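/- Conventions. All manifolds and Lie groups are smooth and finite dimensional; $M$ and $Y$ are Hausdorff and second countable. Let $H$ be a Lie group and let $\mathrm{Lie}(\mathrm{Aut}(H))$ be the tangent space at the identity of the group of smooth automorphisms of $H$; for $X\in \mathrm{Lie}(\mathrm{Aut}(H))$ put $T_X(h)=[h\,e^{tX}(h^{-1})]\in\mathrm{Lie}(H)$, where $[\,\cdot\,]$ is the tangent vector at $t=0$ of a curve. Bibundles. A principal $H$-bibundle $p:E\to B$ is a manifold over $B$ with commuting left and right actions of $H$, each making it a principal $H$-bundle over $B$. It determines $\varphi:E\to\mathrm{Aut}(H)$ by $\varphi_e(h)\,e=e\triangleleft h$. The product $E_1E_2$ of two $H$-bibundles over $B$ is the quotient of the fibre product $E_1\oplus E_2$ by $(e,h\tilde e)\sim(e\triangleleft h,\tilde e)$, with left action on the first factor and right action on the second; $\pi_\oplus:E_1\oplus E_2\to E_1E_2$ is the quotient map and $\pi_1,\pi_2$ are the projections of $E_1\oplus E_2$. 2-connections. A 2-connection on $E$ is a pair $(\mathbf a,A)$ of a $\mathrm{Lie}(H)$-valued one-form $\mathbf a$ on $E$ and a $\mathrm{Lie}(\mathrm{Aut}(H))$-valued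 one-form $A$ on $B$, both smooth, such that $\mathbf a([g(t)e])=-[g(t)]$ for curves $g(t)$ in $H$ through $1$, and $l_h^*\mathbf a=\mathrm{Ad}_h\,\mathbf a+p^*T_A(h)$ for $h\in H$, where $l_h$ is left translation by $h$. Let $A^r$ be the one-form on $B$ with $p^*A^r=\varphi^{-1}(p^*A+\mathrm{ad}_{\mathbf a})\varphi+\varphi^{-1}d\varphi$. Two 2-connections $(\mathbf a_1,A_1)$ on $E_1$ and $(\mathbf a_2,A_2)$ on $E_2$ are summable if $A_2=A_1^r$. Their sum is then $(\mathbf a_1\dotplus\mathbf a_2,A_1)$, where $\mathbf a_1\dotplus\mathbf a_2$ is the one-form on $E_1E_2$ with $\pi_\oplus^*(\mathbf a_1\dotplus\mathbf a_2)=\pi_1^*\mathbf a_1+\varphi_1(\pi_2^*\mathbf a_2)$; here $\varphi_1$ is the map $\varphi$ of $E_1$, acting on $\mathrm{Lie}(H)$ by differentials. Bundle gerbes. Let $\wp:Y\to M$ be a surjective submersion and let $Y^{[k]}$ be the $k$-fold fibre product of $Y$ over $M$. For an $H$-bibundle $\mathcal E\to Y^{[2]}$ let $\mathcal E_{ij}$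 denote its pull-back along the projection $p_{ij}$ from $Y^{[3]}$ or $Y^{[4]}$ to $Y^{[2]}$; pulled-back forms are written with the same indices. A (nonabelian) bundle gerbe $(\mathcal E,Y,M,\mathbf f)$ consists of an $H$-bibundle $\mathcal E\to Y^{[2]}$ and an isomorphism of bibundles $f:\mathcal E_{12}\mathcal E_{23}\to\mathcal E_{13}$ over $Y^{[3]}$ (equivalently, a global central section of $(\mathcal E_{12}\mathcal E_{23}\mathcal E_{13}^{-1})^{-1}$) satisfying the cocycle condition that the two isomorphisms $\mathcal E_{12}\mathcal E_{23}\mathcal E_{34}\to\mathcal E_{14}$ over $Y^{[4]}$ built from $f$, one through $\mathcal E_{13}\mathcal E_{34}$ and one through $\mathcal E_{12}\mathcal E_{24}$, coincide. A bundle gerbe connection on it is a 2-connection $(\mathbf a,A)$ on $\mathcal E\to Y^{[2]}$ such that $(\mathbf a_{12},A_{12})$ and $(\mathbf a_{23},A_{23})$ are summable and their sum is the pull-back of $(\mathbf a_{13},A_{13})$ by $f$, that is $$A_{23}=(A_{12})^r,\qquad \mathbf a_{12}\dotplus\mathbf a_{23}=f^*\mathbf a_{13},\qquad A_{12}=A_{13}.$$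 Theorem. Every bundle gerbe $(\mathcal E,Y,M,\mathbf f)$ admits a bundle gerbe connection $(\mathbf a,A)$. -/

import Mathlib

open Set Function Manifold
open scoped Manifold ContDiff

noncomputable section

/-- A smooth submersion `Z → M`. -/
structure Submersion (F EZ EM : Type*) [NormedAddCommGroup F] [NormedSpace ℝ F]
    [NormedAddCommGroup EZ] [NormedSpace ℝ EZ] [NormedAddCommGroup EM] [NormedSpace ℝ EM]
    (Z M : Type*) [TopologicalSpace Z] [ChartedSpace EZ Z] [TopologicalSpace M]
    [ChartedSpace EM M] where
  toFun : Z → M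
  isSubmersion : IsSubmersionOfComplement F 𝓘(ℝ, EZ) 𝓘(ℝ, EM) ∞ toFun

section FibProd

variable {EX EZ EM F EW X Z M W : Type*}
  [NormedAddCommGroup EX] [NormedSpace ℝ EX] [NormedAddCommGroup EZ] [NormedSpace ℝ EZ]
  [NormedAddCommGroup EM] [NormedSpace ℝ EM] [NormedAddCommGroup F] [NormedSpace ℝ F]
  [NormedAddCommGroup EW] [NormedSpace ℝ EW]
  [TopologicalSpace X] [ChartedSpace EX X] [TopologicalSpace Z] [ChartedSpace EZ Z]
  [TopologicalSpace M] [ChartedSpace EM M] [TopologicalSpace W] [ChartedSpace EW W]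

/-- The underlying smooth map. -/
def Submersion.toMap [IsManifold 𝓘(ℝ, EZ) ∞ Z] [IsManifold 𝓘(ℝ, EM) ∞ M]
    (g : Submersion F EZ EM Z M) : C^∞⟮𝓘(ℝ, EZ), Z; 𝓘(ℝ, EM), M⟯ :=
  ⟨g.toFun, g.isSubmersion.contMDiff⟩

/-- The fibre product `X ×_M Z` of a smooth map `f` and a submersion `g`. -/
@[ext] structure FibProd (f : C^∞⟮𝓘(ℝ, EX), X; 𝓘(ℝ, EM), M⟯) (g : Submersion F EZ EM Z M) where
  fst : X
  snd : Z
  comm : f fst = g.toFun snd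

namespace FibProd

variable {f : C^∞⟮𝓘(ℝ, EX), X; 𝓘(ℝ, EM), M⟯} {g : Submersion F EZ EM Z M}

/-- The fibre product as a subset of the product. -/
def toProd (q : FibProd f g) : X × Z := (q.fst, q.snd)

/-- The fibre product carries the subspace topology. -/
instance : TopologicalSpace (FibProd f g) := TopologicalSpace.induced toProd inferInstance

theorem continuous_toProd : Continuous (toProd : FibProd f g → X × Z) := continuous_induced_dom

theorem continuous_fst : Continuous (fst : FibProd f g → X) :=
  _root_.continuous_fst.comp continuous_toProd

theorem continuous_snd : Continuous (snd : FibProd f g → Z) :=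
  _root_.continuous_snd.comp continuous_toProd

section Chart

variable (q : FibProd f g)

/-- Submersion chart of `Z` at the second component. -/
def domC : OpenPartialHomeomorph Z EZ := (g.isSubmersion q.snd).domChart
/-- Submersion chart of `M` at the base point. -/
def codC : OpenPartialHomeomorph M EM := (g.isSubmersion q.snd).codChart
/-- The splitting of the model space of `Z` in the submersion charts. -/
def splitC : EZ ≃L[ℝ] (EM × F) := (g.isSubmersion q.snd).equiv

theorem dom_cod {z : Z} (hz : z ∈ q.domC.source) : g.toFun z ∈ q.codC.source :=
  (g.isSubmersion q.snd).source_subset_preimage_source hz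

theorem cod_apply {z : Z} (hz : z ∈ q.domC.source) :
    q.codC (g.toFun z) = (q.splitC (q.domC z)).1 := by
  have hm : q.domC z ∈ (q.domC.extend 𝓘(ℝ, EZ)).target := by
    rw [OpenPartialHomeomorph.extend_target]
    exact ⟨q.domC.map_source hz, by simp⟩
  have h := (g.isSubmersion q.snd).writtenInCharts hm
  have h2 : (g.isSubmersion q.snd).domChart.symm (q.domC z) = z := q.domC.left_inv hz
  simpa [h2, codC, splitC] using h

/-- The second component of the inverse chart, in the submersion chart of `Z`. -/
def lift (p : EX × F) : EZ :=
  q.splitC.symm (q.codC (f ((chartAt EX q.fst).symm p.1)), p.2)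

/-- Domain of the inverse chart. -/
def tgt : Set (EX × F) :=
  {p | p.1 ∈ (chartAt EX q.fst).target ∧ f ((chartAt EX q.fst).symm p.1) ∈ q.codC.source ∧
    q.lift p ∈ q.domC.target}

theorem tgt_spec {p : EX × F} (hp : p ∈ q.tgt) :
    f ((chartAt EX q.fst).symm p.1) = g.toFun (q.domC.symm (q.lift p)) := by
  obtain ⟨h1, h2, h3⟩ := hp
  have hz := q.domC.map_target h3
  refine q.codC.injOn h2 (q.dom_cod hz) ?_
  rw [q.cod_apply hz, q.domC.right_inv h3]
  simp [lift]

variable [IsManifold 𝓘(ℝ, EX) ∞ X]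

theorem contMDiffOn_chart_symm_fst :
    ContMDiffOn 𝓘(ℝ, EX × F) 𝓘(ℝ, EX) ∞
      (fun p : EX × F => (chartAt EX q.fst).symm p.1) {p | p.1 ∈ (chartAt EX q.fst).target} :=
  (contMDiffOn_chart_symm (I := 𝓘(ℝ, EX)) (x := q.fst)).comp
    (contDiff_fst.contMDiff.contMDiffOn) (fun _ h => h)

theorem contMDiffOn_lift :
    ContMDiffOn 𝓘(ℝ, EX × F) 𝓘(ℝ, EZ) ∞ q.lift
      {p | p.1 ∈ (chartAt EX q.fst).target ∧
        f ((chartAt EX q.fst).symm p.1) ∈ q.codC.source} := by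
  have h1 : ContMDiffOn 𝓘(ℝ, EX × F) 𝓘(ℝ, EM) ∞
      (fun p : EX × F => q.codC (f ((chartAt EX q.fst).symm p.1)))
      {p | p.1 ∈ (chartAt EX q.fst).target ∧
        f ((chartAt EX q.fst).symm p.1) ∈ q.codC.source} :=
    (contMDiffOn_of_mem_maximalAtlas (I := 𝓘(ℝ, EM)) (n := ∞)
      (g.isSubmersion q.snd).codChart_mem_maximalAtlas).comp
      (f.contMDiff.comp_contMDiffOn ((q.contMDiffOn_chart_symm_fst).mono fun _ h => h.1))
      (fun _ h => h.2)
  have h2 : ContMDiffOn 𝓘(ℝ, EX × F) 𝓘(ℝ, F) ∞ (fun p : EX × F => p.2)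
      {p | p.1 ∈ (chartAt EX q.fst).target ∧
        f ((chartAt EX q.fst).symm p.1) ∈ q.codC.source} :=
    contDiff_snd.contMDiff.contMDiffOn
  exact (q.splitC.symm.contDiff (n := ∞)).contMDiff.comp_contMDiffOn (h1.prodMk_space h2)

theorem isOpen_pre : IsOpen {p : EX × F | p.1 ∈ (chartAt EX q.fst).target ∧
    f ((chartAt EX q.fst).symm p.1) ∈ q.codC.source} :=
  (f.contMDiff.continuous.comp_continuousOn
    q.contMDiffOn_chart_symm_fst.continuousOn).isOpen_inter_preimage
    ((chartAt EX q.fst).open_target.preimage _root_.continuous_fst) q.codC.open_source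

theorem isOpen_tgt : IsOpen q.tgt := by
  have := q.contMDiffOn_lift.continuousOn.isOpen_inter_preimage q.isOpen_pre
    q.domC.open_target
  convert this using 1
  ext p
  simp [tgt, and_assoc]

open scoped Classical in
/-- The chart of the fibre product at `q`. -/
def chart : OpenPartialHomeomorph (FibProd f g) (EX × F) where
  toFun r := (chartAt EX q.fst r.fst, (q.splitC (q.domC r.snd)).2)
  invFun p := if hp : p ∈ q.tgt then ⟨_, _, q.tgt_spec hp⟩ else q
  source := {r | r.fst ∈ (chartAt EX q.fst).source ∧ r.snd ∈ q.domC.source}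
  target := q.tgt
  map_source' := by
    rintro r ⟨h1, h2⟩
    have h3 := q.cod_apply h2
    have h4 : (chartAt EX q.fst).symm (chartAt EX q.fst r.fst) = r.fst :=
      (chartAt EX q.fst).left_inv h1
    refine ⟨(chartAt EX q.fst).map_source h1, ?_, ?_⟩
    · simpa only [h4, r.comm] using q.dom_cod h2
    · simp only [lift, h4, r.comm, h3, Prod.mk.eta, ContinuousLinearEquiv.symm_apply_apply]
      exact q.domC.map_source h2
  map_target' := by
    intro p hp
    simp only [dif_pos hp]
    exact ⟨(chartAt EX q.fst).map_target hp.1, q.domC.map_target hp.2.2⟩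
  left_inv' := by
    rintro r ⟨h1, h2⟩
    have h3 := q.cod_apply h2
    have h4 : (chartAt EX q.fst).symm (chartAt EX q.fst r.fst) = r.fst :=
      (chartAt EX q.fst).left_inv h1
    have h5 : q.lift (chartAt EX q.fst r.fst, (q.splitC (q.domC r.snd)).2) = q.domC r.snd := by
      simp only [lift, h4, r.comm, h3, Prod.mk.eta, ContinuousLinearEquiv.symm_apply_apply]
    have h6 : (chartAt EX q.fst r.fst, (q.splitC (q.domC r.snd)).2) ∈ q.tgt := by
      refine ⟨(chartAt EX q.fst).map_source h1, ?_, ?_⟩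
      · simpa only [h4, r.comm] using q.dom_cod h2
      · rw [h5]; exact q.domC.map_source h2
    rw [dif_pos h6]
    refine FibProd.ext h4 ?_
    change q.domC.symm (q.lift _) = r.snd
    rw [h5, q.domC.left_inv h2]
  right_inv' := by
    intro p hp
    simp only [dif_pos hp]
    refine Prod.ext ((chartAt EX q.fst).right_inv hp.1) ?_
    rw [q.domC.right_inv hp.2.2, lift, ContinuousLinearEquiv.apply_symm_apply]
  open_source := ((chartAt EX q.fst).open_source.preimage continuous_fst).inter
    (q.domC.open_source.preimage continuous_snd)
  open_target := q.isOpen_tgt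
  continuousOn_toFun := by
    refine ContinuousOn.prodMk ?_ ?_
    · exact (chartAt EX q.fst).continuousOn.comp continuous_fst.continuousOn fun _ h => h.1
    · exact (_root_.continuous_snd.comp q.splitC.continuous).comp_continuousOn
        (q.domC.continuousOn.comp continuous_snd.continuousOn fun _ h => h.2)
  continuousOn_invFun := by
    rw [continuousOn_iff_continuous_domRestrict]
    refine continuous_induced_rng.2 ?_
    have h1 : ContinuousOn (fun p : EX × F => ((chartAt EX q.fst).symm p.1,
        q.domC.symm (q.lift p))) q.tgt :=
      (q.contMDiffOn_chart_symm_fst.continuousOn.mono fun _ h => h.1).prodMk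
        (q.domC.continuousOn_symm.comp
          (q.contMDiffOn_lift.continuousOn.mono fun _ h => ⟨h.1, h.2.1⟩) fun _ h => h.2.2)
    convert continuousOn_iff_continuous_domRestrict.1 h1 using 1
    ext p
    · simp [toProd, domRestrict]
    · simp [toProd, domRestrict]

theorem mem_source_chart : q ∈ q.chart.source :=
  ⟨_root_.mem_chart_source EX q.fst, (g.isSubmersion q.snd).mem_domChart_source⟩

theorem fst_chart_symm {p : EX × F} (hp : p ∈ q.tgt) :
    (q.chart.symm p).fst = (chartAt EX q.fst).symm p.1 := by
  classical
  exact congrArg fst (dif_pos hp)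

theorem snd_chart_symm {p : EX × F} (hp : p ∈ q.tgt) :
    (q.chart.symm p).snd = q.domC.symm (q.lift p) := by
  classical
  exact congrArg snd (dif_pos hp)

end Chart

instance instChartedSpace [IsManifold 𝓘(ℝ, EX) ∞ X] :
    @ChartedSpace (EX × F) PseudoMetricSpace.toUniformSpace.toTopologicalSpace (FibProd f g) _ where
  atlas := range fun q : FibProd f g => q.chart
  chartAt q := q.chart
  mem_chart_source q := q.mem_source_chart
  chart_mem_atlas := fun q => mem_range_self q

variable [IsManifold 𝓘(ℝ, EX) ∞ X]

theorem contMDiffOn_fst_symm (q : FibProd f g) :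
    ContMDiffOn 𝓘(ℝ, EX × F) 𝓘(ℝ, EX) ∞ (fun p => (q.chart.symm p).fst) q.tgt :=
  (q.contMDiffOn_chart_symm_fst.mono fun _ h => h.1).congr fun _ h => q.fst_chart_symm h

theorem contMDiffOn_snd_symm (q : FibProd f g) :
    ContMDiffOn 𝓘(ℝ, EX × F) 𝓘(ℝ, EZ) ∞ (fun p => (q.chart.symm p).snd) q.tgt :=
  ((contMDiffOn_symm_of_mem_maximalAtlas (I := 𝓘(ℝ, EZ)) (n := ∞)
    (g.isSubmersion q.snd).domChart_mem_maximalAtlas).comp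
    (q.contMDiffOn_lift.mono fun _ h => ⟨h.1, h.2.1⟩) fun _ h => h.2.2).congr
    fun _ h => q.snd_chart_symm h

/-- A chart of the fibre product is smooth along a map with smooth components. -/
theorem contMDiffOn_chart_comp {IH : Type*} [TopologicalSpace IH] {J : ModelWithCorners ℝ EW IH}
    {W : Type*} [TopologicalSpace W] [ChartedSpace IH W] {s : Set W}
    {h : W → FibProd f g} (q : FibProd f g)
    (h1 : ContMDiffOn J 𝓘(ℝ, EX) ∞ (fun w => (h w).fst) s)
    (h2 : ContMDiffOn J 𝓘(ℝ, EZ) ∞ (fun w => (h w).snd) s)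
    (hs : MapsTo h s q.chart.source) :
    ContMDiffOn J 𝓘(ℝ, EX × F) ∞ (fun w => q.chart (h w)) s := by
  refine ContMDiffOn.prodMk_space (f := fun w => chartAt EX q.fst (h w).fst)
    (g := fun w => (q.splitC (q.domC (h w).snd)).2) ?_ ?_
  · exact (contMDiffOn_chart (I := 𝓘(ℝ, EX)) (x := q.fst)).comp h1 fun _ hw => (hs hw).1
  · exact ((contDiff_snd.comp q.splitC.contDiff).contMDiff).comp_contMDiffOn
      ((contMDiffOn_of_mem_maximalAtlas (I := 𝓘(ℝ, EZ)) (n := ∞)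
        (g.isSubmersion q.snd).domChart_mem_maximalAtlas).comp h2 fun _ hw => (hs hw).2)

instance instIsManifold : IsManifold 𝓘(ℝ, EX × F) ∞ (FibProd f g) := by
  apply isManifold_of_contDiffOn
  rintro _ _ ⟨q, rfl⟩ ⟨r, rfl⟩
  rw [← contMDiffOn_iff_contDiffOn]
  have hsub : ((q.chart.symm ≫ₕ r.chart).source : Set (EX × F)) ⊆ q.tgt := fun p hp => hp.1
  have := contMDiffOn_chart_comp (h := fun p => q.chart.symm p)
    (s := (q.chart.symm ≫ₕ r.chart).source) r
    (q.contMDiffOn_fst_symm.mono hsub) (q.contMDiffOn_snd_symm.mono hsub) (fun p hp => hp.2)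
  convert this using 1
  · rfl
  · rfl
  · rfl
  · exact (inter_eq_left.2 fun p _ => ⟨p, rfl⟩)

theorem contMDiff_fst : ContMDiff 𝓘(ℝ, EX × F) 𝓘(ℝ, EX) ∞ (fst : FibProd f g → X) := by
  intro q
  have h := (q.contMDiffOn_fst_symm).comp (contMDiffOn_chart (I := 𝓘(ℝ, EX × F)) (n := ∞) (x := q))
    (fun r hr => q.chart.map_source hr)
  exact (h.congr fun r hr => by
    simp only [Function.comp]
    exact congrArg fst (q.chart.left_inv hr).symm).contMDiffAt
      (q.chart.open_source.mem_nhds q.mem_source_chart)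

theorem contMDiff_snd : ContMDiff 𝓘(ℝ, EX × F) 𝓘(ℝ, EZ) ∞ (snd : FibProd f g → Z) := by
  intro q
  have h := (q.contMDiffOn_snd_symm).comp (contMDiffOn_chart (I := 𝓘(ℝ, EX × F)) (n := ∞) (x := q))
    (fun r hr => q.chart.map_source hr)
  exact (h.congr fun r hr => by
    simp only [Function.comp]
    exact congrArg snd (q.chart.left_inv hr).symm).contMDiffAt
      (q.chart.open_source.mem_nhds q.mem_source_chart)

/-- A map into a fibre product with smooth components is smooth. -/
theorem contMDiff_of_comp {IH : Type*} [TopologicalSpace IH] {J : ModelWithCorners ℝ EW IH}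
    {W : Type*} [TopologicalSpace W] [ChartedSpace IH W]
    {h : W → FibProd f g} (h1 : ContMDiff J 𝓘(ℝ, EX) ∞ (fun w => (h w).fst))
    (h2 : ContMDiff J 𝓘(ℝ, EZ) ∞ (fun w => (h w).snd)) :
    ContMDiff J 𝓘(ℝ, EX × F) ∞ h := by
  have hc : Continuous h := continuous_induced_rng.2 (h1.continuous.prodMk h2.continuous)
  intro w
  have hs : IsOpen (h ⁻¹' (h w).chart.source) := (h w).chart.open_source.preimage hc
  have h3 := contMDiffOn_chart_comp (h w) h1.contMDiffOn h2.contMDiffOn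
    (mapsTo_preimage h (h w).chart.source)
  have h4 := (contMDiffOn_chart_symm (I := 𝓘(ℝ, EX × F)) (n := ∞) (x := h w)).comp h3
    (fun v hv => (h w).chart.map_source hv)
  exact (h4.congr fun v hv => ((h w).chart.left_inv hv).symm).contMDiffAt
    (hs.mem_nhds (h w).mem_source_chart)

/-- The first projection of a fibre product is a submersion. -/
theorem isSubmersion_fst :
    IsSubmersionOfComplement F 𝓘(ℝ, EX × F) 𝓘(ℝ, EX) ∞ (fst : FibProd f g → X) := by
  intro q
  refine IsSubmersionAtOfComplement.mk_of_charts (ContinuousLinearEquiv.refl ℝ (EX × F))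
    q.chart (chartAt EX q.fst) q.mem_source_chart (_root_.mem_chart_source EX q.fst)
    (IsManifold.chart_mem_maximalAtlas q) (IsManifold.chart_mem_maximalAtlas q.fst)
    (fun r hr => hr.1) ?_
  intro p hp
  have hp' : p ∈ q.tgt := by
    rw [OpenPartialHomeomorph.extend_target] at hp
    exact hp.1
  simp [q.fst_chart_symm hp', (chartAt EX q.fst).right_inv hp'.1]

end FibProd

/-- The pull-back of a submersion along a smooth map. -/
def Submersion.pullback [IsManifold 𝓘(ℝ, EX) ∞ X] (g : Submersion F EZ EM Z M)
    (f : C^∞⟮𝓘(ℝ, EX), X; 𝓘(ℝ, EM), M⟯) : Submersion F (EX × F) EX (FibProd f g) X :=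
  ⟨FibProd.fst, FibProd.isSubmersion_fst⟩

/-- The canonical map `(f^* Z) ×_X (f^* Z) → Z ×_M Z`. -/
def FibProd.pullbackSelf [IsManifold 𝓘(ℝ, EX) ∞ X] [IsManifold 𝓘(ℝ, EZ) ∞ Z]
    [IsManifold 𝓘(ℝ, EM) ∞ M] {g : Submersion F EZ EM Z M}
    {f : C^∞⟮𝓘(ℝ, EX), X; 𝓘(ℝ, EM), M⟯} (q : FibProd (g.pullback f).toMap (g.pullback f)) :
    FibProd g.toMap g :=
  ⟨q.fst.snd, q.snd.snd, (q.fst.comm.symm.trans (congrArg f q.comm)).trans q.snd.comm⟩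

theorem FibProd.contMDiff_pullbackSelf [IsManifold 𝓘(ℝ, EX) ∞ X] [IsManifold 𝓘(ℝ, EZ) ∞ Z]
    [IsManifold 𝓘(ℝ, EM) ∞ M] {g : Submersion F EZ EM Z M}
    {f : C^∞⟮𝓘(ℝ, EX), X; 𝓘(ℝ, EM), M⟯} :
    ContMDiff 𝓘(ℝ, (EX × F) × F) 𝓘(ℝ, EZ × F) ∞
      (FibProd.pullbackSelf : FibProd (g.pullback f).toMap (g.pullback f) → FibProd g.toMap g) :=
  FibProd.contMDiff_of_comp
    ((FibProd.contMDiff_snd (f := f) (g := g)).comp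
      (FibProd.contMDiff_fst (f := (g.pullback f).toMap) (g := g.pullback f)))
    ((FibProd.contMDiff_snd (f := f) (g := g)).comp
      (FibProd.contMDiff_snd (f := (g.pullback f).toMap) (g := g.pullback f)))

end FibProd


section LieGroup

variable {EH : Type*} [NormedAddCommGroup EH] [NormedSpace ℝ EH]
  {H : Type*} [TopologicalSpace H] [ChartedSpace EH H] [Group H]

/-- A smooth curve through the identity in the group `Aut(H)` of smooth automorphisms of `H`. -/
structure IsAutCurve (EH : Type*) [NormedAddCommGroup EH] [NormedSpace ℝ EH]
    {H : Type*} [TopologicalSpace H] [ChartedSpace EH H] [Group H] (c : ℝ → H ≃* H) : Prop where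
  zero : ∀ h, c 0 h = h
  smooth_symm : ∀ t, ContMDiff 𝓘(ℝ, EH) 𝓘(ℝ, EH) ∞ (c t).symm
  smooth : ContMDiff (𝓘(ℝ, ℝ).prod 𝓘(ℝ, EH)) 𝓘(ℝ, EH) ∞ (fun p : ℝ × H => c p.1 p.2)

/-- The velocity at `t = 0` of a curve in `Aut(H)`, a vector field on `H`. -/
def autVelocity (EH : Type*) [NormedAddCommGroup EH] [NormedSpace ℝ EH]
    {H : Type*} [TopologicalSpace H] [ChartedSpace EH H] [Group H] (c : ℝ → H ≃* H) (h : H) :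
    TangentSpace 𝓘(ℝ, EH) h :=
  mfderiv 𝓘(ℝ, ℝ) 𝓘(ℝ, EH) (fun t => c t h) 0 (1 : ℝ)

theorem IsAutCurve.contMDiff_apply {c : ℝ → H ≃* H} (hc : IsAutCurve EH c) (h : H) :
    ContMDiff 𝓘(ℝ, ℝ) 𝓘(ℝ, EH) ∞ (fun t => c t h) :=
  hc.smooth.comp (contMDiff_id.prodMk contMDiff_const)

theorem IsAutCurve.refl : IsAutCurve EH (fun _ => MulEquiv.refl H) where
  zero _ := rfl
  smooth_symm _ := contMDiff_id
  smooth := contMDiff_snd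

theorem autVelocity_refl (h : H) : autVelocity EH (fun _ => MulEquiv.refl H) h = 0 := by
  unfold autVelocity
  rw [show (fun t : ℝ => (fun _ => MulEquiv.refl H : ℝ → H ≃* H) t h) = fun _ => h from rfl,
    mfderiv_const]
  rfl

theorem IsAutCurve.scale {c : ℝ → H ≃* H} (hc : IsAutCurve EH c) (r : ℝ) :
    IsAutCurve EH (fun t => c (r * t)) where
  zero h := by simpa using hc.zero h
  smooth_symm t := hc.smooth_symm _
  smooth := hc.smooth.comp
    (((contDiff_const.mul contDiff_id).contMDiff.comp contMDiff_fst).prodMk contMDiff_snd)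

theorem autVelocity_scale {c : ℝ → H ≃* H} (hc : IsAutCurve EH c) (r : ℝ) (h : H) :
    autVelocity EH (fun t => c (r * t)) h = r • autVelocity EH c h := by
  have h1 : HasMFDerivAt 𝓘(ℝ, ℝ) 𝓘(ℝ, EH) (fun t => c t h) (r * 0)
      (mfderiv 𝓘(ℝ, ℝ) 𝓘(ℝ, EH) (fun t => c t h) (r * 0)) :=
    ((hc.contMDiff_apply h).mdifferentiable (by simp) _).hasMFDerivAt
  have h2 : HasMFDerivAt 𝓘(ℝ, ℝ) 𝓘(ℝ, ℝ) (fun t : ℝ => r * t) 0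
      (r • ContinuousLinearMap.id ℝ ℝ) :=
    ((hasFDerivAt_id (𝕜 := ℝ) (0 : ℝ)).const_mul r).hasMFDerivAt
  have h3 := (h1.comp 0 h2).mfderiv
  unfold autVelocity
  have h4 : mfderiv 𝓘(ℝ, ℝ) 𝓘(ℝ, EH) (fun t => c (r * t) h) 0 (1 : ℝ) =
    mfderiv 𝓘(ℝ, ℝ) 𝓘(ℝ, EH) (fun t => c t h) (r * 0) (r • (1 : ℝ)) :=
    congrArg (fun L => L (1 : ℝ)) h3
  rw [h4]
  have h5 : r * 0 = 0 := mul_zero r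
  rw [h5]
  exact (mfderiv 𝓘(ℝ, ℝ) 𝓘(ℝ, EH) (fun t => c t h) 0).map_smul r (1 : ℝ)

theorem IsAutCurve.comp {c d : ℝ → H ≃* H} (hc : IsAutCurve EH c) (hd : IsAutCurve EH d) :
    IsAutCurve EH (fun t => (d t).trans (c t)) where
  zero h := by simp [hc.zero, hd.zero]
  smooth_symm t := (hd.smooth_symm t).comp (hc.smooth_symm t)
  smooth := hc.smooth.comp (contMDiff_fst.prodMk hd.smooth)

theorem autVelocity_comp {c d : ℝ → H ≃* H} (hc : IsAutCurve EH c) (hd : IsAutCurve EH d)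
    (h : H) :
    autVelocity EH (fun t => (d t).trans (c t)) h = autVelocity EH c h + autVelocity EH d h := by
  have hG : ContMDiff 𝓘(ℝ, ℝ × ℝ) 𝓘(ℝ, EH) ∞ (fun p : ℝ × ℝ => c p.1 (d p.2 h)) :=
    hc.smooth.comp (contDiff_fst.contMDiff.prodMk
      ((hd.contMDiff_apply h).comp contDiff_snd.contMDiff))
  have h1 := (hG.mdifferentiable (by simp) ((0 : ℝ), (0 : ℝ))).hasMFDerivAt
  set D := mfderiv 𝓘(ℝ, ℝ × ℝ) 𝓘(ℝ, EH) (fun p : ℝ × ℝ => c p.1 (d p.2 h)) ((0 : ℝ), (0 : ℝ))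
  let idl := ContinuousLinearMap.id ℝ ℝ
  have k1 : HasMFDerivAt 𝓘(ℝ, ℝ) 𝓘(ℝ, ℝ × ℝ) (fun t : ℝ => (t, t)) 0 (idl.prod idl) :=
    ((hasFDerivAt_id (𝕜 := ℝ) (0 : ℝ)).prodMk (hasFDerivAt_id (𝕜 := ℝ) (0 : ℝ))).hasMFDerivAt
  have k2 : HasMFDerivAt 𝓘(ℝ, ℝ) 𝓘(ℝ, ℝ × ℝ) (fun t : ℝ => (t, (0 : ℝ))) 0 (idl.prod 0) :=
    ((hasFDerivAt_id (𝕜 := ℝ) (0 : ℝ)).prodMk (hasFDerivAt_const (0 : ℝ) (0 : ℝ))).hasMFDerivAt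
  have k3 : HasMFDerivAt 𝓘(ℝ, ℝ) 𝓘(ℝ, ℝ × ℝ) (fun t : ℝ => ((0 : ℝ), t)) 0
      ((0 : ℝ →L[ℝ] ℝ).prod idl) :=
    ((hasFDerivAt_const (0 : ℝ) (0 : ℝ)).prodMk (hasFDerivAt_id (𝕜 := ℝ) (0 : ℝ))).hasMFDerivAt
  have e1 : (fun t => (d t).trans (c t) h) =
      (fun p : ℝ × ℝ => c p.1 (d p.2 h)) ∘ fun t : ℝ => (t, t) := rfl
  have l1 : autVelocity EH (fun t => (d t).trans (c t)) h = D ((1 : ℝ), (1 : ℝ)) := by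
    unfold autVelocity
    rw [e1]
    exact congrArg (fun L => L (1 : ℝ)) (HasMFDerivAt.comp (f := fun t : ℝ => (t, t)) (0 : ℝ) h1 k1).mfderiv
  have e2 : (fun t => c t h) = (fun p : ℝ × ℝ => c p.1 (d p.2 h)) ∘ fun t : ℝ => (t, (0 : ℝ)) := by
    funext t; simp [hd.zero]
  have l2 : autVelocity EH c h = D ((1 : ℝ), (0 : ℝ)) := by
    unfold autVelocity
    rw [e2]
    exact congrArg (fun L => L (1 : ℝ)) (HasMFDerivAt.comp (f := fun t : ℝ => (t, (0 : ℝ))) (0 : ℝ) h1 k2).mfderiv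
  have e3 : (fun t => d t h) = (fun p : ℝ × ℝ => c p.1 (d p.2 h)) ∘ fun t : ℝ => ((0 : ℝ), t) := by
    funext t; simp [hc.zero]
  have l3 : autVelocity EH d h = D ((0 : ℝ), (1 : ℝ)) := by
    unfold autVelocity
    rw [e3]
    exact congrArg (fun L => L (1 : ℝ)) (HasMFDerivAt.comp (f := fun t : ℝ => ((0 : ℝ), t)) (0 : ℝ) h1 k3).mfderiv
  rw [l1, l2, l3]
  have : (((1 : ℝ), (1 : ℝ)) : ℝ × ℝ) = ((1 : ℝ), (0 : ℝ)) + ((0 : ℝ), (1 : ℝ)) := by simp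
  rw [this]
  exact D.map_add ((1 : ℝ), (0 : ℝ)) ((0 : ℝ), (1 : ℝ))

/-- `Lie(Aut(H))`: the tangent space at the identity of the group of smooth automorphisms of `H`.
A tangent vector is recorded as the vector field `h ↦ d/dt c_t(h)` on `H`. -/
def LieAut (EH H : Type*) [NormedAddCommGroup EH] [NormedSpace ℝ EH]
    [TopologicalSpace H] [ChartedSpace EH H] [Group H] :
    Submodule ℝ (∀ h : H, TangentSpace 𝓘(ℝ, EH) h) where
  carrier := {X | ∃ c : ℝ → H ≃* H, IsAutCurve EH c ∧ X = autVelocity EH c}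
  zero_mem' := ⟨_, IsAutCurve.refl, funext fun h => (autVelocity_refl h).symm⟩
  add_mem' := by
    rintro _ _ ⟨c, hc, rfl⟩ ⟨d, hd, rfl⟩
    exact ⟨_, hc.comp hd, funext fun h => (autVelocity_comp hc hd h).symm⟩
  smul_mem' := by
    rintro r _ ⟨c, hc, rfl⟩
    exact ⟨_, hc.scale r, funext fun h => (autVelocity_scale hc r h).symm⟩

/-- The adjoint action of `h` on `Lie(H)`. -/
def lieAd (EH : Type*) [NormedAddCommGroup EH] [NormedSpace ℝ EH]
    {H : Type*} [TopologicalSpace H] [ChartedSpace EH H] [Group H] (h : H)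
    (ξ : GroupLieAlgebra 𝓘(ℝ, EH) H) : GroupLieAlgebra 𝓘(ℝ, EH) H :=
  mfderiv 𝓘(ℝ, EH) 𝓘(ℝ, EH) (fun x : H => h * x * h⁻¹) 1 ξ

/-- The inner derivation `ad_ξ` as an element of `Lie(Aut(H))`: the vector field
`k ↦ d/dt (g_t k g_t⁻¹)` for a curve `g_t` in `H` through `1` with velocity `ξ`. -/
def adField (EH : Type*) [NormedAddCommGroup EH] [NormedSpace ℝ EH]
    {H : Type*} [TopologicalSpace H] [ChartedSpace EH H] [Group H]
    (ξ : GroupLieAlgebra 𝓘(ℝ, EH) H) (k : H) : TangentSpace 𝓘(ℝ, EH) k :=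
  mfderiv 𝓘(ℝ, EH) 𝓘(ℝ, EH) (fun x : H => x * k * x⁻¹) 1 ξ

/-- The cocycle `T_X(h) = [h e^{tX}(h⁻¹)]` of `X ∈ Lie(Aut(H))`. -/
def autCocycle (X : LieAut EH H) (h : H) : GroupLieAlgebra 𝓘(ℝ, EH) H :=
  mfderiv 𝓘(ℝ, EH) 𝓘(ℝ, EH) (fun x : H => h * x) h⁻¹ (X.1 h⁻¹)

end LieGroup

section Bibundle

/-- A principal `H`-bibundle with total space `P` over `B`: a smooth surjective submersion
`proj : P → B` with commuting smooth left and right actions of `H` on `P`, each of which makes `P`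
a principal `H`-bundle over `B`: it preserves the fibres, and is free and transitive on them with
smooth division map (on the left, `ldiv (h e, e) = h`; on the right, `rdiv (e ◁ h, e) = h`). -/
structure Bibundle (EH H EB B EP P : Type*)
    [NormedAddCommGroup EH] [NormedSpace ℝ EH] [TopologicalSpace H] [ChartedSpace EH H] [Group H]
    [NormedAddCommGroup EB] [NormedSpace ℝ EB] [TopologicalSpace B] [ChartedSpace EB B]
    [IsManifold 𝓘(ℝ, EB) ∞ B]
    [NormedAddCommGroup EP] [NormedSpace ℝ EP] [TopologicalSpace P] [ChartedSpace EP P]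
    [IsManifold 𝓘(ℝ, EP) ∞ P] where
  proj : Submersion EH EP EB P B
  surjective_proj : Surjective proj.toFun
  lact : H → P → P
  ract : P → H → P
  one_lact : ∀ e, lact 1 e = e
  mul_lact : ∀ h k e, lact (h * k) e = lact h (lact k e)
  ract_one : ∀ e, ract e 1 = e
  ract_mul : ∀ e h k, ract e (h * k) = ract (ract e h) k
  lact_ract : ∀ k e h, ract (lact k e) h = lact k (ract e h)
  proj_lact : ∀ h e, proj.toFun (lact h e) = proj.toFun e
  proj_ract : ∀ e h, proj.toFun (ract e h) = proj.toFun e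
  contMDiff_lact : ContMDiff (𝓘(ℝ, EH).prod 𝓘(ℝ, EP)) 𝓘(ℝ, EP) ∞ fun q : H × P => lact q.1 q.2
  contMDiff_ract : ContMDiff (𝓘(ℝ, EP).prod 𝓘(ℝ, EH)) 𝓘(ℝ, EP) ∞ fun q : P × H => ract q.1 q.2
  ldiv : FibProd proj.toMap proj → H
  contMDiff_ldiv : ContMDiff 𝓘(ℝ, EP × EH) 𝓘(ℝ, EH) ∞ ldiv
  lact_ldiv : ∀ q, lact (ldiv q) q.snd = q.fst
  ldiv_lact : ∀ h e, ldiv ⟨lact h e, e, proj_lact h e⟩ = h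
  rdiv : FibProd proj.toMap proj → H
  contMDiff_rdiv : ContMDiff 𝓘(ℝ, EP × EH) 𝓘(ℝ, EH) ∞ rdiv
  ract_rdiv : ∀ q, ract q.snd (rdiv q) = q.fst
  rdiv_ract : ∀ e h, rdiv ⟨ract e h, e, proj_ract e h⟩ = h

variable {EH H EB B EC C EP P EQ Q ER R : Type*}
    [NormedAddCommGroup EH] [NormedSpace ℝ EH] [TopologicalSpace H] [ChartedSpace EH H] [Group H]
    [NormedAddCommGroup EB] [NormedSpace ℝ EB] [TopologicalSpace B] [ChartedSpace EB B]
    [IsManifold 𝓘(ℝ, EB) ∞ B]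
    [NormedAddCommGroup EC] [NormedSpace ℝ EC] [TopologicalSpace C] [ChartedSpace EC C]
    [IsManifold 𝓘(ℝ, EC) ∞ C]
    [NormedAddCommGroup EP] [NormedSpace ℝ EP] [TopologicalSpace P] [ChartedSpace EP P]
    [IsManifold 𝓘(ℝ, EP) ∞ P]
    [NormedAddCommGroup EQ] [NormedSpace ℝ EQ] [TopologicalSpace Q] [ChartedSpace EQ Q]
    [IsManifold 𝓘(ℝ, EQ) ∞ Q]
    [NormedAddCommGroup ER] [NormedSpace ℝ ER] [TopologicalSpace R] [ChartedSpace ER R]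
    [IsManifold 𝓘(ℝ, ER) ∞ R]

namespace Bibundle

/-- The map `φ : P × H → H` determined by `φ_e(h) e = e ◁ h`. -/
def phi (E : Bibundle EH H EB B EP P) (e : P) (h : H) : H :=
  E.ldiv ⟨E.ract e h, e, E.proj_ract e h⟩

/-- The pull-back of a bibundle along a smooth map of base manifolds. -/
def pullback (E : Bibundle EH H EB B EP P) (β : C^∞⟮𝓘(ℝ, EC), C; 𝓘(ℝ, EB), B⟯) :
    Bibundle EH H EC C (EC × EH) (FibProd β E.proj) where
  proj := E.proj.pullback β
  surjective_proj c := by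
    obtain ⟨e, he⟩ := E.surjective_proj (β c)
    exact ⟨⟨c, e, he.symm⟩, rfl⟩
  lact h q := ⟨q.fst, E.lact h q.snd, by rw [E.proj_lact, q.comm]⟩
  ract q h := ⟨q.fst, E.ract q.snd h, by rw [E.proj_ract, q.comm]⟩
  one_lact q := FibProd.ext rfl (E.one_lact _)
  mul_lact h k q := FibProd.ext rfl (E.mul_lact _ _ _)
  ract_one q := FibProd.ext rfl (E.ract_one _)
  ract_mul q h k := FibProd.ext rfl (E.ract_mul _ _ _)
  lact_ract k q h := FibProd.ext rfl (E.lact_ract _ _ _)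
  proj_lact _ _ := rfl
  proj_ract _ _ := rfl
  contMDiff_lact := by
    have h1 : ContMDiff (𝓘(ℝ, EH).prod 𝓘(ℝ, EC × EH)) 𝓘(ℝ, EC) ∞
        (fun w : H × FibProd β E.proj => w.2.fst) :=
      (FibProd.contMDiff_fst (f := β) (g := E.proj)).comp contMDiff_snd
    have h2 : ContMDiff (𝓘(ℝ, EH).prod 𝓘(ℝ, EC × EH)) 𝓘(ℝ, EP) ∞
        (fun w : H × FibProd β E.proj => E.lact w.1 w.2.snd) :=
      E.contMDiff_lact.comp (contMDiff_fst.prodMk (FibProd.contMDiff_snd.comp contMDiff_snd))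
    exact FibProd.contMDiff_of_comp h1 h2
  contMDiff_ract := by
    have h1 : ContMDiff (𝓘(ℝ, EC × EH).prod 𝓘(ℝ, EH)) 𝓘(ℝ, EC) ∞
        (fun w : FibProd β E.proj × H => w.1.fst) :=
      (FibProd.contMDiff_fst (f := β) (g := E.proj)).comp contMDiff_fst
    have h2 : ContMDiff (𝓘(ℝ, EC × EH).prod 𝓘(ℝ, EH)) 𝓘(ℝ, EP) ∞
        (fun w : FibProd β E.proj × H => E.ract w.1.snd w.2) :=
      E.contMDiff_ract.comp ((FibProd.contMDiff_snd.comp contMDiff_fst).prodMk contMDiff_snd)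
    exact FibProd.contMDiff_of_comp h1 h2
  ldiv q := E.ldiv q.pullbackSelf
  contMDiff_ldiv := E.contMDiff_ldiv.comp FibProd.contMDiff_pullbackSelf
  lact_ldiv q := FibProd.ext q.comm.symm (E.lact_ldiv q.pullbackSelf)
  ldiv_lact h q := E.ldiv_lact h q.snd
  rdiv q := E.rdiv q.pullbackSelf
  contMDiff_rdiv := E.contMDiff_rdiv.comp FibProd.contMDiff_pullbackSelf
  ract_rdiv q := FibProd.ext q.comm.symm (E.ract_rdiv q.pullbackSelf)
  rdiv_ract q h := E.rdiv_ract q.snd h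

/-- The fibre product `E₁ ⊕ E₂` of two bibundles over `B`. -/
abbrev Sum (E₁ : Bibundle EH H EB B EP P) (E₂ : Bibundle EH H EB B EQ Q) : Type _ :=
  FibProd E₁.proj.toMap E₂.proj

/-- The product bibundle `E₁E₂` is the quotient of `E₁ ⊕ E₂` by `(e, h e') ∼ (e ◁ h, e')`. -/
def Prod (E₁ : Bibundle EH H EB B EP P) (E₂ : Bibundle EH H EB B EQ Q) : Type _ :=
  Quot fun q r : Sum E₁ E₂ => ∃ h : H, r.fst = E₁.ract q.fst h ∧ q.snd = E₂.lact h r.snd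

namespace Prod

variable {E₁ : Bibundle EH H EB B EP P} {E₂ : Bibundle EH H EB B EQ Q}

/-- The quotient map `π_⊕ : E₁ ⊕ E₂ → E₁E₂`. -/
def mk (q : Sum E₁ E₂) : Prod E₁ E₂ := Quot.mk _ q

/-- The projection of the product bibundle. -/
def proj : Prod E₁ E₂ → B :=
  Quot.lift (fun q => E₁.proj.toFun q.fst) (by
    rintro q r ⟨h, h1, -⟩
    rw [h1, E₁.proj_ract])

/-- The left action `h [e, e'] = [h e, e']`. -/
def lact (h : H) : Prod E₁ E₂ → Prod E₁ E₂ :=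
  Quot.map (fun q => ⟨E₁.lact h q.fst, q.snd, (E₁.proj_lact _ _).trans q.comm⟩) (by
    rintro q r ⟨k, h1, h2⟩
    exact ⟨k, by simp only [h1, E₁.lact_ract], h2⟩)

/-- The right action `[e, e'] ◁ h = [e, e' ◁ h]`. -/
def ract (x : Prod E₁ E₂) (h : H) : Prod E₁ E₂ :=
  Quot.map (fun q : Sum E₁ E₂ =>
      (⟨q.fst, E₂.ract q.snd h, q.comm.trans (E₂.proj_ract _ _).symm⟩ : Sum E₁ E₂)) (by
    rintro q r ⟨k, h1, h2⟩
    exact ⟨k, h1, by simp only [h2, E₂.lact_ract]⟩) x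

end Prod

/-- A morphism `E₁E₂ → E₃` of principal bibundles over `B` (hence an isomorphism). Since `π_⊕` is a
surjective submersion, a map out of `E₁E₂` is smooth iff its composite with `π_⊕` is. -/
structure ProdHom (E₁ : Bibundle EH H EB B EP P) (E₂ : Bibundle EH H EB B EQ Q)
    (E₃ : Bibundle EH H EB B ER R) where
  toFun : Prod E₁ E₂ → R
  contMDiff : ContMDiff 𝓘(ℝ, EP × EH) 𝓘(ℝ, ER) ∞ fun q : Sum E₁ E₂ => toFun (Prod.mk q)
  proj_toFun : ∀ x, E₃.proj.toFun (toFun x) = x.proj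
  map_lact : ∀ h x, toFun (x.lact h) = E₃.lact h (toFun x)
  map_ract : ∀ x h, toFun (x.ract h) = E₃.ract (toFun x) h

end Bibundle

/-- A `Lie(H)`-valued one-form on `P`. -/
abbrev LieForm (EH H EP P : Type*)
    [NormedAddCommGroup EH] [NormedSpace ℝ EH] [TopologicalSpace H] [ChartedSpace EH H] [Group H]
    [NormedAddCommGroup EP] [NormedSpace ℝ EP] [TopologicalSpace P] [ChartedSpace EP P] :=
  ∀ e : P, TangentSpace 𝓘(ℝ, EP) e →L[ℝ] GroupLieAlgebra 𝓘(ℝ, EH) H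

/-- Smoothness of a `Lie(H)`-valued one-form, as a map `TP → Lie(H)`. -/
def LieForm.Smooth (a : LieForm EH H EP P) : Prop :=
  ContMDiff 𝓘(ℝ, EP).tangent 𝓘(ℝ, EH) ∞
    fun v : TangentBundle 𝓘(ℝ, EP) P => (show EH from a v.1 v.2)

/-- Pull-back of a `Lie(H)`-valued one-form. -/
def LieForm.pullback (a : LieForm EH H EP P) (u : Q → P) : LieForm EH H EQ Q :=
  fun w => (a (u w)).comp (mfderiv 𝓘(ℝ, EQ) 𝓘(ℝ, EP) u w)

/-- A `Lie(Aut(H))`-valued one-form on `B`. -/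
abbrev AutForm (EH H EB B : Type*)
    [NormedAddCommGroup EH] [NormedSpace ℝ EH] [TopologicalSpace H] [ChartedSpace EH H] [Group H]
    [NormedAddCommGroup EB] [NormedSpace ℝ EB] [TopologicalSpace B] [ChartedSpace EB B] :=
  ∀ b : B, TangentSpace 𝓘(ℝ, EB) b →ₗ[ℝ] LieAut EH H

/-- Smoothness of a `Lie(Aut(H))`-valued one-form, as the map `TB × H → TH` that evaluates the
vector fields. -/
def AutForm.Smooth [LieGroup 𝓘(ℝ, EH) ∞ H] (A : AutForm EH H EB B) : Prop :=
  ContMDiff (𝓘(ℝ, EB).tangent.prod 𝓘(ℝ, EH)) 𝓘(ℝ, EH).tangent ∞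
    fun p : TangentBundle 𝓘(ℝ, EB) B × H =>
      (⟨p.2, (A p.1.1 p.1.2).1 p.2⟩ : TangentBundle 𝓘(ℝ, EH) H)

/-- Pull-back of a `Lie(Aut(H))`-valued one-form. -/
def AutForm.pullback (A : AutForm EH H EB B) (β : C → B) : AutForm EH H EC C :=
  fun c => (A (β c)).comp (mfderiv 𝓘(ℝ, EC) 𝓘(ℝ, EB) β c).toLinearMap

namespace Bibundle

/-- `(a, A)` is a 2-connection on the bibundle `E`. -/
structure IsTwoConnection [LieGroup 𝓘(ℝ, EH) ∞ H] (E : Bibundle EH H EB B EP P) (a : LieForm EH H EP P)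
    (A : AutForm EH H EB B) : Prop where
  smooth_fst : a.Smooth
  smooth_snd : A.Smooth
  /-- `a [g(t) e] = -[g(t)]`. -/
  vertical : ∀ (e : P) (ξ : GroupLieAlgebra 𝓘(ℝ, EH) H),
    a e (mfderiv 𝓘(ℝ, EH) 𝓘(ℝ, EP) (fun g : H => E.lact g e) 1 ξ) = -ξ
  /-- `l_h^* a = Ad_h a + p^* T_A(h)`. -/
  equivariant : ∀ (h : H) (e : P) (v : TangentSpace 𝓘(ℝ, EP) e),
    a (E.lact h e) (mfderiv 𝓘(ℝ, EP) 𝓘(ℝ, EP) (E.lact h) e v) =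
      lieAd EH h (a e v) +
        autCocycle (A (E.proj.toFun e) (mfderiv 𝓘(ℝ, EP) 𝓘(ℝ, EB) E.proj.toFun e v)) h

/-- `A' = A^r`, that is `φ (p^* A') φ⁻¹ = p^* A + ad_a + (dφ) φ⁻¹`. In terms of vector fields on
`H`, this is an equation between tangent vectors at `φ_e(h)`. -/
def IsRightForm (E : Bibundle EH H EB B EP P) (a : LieForm EH H EP P)
    (A A' : AutForm EH H EB B) : Prop :=
  ∀ (e : P) (v : TangentSpace 𝓘(ℝ, EP) e) (h : H),
    mfderiv 𝓘(ℝ, EH) 𝓘(ℝ, EH) (E.phi e) h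
        ((A' (E.proj.toFun e) (mfderiv 𝓘(ℝ, EP) 𝓘(ℝ, EB) E.proj.toFun e v)).1 h) =
      (A (E.proj.toFun e) (mfderiv 𝓘(ℝ, EP) 𝓘(ℝ, EB) E.proj.toFun e v)).1 (E.phi e h) +
        adField EH (a e v) (E.phi e h) +
        mfderiv 𝓘(ℝ, EP) 𝓘(ℝ, EH) (fun e' : P => E.phi e' h) e v

/-- The one-form `π_1^* a₁ + φ_1 (π_2^* a₂)` on `E₁ ⊕ E₂`. -/
def sumForm (E₁ : Bibundle EH H EB B EP P) (E₂ : Bibundle EH H EB B EQ Q)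
    (a₁ : LieForm EH H EP P) (a₂ : LieForm EH H EQ Q) : LieForm EH H (EP × EH) (Sum E₁ E₂) :=
  fun q => a₁.pullback FibProd.fst q +
    (show GroupLieAlgebra 𝓘(ℝ, EH) H →L[ℝ] GroupLieAlgebra 𝓘(ℝ, EH) H from
      mfderiv 𝓘(ℝ, EH) 𝓘(ℝ, EH) (E₁.phi q.fst) 1).comp (a₂.pullback FibProd.snd q)

end Bibundle

end Bibundle

section Gerbe

variable {EM EY F EH EP M Y H P : Type*}
    [NormedAddCommGroup EM] [NormedSpace ℝ EM] [NormedAddCommGroup EY] [NormedSpace ℝ EY]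
    [NormedAddCommGroup F] [NormedSpace ℝ F]
    [NormedAddCommGroup EH] [NormedSpace ℝ EH] [NormedAddCommGroup EP] [NormedSpace ℝ EP]
    [TopologicalSpace M] [ChartedSpace EM M] [IsManifold 𝓘(ℝ, EM) ∞ M]
    [TopologicalSpace Y] [ChartedSpace EY Y] [IsManifold 𝓘(ℝ, EY) ∞ Y]
    [TopologicalSpace H] [ChartedSpace EH H] [Group H]
    [TopologicalSpace P] [ChartedSpace EP P] [IsManifold 𝓘(ℝ, EP) ∞ P]

/-- `Y^{[2]} = Y ×_M Y`. -/
abbrev FibSq (π : Submersion F EY EM Y M) : Type _ := FibProd π.toMap π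

/-- `Y^{[3]} = Y ×_M Y ×_M Y`, whose points are written `((y₁, y₂), y₃)`. -/
abbrev FibCube (π : Submersion F EY EM Y M) : Type _ :=
  FibProd (π.toMap.comp (⟨FibProd.snd, FibProd.contMDiff_snd⟩ :
    C^∞⟮𝓘(ℝ, EY × F), FibSq π; 𝓘(ℝ, EY), Y⟯)) π

/-- `p_{12} : Y^{[3]} → Y^{[2]}`. -/
def p12 (π : Submersion F EY EM Y M) :
    C^∞⟮𝓘(ℝ, (EY × F) × F), FibCube π; 𝓘(ℝ, EY × F), FibSq π⟯ :=
  ⟨FibProd.fst, FibProd.contMDiff_fst⟩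

/-- `p_{23} : Y^{[3]} → Y^{[2]}`. -/
def p23 (π : Submersion F EY EM Y M) :
    C^∞⟮𝓘(ℝ, (EY × F) × F), FibCube π; 𝓘(ℝ, EY × F), FibSq π⟯ :=
  ⟨fun y => ⟨y.fst.snd, y.snd, y.comm⟩, FibProd.contMDiff_of_comp
    ((FibProd.contMDiff_snd (f := π.toMap) (g := π)).comp FibProd.contMDiff_fst)
    FibProd.contMDiff_snd⟩

/-- `p_{13} : Y^{[3]} → Y^{[2]}`. -/
def p13 (π : Submersion F EY EM Y M) :
    C^∞⟮𝓘(ℝ, (EY × F) × F), FibCube π; 𝓘(ℝ, EY × F), FibSq π⟯ :=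
  ⟨fun y => ⟨y.fst.fst, y.snd, y.fst.comm.trans y.comm⟩, by
    have h1 : ContMDiff 𝓘(ℝ, (EY × F) × F) 𝓘(ℝ, EY) ∞ (fun y : FibCube π => y.fst.fst) :=
      (FibProd.contMDiff_fst (f := π.toMap) (g := π)).comp (p12 π).contMDiff
    exact FibProd.contMDiff_of_comp h1 FibProd.contMDiff_snd⟩

variable {π : Submersion F EY EM Y M}

/-- The point `(e, e')` of `ℰ₁₂ ⊕ ℰ₂₃` over `(y₁, y₂, y₃)`, for `e ∈ ℰ` over `(y₁, y₂)` and
`e' ∈ ℰ` over `(y₂, y₃)`. -/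
def gerbePair (E : Bibundle EH H (EY × F) (FibSq π) EP P) (e e' : P)
    (h : (E.proj.toFun e).snd = (E.proj.toFun e').fst) :
    Bibundle.Sum (E.pullback (p12 π)) (E.pullback (p23 π)) :=
  let y : FibCube π := ⟨E.proj.toFun e, (E.proj.toFun e').snd,
    (congrArg π.toFun h).trans (E.proj.toFun e').comm⟩
  { fst := ⟨y, e, rfl⟩
    snd := ⟨y, e', FibProd.ext h rfl⟩
    comm := by rfl }

/-- The element `f[e, e']` of `ℰ` over `(y₁, y₃)`, where `f : ℰ₁₂ℰ₂₃ → ℰ₁₃`. -/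
def gerbeMul {E : Bibundle EH H (EY × F) (FibSq π) EP P}
    (f : Bibundle.ProdHom (E.pullback (p12 π)) (E.pullback (p23 π)) (E.pullback (p13 π)))
    (e e' : P) (h : (E.proj.toFun e).snd = (E.proj.toFun e').fst) : P :=
  (f.toFun (Bibundle.Prod.mk (gerbePair E e e' h))).snd

theorem proj_gerbeMul {E : Bibundle EH H (EY × F) (FibSq π) EP P}
    (f : Bibundle.ProdHom (E.pullback (p12 π)) (E.pullback (p23 π)) (E.pullback (p13 π)))
    (e e' : P) (h : (E.proj.toFun e).snd = (E.proj.toFun e').fst) :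
    (E.proj.toFun (gerbeMul f e e' h)).fst = (E.proj.toFun e).fst ∧
      (E.proj.toFun (gerbeMul f e e' h)).snd = (E.proj.toFun e').snd := by
  have h1 := (f.toFun (Bibundle.Prod.mk (gerbePair E e e' h))).comm
  have h2 := f.proj_toFun (Bibundle.Prod.mk (gerbePair E e e' h))
  have h3 := h1.symm.trans (congrArg (p13 π) h2)
  have h4 := congrArg (fun z : FibSq π => z.fst) h3
  have h5 := congrArg (fun z : FibSq π => z.snd) h3
  exact ⟨h4, h5⟩

/-- A nonabelian bundle gerbe `(ℰ, Y, M, f)` over the submersion `π : Y → M`: a principal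
`H`-bibundle `ℰ` over `Y^{[2]}` and an isomorphism of bibundles `f : ℰ₁₂ℰ₂₃ → ℰ₁₃` over `Y^{[3]}`
such that the two isomorphisms `ℰ₁₂ℰ₂₃ℰ₃₄ → ℰ₁₄` over `Y^{[4]}` built from `f` agree. -/
structure BundleGerbe (EH H EP P : Type*) (π : Submersion F EY EM Y M)
    [NormedAddCommGroup EH] [NormedSpace ℝ EH] [NormedAddCommGroup EP] [NormedSpace ℝ EP]
    [TopologicalSpace H] [ChartedSpace EH H] [Group H]
    [TopologicalSpace P] [ChartedSpace EP P] [IsManifold 𝓘(ℝ, EP) ∞ P] where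
  E : Bibundle EH H (EY × F) (FibSq π) EP P
  f : Bibundle.ProdHom (E.pullback (p12 π)) (E.pullback (p23 π)) (E.pullback (p13 π))
  cocycle : ∀ (e₁ e₂ e₃ : P) (h₁₂ : (E.proj.toFun e₁).snd = (E.proj.toFun e₂).fst)
    (h₂₃ : (E.proj.toFun e₂).snd = (E.proj.toFun e₃).fst),
    gerbeMul f (gerbeMul f e₁ e₂ h₁₂) e₃ ((proj_gerbeMul f e₁ e₂ h₁₂).2.trans h₂₃) =
      gerbeMul f e₁ (gerbeMul f e₂ e₃ h₂₃) (h₁₂.trans (proj_gerbeMul f e₂ e₃ h₂₃).1.symm)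

/-- `(a, A)` is a bundle gerbe connection: a 2-connection on `ℰ` such that `(a₁₂, A₁₂)` and
`(a₂₃, A₂₃)` are summable, with `(a₁₂, A₁₂) ∔ (a₂₃, A₂₃) = f^* (a₁₃, A₁₃)`. The one-form
`a₁₂ ∔ a₂₃` on `ℰ₁₂ℰ₂₃` is the one whose pull-back to `ℰ₁₂ ⊕ ℰ₂₃` is `sumForm`, and the other
component of the sum is `A₁₂`. -/
structure BundleGerbe.IsConnection [LieGroup 𝓘(ℝ, EH) ∞ H] (G : BundleGerbe EH H EP P π)
    (a : LieForm EH H EP P) (A : AutForm EH H (EY × F) (FibSq π)) : Prop where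
  isTwoConnection : G.E.IsTwoConnection a A
  summable : (G.E.pullback (p12 π)).IsRightForm (a.pullback FibProd.snd)
    (AutForm.pullback (EC := (EY × F) × F) A (p12 π))
    (AutForm.pullback (EC := (EY × F) × F) A (p23 π))
  sum_eq : (G.E.pullback (p12 π)).sumForm (G.E.pullback (p23 π))
      (a.pullback FibProd.snd) (a.pullback FibProd.snd) =
    LieForm.pullback (EP := ((EY × F) × F) × EH)
      (LieForm.pullback a (FibProd.snd : FibProd (p13 π) G.E.proj → P))
      fun q => G.f.toFun (Bibundle.Prod.mk q)
  snd_eq : AutForm.pullback (EC := (EY × F) × F) A (p12 π) =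
    AutForm.pullback (EC := (EY × F) × F) A (p13 π)

end Gerbe

end

/-! The isomorphism `f` makes `ℰ` a groupoid over `Y`: an element `e` over `(y₁, y₂)` and an element
`e'` over `(y₂, y₃)` have a product `e e'` over `(y₁, y₃)`, associative by the cocycle condition,
with `(h e) e' = h (e e')`, `(e ◁ h) e' = e (h e')` and `φ_{e e'} = φ_e φ_{e'}`. The equation for
the sum of the connections says that `a` is multiplicative, `a(e e') = a(e) + φ_e a(e')`. The
theorem reduces to finding a smooth vertical multiplicative `a` that is, on the left, equivariant up
to a cocycle `T_X`; the rest follows from these conditions.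

Such an `a` is built over `M`. First, `ℰ` has a vertical form that is right-invariant and has left
cocycles: near a point of `Y^{[2]}` take the flat form of a local section (`flatForm`), then glue
with a partition of unity (`exists_rightInvariant_form`). Next, over an open `U ⊆ M` with a section
`s : U → Y`, set `b(e) = a(e q) - φ_e a(q)`, where `q` is any element over `(y₂, s(m))`. By
verticality and right invariance another `q` gives the same value (`multForm_indep`). Since `e' q`
is an admissible choice for `e`, associativity gives `b(e) + φ_e b(e') = a(e (e' q)) - φ_e a(e' q) +
φ_e a(e' q) - φ_e φ_{e'} a(q) = b(e e')`. All the conditions are convex and concern one fibre over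
`M` at a time, so the local forms glue (`exists_multiplicative_form`).

The form `A` is then forced: `T_A(h)` must be `l_h^* a - Ad_h a`, and `X` is determined by `T_X`
(`cocycle_injective`). It descends to the base because changing a lift of a tangent vector by a
vertical vector leaves `X` unchanged (`cocycle_of_lact`). Evaluating `a` on `(h e) e' = h (e e')`
gives `A₁₂ = A₁₃` (`autForm_src_eq`), and evaluating it on `(e ◁ h) e' = e (h e')` gives `A₂₃ =
(A₁₂)^r` (`dphi_cocycle`).

All infinitesimal identities are checked on curves: a tangent vector is the velocity of a curve, and
an identity between points along curves is differentiated at `0` with the product rule `vel_diag`.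
-/

noncomputable section

/-! ### Curves and their velocities. -/

section Velocity

variable {E E' E'' X Z W : Type*}
  [NormedAddCommGroup E] [NormedSpace ℝ E] [TopologicalSpace X] [ChartedSpace E X]
  [NormedAddCommGroup E'] [NormedSpace ℝ E'] [TopologicalSpace Z] [ChartedSpace E' Z]
  [NormedAddCommGroup E''] [NormedSpace ℝ E''] [TopologicalSpace W] [ChartedSpace E'' W]

/-- The velocity at time `0` of a curve in a manifold, as an element of the model space. -/
def vel (E : Type*) [NormedAddCommGroup E] [NormedSpace ℝ E] {X : Type*} [TopologicalSpace X]
    [ChartedSpace E X] (γ : ℝ → X) : E :=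
  mfderiv 𝓘(ℝ, ℝ) 𝓘(ℝ, E) γ 0 (1 : ℝ)

/-- The derivative of a map at a point, as a linear map between model spaces. -/
def deriv' (E E' : Type*) [NormedAddCommGroup E] [NormedSpace ℝ E] [NormedAddCommGroup E']
    [NormedSpace ℝ E'] {X Z : Type*} [TopologicalSpace X] [ChartedSpace E X]
    [TopologicalSpace Z] [ChartedSpace E' Z] (f : X → Z) (x : X) : E →L[ℝ] E' :=
  mfderiv 𝓘(ℝ, E) 𝓘(ℝ, E') f x

theorem vel_const (x : X) : vel E (fun _ : ℝ => x) = 0 := by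
  unfold vel
  rw [mfderiv_const]
  rfl

theorem deriv'_vel_of_mdifferentiableAt {f : X → Z} {γ : ℝ → X}
    (hf : MDifferentiableAt 𝓘(ℝ, E) 𝓘(ℝ, E') f (γ 0))
    (hγ : MDifferentiableAt 𝓘(ℝ, ℝ) 𝓘(ℝ, E) γ 0) :
    deriv' E E' f (γ 0) (vel E γ) = vel E' (fun t => f (γ t)) :=
  congrArg (fun L => L (1 : ℝ)) (mfderiv_comp (0 : ℝ) hf hγ).symm

theorem ContMDiff.mdifferentiableAt' {f : X → Z} (hf : ContMDiff 𝓘(ℝ, E) 𝓘(ℝ, E') ∞ f) (x : X) :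
    MDifferentiableAt 𝓘(ℝ, E) 𝓘(ℝ, E') f x :=
  hf.mdifferentiable (by simp) x

theorem ContMDiffOn.mdifferentiableAt' {f : X → Z} {s : Set X}
    (hf : ContMDiffOn 𝓘(ℝ, E) 𝓘(ℝ, E') ∞ f s) (hs : IsOpen s) {x : X} (hx : x ∈ s) :
    MDifferentiableAt 𝓘(ℝ, E) 𝓘(ℝ, E') f x :=
  (hf.contMDiffAt (hs.mem_nhds hx)).mdifferentiableAt (by simp)

theorem deriv'_vel {f : X → Z} {γ : ℝ → X} (hf : ContMDiff 𝓘(ℝ, E) 𝓘(ℝ, E') ∞ f)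
    (hγ : ContMDiff 𝓘(ℝ, ℝ) 𝓘(ℝ, E) ∞ γ) {x : X} (hx : γ 0 = x) :
    deriv' E E' f x (vel E γ) = vel E' (fun t => f (γ t)) := by
  subst hx
  exact deriv'_vel_of_mdifferentiableAt (hf.mdifferentiableAt' _) (hγ.mdifferentiableAt' _)

/-- Product rule: the velocity of a curve along the diagonal of a family with two parameters. -/
theorem vel_diag {G : ℝ → ℝ → X}
    (hG : ContMDiff 𝓘(ℝ, ℝ × ℝ) 𝓘(ℝ, E) ∞ fun p : ℝ × ℝ => G p.1 p.2) :
    vel E (fun t => G t t) = vel E (fun t => G t 0) + vel E (fun t => G 0 t) := by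
  have h1 := (hG.mdifferentiable (by simp) ((0 : ℝ), (0 : ℝ))).hasMFDerivAt
  set D := mfderiv 𝓘(ℝ, ℝ × ℝ) 𝓘(ℝ, E) (fun p : ℝ × ℝ => G p.1 p.2) ((0 : ℝ), (0 : ℝ))
  let idl := ContinuousLinearMap.id ℝ ℝ
  have k1 : HasMFDerivAt 𝓘(ℝ, ℝ) 𝓘(ℝ, ℝ × ℝ) (fun t : ℝ => (t, t)) 0 (idl.prod idl) :=
    ((hasFDerivAt_id (𝕜 := ℝ) (0 : ℝ)).prodMk (hasFDerivAt_id (𝕜 := ℝ) (0 : ℝ))).hasMFDerivAt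
  have k2 : HasMFDerivAt 𝓘(ℝ, ℝ) 𝓘(ℝ, ℝ × ℝ) (fun t : ℝ => (t, (0 : ℝ))) 0 (idl.prod 0) :=
    ((hasFDerivAt_id (𝕜 := ℝ) (0 : ℝ)).prodMk (hasFDerivAt_const (0 : ℝ) (0 : ℝ))).hasMFDerivAt
  have k3 : HasMFDerivAt 𝓘(ℝ, ℝ) 𝓘(ℝ, ℝ × ℝ) (fun t : ℝ => ((0 : ℝ), t)) 0
      ((0 : ℝ →L[ℝ] ℝ).prod idl) :=
    ((hasFDerivAt_const (0 : ℝ) (0 : ℝ)).prodMk (hasFDerivAt_id (𝕜 := ℝ) (0 : ℝ))).hasMFDerivAt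
  have l1 : vel E (fun t => G t t) = D ((1 : ℝ), (1 : ℝ)) :=
    congrArg (fun L => L (1 : ℝ))
      (HasMFDerivAt.comp (f := fun t : ℝ => (t, t)) (0 : ℝ) h1 k1).mfderiv
  have l2 : vel E (fun t => G t 0) = D ((1 : ℝ), (0 : ℝ)) :=
    congrArg (fun L => L (1 : ℝ))
      (HasMFDerivAt.comp (f := fun t : ℝ => (t, (0 : ℝ))) (0 : ℝ) h1 k2).mfderiv
  have l3 : vel E (fun t => G 0 t) = D ((0 : ℝ), (1 : ℝ)) :=
    congrArg (fun L => L (1 : ℝ))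
      (HasMFDerivAt.comp (f := fun t : ℝ => ((0 : ℝ), t)) (0 : ℝ) h1 k3).mfderiv
  rw [l1, l2, l3]
  have : (((1 : ℝ), (1 : ℝ)) : ℝ × ℝ) = ((1 : ℝ), (0 : ℝ)) + ((0 : ℝ), (1 : ℝ)) := by simp
  rw [this]
  exact D.map_add ((1 : ℝ), (0 : ℝ)) ((0 : ℝ), (1 : ℝ))

/-- A bounded reparametrisation of time with unit speed at `0`. -/
theorem exists_bounded_time {ε : ℝ} (hε : 0 < ε) :
    ∃ τ : ℝ → ℝ, ContDiff ℝ ∞ τ ∧ τ 0 = 0 ∧ HasDerivAt τ 1 0 ∧ ∀ t, |τ t| ≤ ε := by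
  refine ⟨fun t => ε * Real.sin (t / ε), ?_, by simp, ?_, fun t => ?_⟩
  · exact contDiff_const.mul (Real.contDiff_sin.comp (contDiff_id.div_const ε))
  · have := (((hasDerivAt_id (0 : ℝ)).div_const ε).sin).const_mul ε
    simpa [hε.ne'] using this
  · rw [abs_mul, abs_of_pos hε]
    exact mul_le_of_le_one_right hε.le (Real.abs_sin_le_one _)

theorem vel_comp_time {γ : ℝ → X} (hγ : ContMDiff 𝓘(ℝ, ℝ) 𝓘(ℝ, E) ∞ γ) {τ : ℝ → ℝ} {r : ℝ}
    (h0 : τ 0 = 0) (hτ : HasDerivAt τ r 0) : vel E (fun t => γ (τ t)) = r • vel E γ := by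
  have h1 : HasMFDerivAt 𝓘(ℝ, ℝ) 𝓘(ℝ, E) γ (τ 0) (mfderiv 𝓘(ℝ, ℝ) 𝓘(ℝ, E) γ (τ 0)) :=
    (hγ.mdifferentiable (by simp) _).hasMFDerivAt
  have h2 : HasMFDerivAt 𝓘(ℝ, ℝ) 𝓘(ℝ, ℝ) τ 0 (ContinuousLinearMap.toSpanSingleton ℝ r) :=
    hτ.hasFDerivAt.hasMFDerivAt
  have h3 := congrArg (fun L => L (1 : ℝ)) (h1.comp (0 : ℝ) h2).mfderiv
  refine Eq.trans h3 ?_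
  have h4 : mfderiv 𝓘(ℝ, ℝ) 𝓘(ℝ, E) γ (τ 0) ((1 : ℝ) • r) = r • vel E γ := by
    rw [h0, one_smul]
    have := (mfderiv 𝓘(ℝ, ℝ) 𝓘(ℝ, E) γ 0).map_smul r (1 : ℝ)
    refine Eq.trans ?_ this
    exact congrArg _ (mul_one r).symm
  exact h4

/-- Slowing a curve down away from time `0` keeps its velocity at `0` and confines it to `O`.
Arguments that need local sections can therefore use curves defined on all of `ℝ`, with no germs. -/
theorem exists_time_mapsTo {γ : ℝ → X} (hγ : ContMDiff 𝓘(ℝ, ℝ) 𝓘(ℝ, E) ∞ γ) {O : Set X}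
    (hO : IsOpen O) (h0 : γ 0 ∈ O) :
    ∃ τ : ℝ → ℝ, ContDiff ℝ ∞ τ ∧ τ 0 = 0 ∧ HasDerivAt τ 1 0 ∧ ∀ t, γ (τ t) ∈ O := by
  obtain ⟨ε, hε, h⟩ := Metric.isOpen_iff.1 (hO.preimage hγ.continuous) 0 h0
  -- The bound on `τ` is not strict while the ball is open, hence half the radius.
  obtain ⟨τ, h1, h2, h3, h4⟩ := exists_bounded_time (half_pos hε)
  refine ⟨τ, h1, h2, h3, fun t => h ?_⟩
  rw [Metric.mem_ball, dist_zero_right, Real.norm_eq_abs]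
  linarith [h4 t]

/-- A straight line in the chart at `x`, confined to the part of the chart inside `O`. This turns
statements about tangent vectors into statements about curves. -/
theorem exists_curve [IsManifold 𝓘(ℝ, E) ∞ X] {O : Set X} (hO : IsOpen O) {x : X} (hx : x ∈ O)
    (v : E) : ∃ γ : ℝ → X, ContMDiff 𝓘(ℝ, ℝ) 𝓘(ℝ, E) ∞ γ ∧ γ 0 = x ∧ vel E γ = v ∧
      ∀ t, γ t ∈ O := by
  set φ := chartAt E x
  have hU : IsOpen (φ.target ∩ φ.symm ⁻¹' O) :=
    φ.symm.isOpen_inter_preimage hO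
  have hxU : φ x ∈ φ.target ∩ φ.symm ⁻¹' O :=
    ⟨mem_chart_target E x, by simpa [φ.left_inv (mem_chart_source E x)] using hx⟩
  set l : ℝ → E := fun t => φ x + t • v
  have hl : ContMDiff 𝓘(ℝ, ℝ) 𝓘(ℝ, E) ∞ l :=
    (contDiff_const.add (contDiff_id.smul contDiff_const)).contMDiff
  obtain ⟨τ, h1, h2, h3, h4⟩ := exists_time_mapsTo hl hU (by simpa [l] using hxU)
  have hlτ : ContMDiff 𝓘(ℝ, ℝ) 𝓘(ℝ, E) ∞ (fun t => l (τ t)) := hl.comp h1.contMDiff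
  have hs : ContMDiff 𝓘(ℝ, ℝ) 𝓘(ℝ, E) ∞ (fun t => φ.symm (l (τ t))) := by
    rw [← contMDiffOn_univ] at hlτ ⊢
    exact (contMDiffOn_chart_symm (I := 𝓘(ℝ, E)) (x := x)).comp hlτ fun t _ => (h4 t).1
  have h0 : φ.symm (l (τ 0)) = x := by
    simp [l, h2, φ.left_inv (mem_chart_source E x)]
  refine ⟨_, hs, h0, ?_, fun t => (h4 t).2⟩
  have hd : HasFDerivAt (fun t => l (τ t)) (ContinuousLinearMap.toSpanSingleton ℝ v) 0 := by
    have h := (h3.smul_const v).const_add (φ x)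
    rw [one_smul] at h
    exact h.hasFDerivAt
  have : HasMFDerivAt 𝓘(ℝ, ℝ) 𝓘(ℝ, E) (fun t => φ.symm (l (τ t))) 0
      (ContinuousLinearMap.toSpanSingleton ℝ v : ℝ →L[ℝ] E) := by
    refine ⟨hs.continuous.continuousAt, ?_⟩
    -- The velocity is computed in the chart at the starting point, which is `φ` itself, and there
    -- the curve is the line.
    have h5 : writtenInExtChartAt 𝓘(ℝ, ℝ) 𝓘(ℝ, E) 0 (fun t => φ.symm (l (τ t))) =
        fun t => l (τ t) := by
      funext t
      simp only [writtenInExtChartAt, h0]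
      exact φ.right_inv (h4 t).1
    rw [h5]
    exact hd.hasFDerivWithinAt
  have h6 := congrArg (fun L => L (1 : ℝ)) this.mfderiv
  refine Eq.trans h6 ?_
  exact one_smul ℝ v

end Velocity

/-! ### Smoothness of partial derivatives, lifts to fibre products, local sections. -/

section Smoothness

variable {E E' E'' X Z W : Type*}
  [NormedAddCommGroup E] [NormedSpace ℝ E] [TopologicalSpace X] [ChartedSpace E X]
  [NormedAddCommGroup E'] [NormedSpace ℝ E'] [TopologicalSpace Z] [ChartedSpace E' Z]
  [NormedAddCommGroup E''] [NormedSpace ℝ E''] [TopologicalSpace W] [ChartedSpace E'' W]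

/-- The vector part of a point of the tangent bundle, as an element of the model space. -/
def tvec (v : TangentBundle 𝓘(ℝ, E) X) : E := v.2

/-- The point of the tangent bundle with given base point and vector part. -/
def tmk (x : X) (v : E) : TangentBundle 𝓘(ℝ, E) X := ⟨x, v⟩

/-- The partial derivative of a smooth map `X × Z → W` in the first variable is smooth, as a map
`TX × Z → TW`. -/
theorem contMDiffOn_partial_deriv [IsManifold 𝓘(ℝ, E) ∞ X] [IsManifold 𝓘(ℝ, E') ∞ Z]
    [IsManifold 𝓘(ℝ, E'') ∞ W] {F : X → Z → W} {Ω : Set (X × Z)} (hΩ : IsOpen Ω)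
    (hF : ContMDiffOn (𝓘(ℝ, E).prod 𝓘(ℝ, E')) 𝓘(ℝ, E'') ∞ (fun p : X × Z => F p.1 p.2) Ω) :
    ContMDiffOn (𝓘(ℝ, E).tangent.prod 𝓘(ℝ, E')) 𝓘(ℝ, E'').tangent ∞
      (fun p : TangentBundle 𝓘(ℝ, E) X × Z =>
        tmk (F p.1.1 p.2) (deriv' E E'' (fun x => F x p.2) p.1.1 (tvec p.1)))
      {p | (p.1.1, p.2) ∈ Ω} := by
  -- The partial derivative is the full tangent map on vectors `(v, 0)`, so it is smooth as a
  -- composite of the tangent map with the zero section in the second factor.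
  have h1 : ContMDiff (𝓘(ℝ, E).tangent.prod 𝓘(ℝ, E'))
      (𝓘(ℝ, E).tangent.prod 𝓘(ℝ, E').tangent) ∞
      (fun p : TangentBundle 𝓘(ℝ, E) X × Z =>
        (p.1, (⟨p.2, 0⟩ : TangentBundle 𝓘(ℝ, E') Z))) :=
    contMDiff_fst.prodMk ((Bundle.contMDiff_zeroSection ℝ (TangentSpace 𝓘(ℝ, E'))).comp
      contMDiff_snd)
  have h2 := (contMDiff_equivTangentBundleProd_symm (n := ∞) (I := 𝓘(ℝ, E)) (I' := 𝓘(ℝ, E'))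
    (M := X) (M' := Z)).comp h1
  have h3 := (hF.contMDiffOn_tangentMapWithin (m := ∞) le_rfl hΩ.uniqueMDiffOn).comp
    (h2.contMDiffOn (s := {p : TangentBundle 𝓘(ℝ, E) X × Z | (p.1.1, p.2) ∈ Ω}))
    (fun p hp => hp)
  refine h3.congr fun p hp => ?_
  have hd : MDifferentiableAt (𝓘(ℝ, E).prod 𝓘(ℝ, E')) 𝓘(ℝ, E'')
      (fun p : X × Z => F p.1 p.2) (p.1.1, p.2) :=
    (hF.contMDiffAt (hΩ.mem_nhds hp)).mdifferentiableAt (by simp)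
  have h4 := mfderiv_prod_eq_add_apply (v := ((p.1.2, 0) : E × E')) hd
  refine congrArg (tmk (F p.1.1 p.2)) ?_
  have h6 : mfderivWithin (𝓘(ℝ, E).prod 𝓘(ℝ, E')) 𝓘(ℝ, E'') (fun p : X × Z => F p.1 p.2) Ω
      (p.1.1, p.2) = mfderiv (𝓘(ℝ, E).prod 𝓘(ℝ, E')) 𝓘(ℝ, E'') (fun p : X × Z => F p.1 p.2)
      (p.1.1, p.2) := mfderivWithin_of_isOpen hΩ hp
  have h7 := congrArg (fun L => L ((p.1.2, 0) : E × E')) h6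
  refine Eq.trans ?_ (h7.trans h4).symm
  have h5 : mfderiv 𝓘(ℝ, E') 𝓘(ℝ, E'') (fun z => F p.1.1 z) p.2 (0 : E') = (0 : E'') :=
    (mfderiv 𝓘(ℝ, E') 𝓘(ℝ, E'') (fun z => F p.1.1 z) p.2).map_zero
  refine Eq.trans (add_zero _).symm ?_
  exact congrArg₂ (fun a b : E'' => a + b) rfl h5.symm

variable {EN HN N : Type*} [NormedAddCommGroup EN] [NormedSpace ℝ EN] [TopologicalSpace HN]
  {J : ModelWithCorners ℝ EN HN} [TopologicalSpace N] [ChartedSpace HN N]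

/-- A map into a single tangent space is smooth as a map to the tangent bundle iff it is smooth as
a map to the model space. -/
theorem contMDiffOn_tangentSpace_iff [IsManifold 𝓘(ℝ, E) ∞ X] {x : X} {ξ : N → E} {s : Set N} :
    ContMDiffOn J 𝓘(ℝ, E).tangent ∞ (fun n => tmk x (ξ n)) s ↔
      ContMDiffOn J 𝓘(ℝ, E) ∞ ξ s := by
  refine forall₂_congr fun n _ => ?_
  rw [Bundle.contMDiffWithinAt_totalSpace]
  have : (fun n => (trivializationAt E (TangentSpace 𝓘(ℝ, E)) x
      (tmk x (ξ n))).2) = ξ := by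
    -- The trivialisation centred at `x` is the identity on the fibre over `x`.
    funext n
    exact (tangentBundleCore 𝓘(ℝ, E) X).coordChange_self _ _ (mem_chart_source E x) _
  change _ ∧ ContMDiffWithinAt J 𝓘(ℝ, E) ∞ (fun n => (trivializationAt E
    (TangentSpace 𝓘(ℝ, E)) x (tmk x (ξ n))).2) s n ↔ _
  rw [this]
  exact and_iff_right contMDiffWithinAt_const

/-- A map into a fibre product with smooth components on an open set is smooth there. -/
theorem FibProd.contMDiffOn_of_comp {EM F M : Type*}
    [NormedAddCommGroup EM] [NormedSpace ℝ EM] [NormedAddCommGroup F] [NormedSpace ℝ F]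
    [TopologicalSpace M] [ChartedSpace EM M] [IsManifold 𝓘(ℝ, E) ∞ X]
    {f : C^∞⟮𝓘(ℝ, E), X; 𝓘(ℝ, EM), M⟯} {g : Submersion F E' EM Z M}
    {h : N → FibProd f g} {s : Set N} (hs : IsOpen s)
    (h1 : ContMDiffOn J 𝓘(ℝ, E) ∞ (fun w => (h w).fst) s)
    (h2 : ContMDiffOn J 𝓘(ℝ, E') ∞ (fun w => (h w).snd) s) :
    ContMDiffOn J 𝓘(ℝ, E × F) ∞ h s := by
  have hc : ContinuousOn h s := by
    rw [continuousOn_iff_continuous_domRestrict]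
    refine continuous_induced_rng.2 ?_
    exact continuousOn_iff_continuous_domRestrict.1 (h1.continuousOn.prodMk h2.continuousOn)
  intro w hw
  have hs' : IsOpen (s ∩ h ⁻¹' (h w).chart.source) :=
    hc.isOpen_inter_preimage hs (h w).chart.open_source
  have h3 := contMDiffOn_chart_comp (s := s ∩ h ⁻¹' (h w).chart.source) (h w)
    (h1.mono inter_subset_left) (h2.mono inter_subset_left) (fun v hv => hv.2)
  have h4 := (contMDiffOn_chart_symm (I := 𝓘(ℝ, E × F)) (n := ∞) (x := h w)).comp h3
    (fun v hv => (h w).chart.map_source hv.2)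
  exact ((h4.congr fun v hv => ((h w).chart.left_inv hv.2).symm).contMDiffAt
    (hs'.mem_nhds ⟨hw, (h w).mem_source_chart⟩)).contMDiffWithinAt

/-- Smooth maps with equal images in the base lift to the fibre product. -/
theorem FibProd.exists_lift {EM F M : Type*}
    [NormedAddCommGroup EM] [NormedSpace ℝ EM] [NormedAddCommGroup F] [NormedSpace ℝ F]
    [TopologicalSpace M] [ChartedSpace EM M] [IsManifold 𝓘(ℝ, E) ∞ X]
    {f : C^∞⟮𝓘(ℝ, E), X; 𝓘(ℝ, EM), M⟯} {g : Submersion F E' EM Z M}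
    {x : N → X} {z : N → Z} {s : Set N} (hs : IsOpen s) (hne : s.Nonempty)
    (hx : ContMDiffOn J 𝓘(ℝ, E) ∞ x s) (hz : ContMDiffOn J 𝓘(ℝ, E') ∞ z s)
    (hc : ∀ n ∈ s, f (x n) = g.toFun (z n)) :
    ∃ h : N → FibProd f g, ContMDiffOn J 𝓘(ℝ, E × F) ∞ h s ∧
      ∀ n ∈ s, (h n).fst = x n ∧ (h n).snd = z n := by
  classical
  obtain ⟨n₀, hn₀⟩ := hne
  -- Outside `s` the two maps need not agree in the base; the lift takes there the constant value
  -- over `n₀`, which is where nonemptiness is needed.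
  have key : ∀ n, ∃ q : FibProd f g, n ∈ s → q.fst = x n ∧ q.snd = z n := fun n => by
    by_cases hn : n ∈ s
    · exact ⟨⟨x n, z n, hc n hn⟩, fun _ => ⟨rfl, rfl⟩⟩
    · exact ⟨⟨x n₀, z n₀, hc n₀ hn₀⟩, fun h => absurd h hn⟩
  choose h hh using key
  exact ⟨h, FibProd.contMDiffOn_of_comp hs (hx.congr fun n hn => (hh n hn).1)
    (hz.congr fun n hn => (hh n hn).2), hh⟩

/-- A submersion has local sections through every point. -/
theorem Submersion.exists_local_section {F EM M : Type*} [NormedAddCommGroup F] [NormedSpace ℝ F]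
    [NormedAddCommGroup EM] [NormedSpace ℝ EM] [TopologicalSpace M] [ChartedSpace EM M]
    [IsManifold 𝓘(ℝ, EM) ∞ M] (g : Submersion F E EM X M) (x : X) :
    ∃ (U : Set M) (σ : M → X), IsOpen U ∧ g.toFun x ∈ U ∧
      ContMDiffOn 𝓘(ℝ, EM) 𝓘(ℝ, E) ∞ σ U ∧ σ (g.toFun x) = x ∧ ∀ m ∈ U, g.toFun (σ m) = m := by
  -- The pull-back of `g` along the identity of `M` has charts adapted to `g`; keeping the
  -- `F`-coordinate equal to that of `q` gives the section.
  let q : FibProd (ContMDiffMap.id : C^∞⟮𝓘(ℝ, EM), M; 𝓘(ℝ, EM), M⟯) g := ⟨g.toFun x, x, rfl⟩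
  set φ := chartAt EM (g.toFun x)
  let l : M → EM × F := fun m => (φ m, (q.chart q).2)
  have hl : ContMDiffOn 𝓘(ℝ, EM) 𝓘(ℝ, EM × F) ∞ l φ.source :=
    (contMDiffOn_chart (I := 𝓘(ℝ, EM)) (x := g.toFun x)).prodMk_space contMDiffOn_const
  have hq : l (g.toFun x) = q.chart q := rfl
  refine ⟨φ.source ∩ l ⁻¹' q.tgt, fun m => (q.chart.symm (l m)).snd,
    hl.continuousOn.isOpen_inter_preimage φ.open_source q.isOpen_tgt,
    ⟨mem_chart_source EM _, ?_⟩, ?_, ?_, ?_⟩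
  · rw [mem_preimage, hq]
    exact q.chart.map_source q.mem_source_chart
  · exact q.contMDiffOn_snd_symm.comp (hl.mono inter_subset_left) fun m hm => hm.2
  · simp only [hq, q.chart.left_inv q.mem_source_chart]
    rfl
  · intro m hm
    have h1 := (q.chart.symm (l m)).comm
    rw [q.fst_chart_symm hm.2] at h1
    exact h1.symm.trans (φ.left_inv hm.1)

end Smoothness

/-! ### Gluing one-forms with a partition of unity. -/

section LieForm

variable {EH H EP P EN N : Type*}
  [NormedAddCommGroup EH] [NormedSpace ℝ EH] [TopologicalSpace H] [ChartedSpace EH H] [Group H]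
  [NormedAddCommGroup EP] [NormedSpace ℝ EP] [TopologicalSpace P] [ChartedSpace EP P]
  [IsManifold 𝓘(ℝ, EP) ∞ P]
  [NormedAddCommGroup EN] [NormedSpace ℝ EN] [TopologicalSpace N] [ChartedSpace EN N]

/-- The value of a `Lie(H)`-valued one-form, as a map between model spaces. -/
def LieForm.val (a : LieForm EH H EP P) (e : P) (v : EP) : EH := a e v

/-- Smoothness of a `Lie(H)`-valued one-form over a set. -/
def LieForm.SmoothOn (a : LieForm EH H EP P) (O : Set P) : Prop :=
  ContMDiffOn 𝓘(ℝ, EP).tangent 𝓘(ℝ, EH) ∞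
    (fun v : TangentBundle 𝓘(ℝ, EP) P => a.val v.1 (tvec v)) {v | v.1 ∈ O}

/-- Local existence implies global existence of smooth one-forms with values in convex sets that
depend on a parameter in `N`. -/
theorem LieForm.exists_smooth_of_local [FiniteDimensional ℝ EN] [IsManifold 𝓘(ℝ, EN) ∞ N]
    [T2Space N] [SecondCountableTopology N] {κ : P → N}
    (hκ : ContMDiff 𝓘(ℝ, EP) 𝓘(ℝ, EN) ∞ κ) {Φ : N → Set (LieForm EH H EP P)}
    (hconv : ∀ n, Convex ℝ (Φ n))
    (hcongr : ∀ n (a b : LieForm EH H EP P), (∀ e, κ e = n → a e = b e) → a ∈ Φ n → b ∈ Φ n)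
    (hloc : ∀ n, ∃ U : Set N, IsOpen U ∧ n ∈ U ∧ ∃ a : LieForm EH H EP P,
      a.SmoothOn (κ ⁻¹' U) ∧ ∀ m ∈ U, a ∈ Φ m) :
    ∃ a : LieForm EH H EP P, a.Smooth ∧ ∀ n, a ∈ Φ n := by
  choose U hU hmem a ha hΦ using hloc
  have : LocallyCompactSpace N := ChartedSpace.locallyCompactSpace EN N
  obtain ⟨ρ, hρ⟩ := SmoothPartitionOfUnity.exists_isSubordinate 𝓘(ℝ, EN) (s := (univ : Set N))
    isClosed_univ U hU (fun n _ => mem_iUnion.2 ⟨n, hmem n⟩)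
  let b : LieForm EH H EP P := fun e => ∑ i ∈ ρ.finsupport (κ e), ρ i (κ e) • a i e
  refine ⟨b, ?_, fun n => ?_⟩
  -- The index set of the sum defining `b` varies with the point; as a locally finite sum over all
  -- indices it can be shown smooth term by term.
  · have hb : (fun v : TangentBundle 𝓘(ℝ, EP) P => b.val v.1 (tvec v)) =
        fun v => ∑ᶠ i, ρ i (κ v.1) • (a i).val v.1 (tvec v) := by
      funext v
      rw [← ρ.sum_finsupport_smul_eq_finsum (x₀ := κ v.1) (fun i _ => (a i).val v.1 (tvec v))]
      have h1 : b v.1 v.2 = ∑ i ∈ ρ.finsupport (κ v.1), (ρ i (κ v.1) • a i v.1) v.2 :=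
        sum_apply _ _ _
      exact h1
    change ContMDiff _ _ _ (fun v : TangentBundle 𝓘(ℝ, EP) P => b.val v.1 (tvec v))
    rw [hb]
    have hκ' : ContMDiff 𝓘(ℝ, EP).tangent 𝓘(ℝ, EN) ∞
        (fun v : TangentBundle 𝓘(ℝ, EP) P => κ v.1) :=
      hκ.comp (Bundle.contMDiff_proj (TangentSpace 𝓘(ℝ, EP)))
    refine contMDiff_finsum (fun i => ?_) ?_
    · refine contMDiff_of_tsupport fun v hv => ?_
      have hv' : κ v.1 ∈ U i := by
        refine hρ i ?_
        -- A term is supported over the support of its cut-off function, hence over `U i`, where `a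
        -- i` is smooth.
        have h2 : tsupport (fun v : TangentBundle 𝓘(ℝ, EP) P =>
            ρ i (κ v.1) • (a i).val v.1 (tvec v)) ⊆ (fun v : TangentBundle 𝓘(ℝ, EP) P => κ v.1) ⁻¹'
              tsupport (ρ i) := by
          refine closure_minimal (fun w hw => ?_) ((isClosed_tsupport _).preimage hκ'.continuous)
          refine subset_tsupport _ ?_
          exact fun h0 => hw (by simp only [h0, zero_smul])
        exact h2 hv
      exact (((ρ i).contMDiff.comp hκ').contMDiffAt).smul
        ((ha i).contMDiffAt (((hU i).preimage hκ'.continuous).mem_nhds hv'))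
    · refine LocallyFinite.subset (ρ.locallyFinite.preimage_continuous hκ'.continuous) fun i v hv => ?_
      exact fun h0 => hv (by simp only [h0, zero_smul])
  -- On the fibre over `n` the weights are constant, so there `b` agrees with a genuine convex
  -- combination of forms in `Φ n`. The condition sees nothing outside that fibre.
  · refine hcongr n (∑ i ∈ ρ.finsupport n, ρ i n • a i) b ?_ ?_
    · rintro e rfl
      exact Finset.sum_apply _ _ _
    · refine (hconv n).sum_mem (fun i _ => ρ.nonneg i n) (ρ.sum_finsupport n (mem_univ n)) fun i hi => ?_
      exact hΦ i n (hρ i (subset_tsupport _ ((ρ.mem_finsupport n).1 hi)))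

end LieForm

/-! ### The adjoint action and the cocycle of an infinitesimal automorphism. -/

section LieGroupCalculus

variable {EH H : Type*}
  [NormedAddCommGroup EH] [NormedSpace ℝ EH] [TopologicalSpace H] [ChartedSpace EH H] [Group H]

/-- The adjoint action of `h`, as a linear map of the model space. -/
def adMap (EH : Type*) [NormedAddCommGroup EH] [NormedSpace ℝ EH] {H : Type*} [TopologicalSpace H]
    [ChartedSpace EH H] [Group H] (h : H) : EH →L[ℝ] EH :=
  deriv' EH EH (fun x : H => h * x * h⁻¹) 1

/-- The cocycle `T_X`, with values in the model space. -/
def cocycle (X : LieAut EH H) (h : H) : EH := autCocycle X h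

theorem ContMDiff.left {E X : Type*} [NormedAddCommGroup E] [NormedSpace ℝ E]
    [TopologicalSpace X] [ChartedSpace E X] {γ : ℝ → X} (h : ContMDiff 𝓘(ℝ, ℝ) 𝓘(ℝ, E) ∞ γ) :
    ContMDiff 𝓘(ℝ, ℝ × ℝ) 𝓘(ℝ, E) ∞ fun p : ℝ × ℝ => γ p.1 :=
  h.comp contDiff_fst.contMDiff

theorem ContMDiff.right {E X : Type*} [NormedAddCommGroup E] [NormedSpace ℝ E]
    [TopologicalSpace X] [ChartedSpace E X] {γ : ℝ → X} (h : ContMDiff 𝓘(ℝ, ℝ) 𝓘(ℝ, E) ∞ γ) :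
    ContMDiff 𝓘(ℝ, ℝ × ℝ) 𝓘(ℝ, E) ∞ fun p : ℝ × ℝ => γ p.2 :=
  h.comp contDiff_snd.contMDiff

theorem cocycle_add (X Y : LieAut EH H) (h : H) :
    cocycle (X + Y) h = cocycle X h + cocycle Y h :=
  (deriv' EH EH (fun x : H => h * x) h⁻¹).map_add (X.1 h⁻¹) (Y.1 h⁻¹)

theorem cocycle_smul (r : ℝ) (X : LieAut EH H) (h : H) :
    cocycle (r • X) h = r • cocycle X h :=
  (deriv' EH EH (fun x : H => h * x) h⁻¹).map_smul r (X.1 h⁻¹)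

variable [LieGroup 𝓘(ℝ, EH) ∞ H]

theorem contMDiff_conj (h : H) : ContMDiff 𝓘(ℝ, EH) 𝓘(ℝ, EH) ∞ (fun x : H => h * x * h⁻¹) :=
  (contMDiff_const.mul contMDiff_id).mul contMDiff_const

theorem ContMDiff.conj {g : ℝ → H} (hg : ContMDiff 𝓘(ℝ, ℝ) 𝓘(ℝ, EH) ∞ g) (h : H) :
    ContMDiff 𝓘(ℝ, ℝ) 𝓘(ℝ, EH) ∞ (fun t => h * g t * h⁻¹) :=
  (contMDiff_conj h).comp hg

theorem vel_mul {f g : ℝ → H} (hf : ContMDiff 𝓘(ℝ, ℝ) 𝓘(ℝ, EH) ∞ f)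
    (hg : ContMDiff 𝓘(ℝ, ℝ) 𝓘(ℝ, EH) ∞ g) :
    vel EH (fun t => f t * g t) = vel EH (fun t => f t * g 0) + vel EH (fun t => f 0 * g t) :=
  vel_diag (G := fun t u => f t * g u) (hf.left.mul hg.right)

theorem vel_mul_of_one {f g : ℝ → H} (hf : ContMDiff 𝓘(ℝ, ℝ) 𝓘(ℝ, EH) ∞ f)
    (hg : ContMDiff 𝓘(ℝ, ℝ) 𝓘(ℝ, EH) ∞ g) (h0 : f 0 = 1) (k0 : g 0 = 1) :
    vel EH (fun t => f t * g t) = vel EH f + vel EH g := by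
  rw [vel_mul hf hg]
  simp only [h0, k0, mul_one, one_mul]

theorem vel_inv {g : ℝ → H} (hg : ContMDiff 𝓘(ℝ, ℝ) 𝓘(ℝ, EH) ∞ g) (h0 : g 0 = 1) :
    vel EH (fun t => (g t)⁻¹) = -vel EH g := by
  have h := vel_mul_of_one hg hg.inv h0 (by simp [h0])
  have h1 : vel EH (fun t => g t * (g t)⁻¹) = 0 := by
    simp only [mul_inv_cancel]
    exact vel_const 1
  rw [h1] at h
  exact (neg_eq_of_add_eq_zero_right h.symm).symm

theorem adMap_vel (h : H) {g : ℝ → H} (hg : ContMDiff 𝓘(ℝ, ℝ) 𝓘(ℝ, EH) ∞ g) (h0 : g 0 = 1) :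
    adMap EH h (vel EH g) = vel EH (fun t => h * g t * h⁻¹) :=
  deriv'_vel (contMDiff_conj h) hg h0

theorem exists_curve_one (ξ : EH) : ∃ g : ℝ → H, ContMDiff 𝓘(ℝ, ℝ) 𝓘(ℝ, EH) ∞ g ∧ g 0 = 1 ∧
    vel EH g = ξ := by
  have : IsManifold 𝓘(ℝ, EH) ∞ H := inferInstance
  obtain ⟨g, h1, h2, h3, -⟩ := exists_curve isOpen_univ (mem_univ (1 : H)) ξ
  exact ⟨g, h1, h2, h3⟩

theorem adMap_mul (h k : H) (ξ : EH) : adMap EH (h * k) ξ = adMap EH h (adMap EH k ξ) := by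
  obtain ⟨g, hg, h0, rfl⟩ := exists_curve_one (H := H) ξ
  rw [adMap_vel _ hg h0, adMap_vel _ hg h0, adMap_vel _ (hg.conj k) (by simp [h0])]
  congr 1
  funext t
  simp only [mul_inv_rev, mul_assoc]

theorem cocycle_eq {X : LieAut EH H} {c : ℝ → H ≃* H} (hc : IsAutCurve EH c)
    (hX : X.1 = autVelocity EH c) (h : H) :
    cocycle X h = vel EH (fun t => h * c t h⁻¹) := by
  have h1 : deriv' EH EH (fun x : H => h * x) h⁻¹ (vel EH (fun t => c t h⁻¹)) = _ :=
    deriv'_vel contMDiff_mul_left (hc.contMDiff_apply h⁻¹) (hc.zero _)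
  rw [← h1]
  exact congrArg (deriv' EH EH (fun x : H => h * x) h⁻¹) (congrFun hX h⁻¹)

/-- For a curve `c` representing `X`, left translation by `h` undoes the factor in `h⁻¹ c_t(h)`. So
the vector field `X` can be read off from its cocycle. -/
theorem deriv'_mul_left_cocycle (X : LieAut EH H) (h : H) :
    deriv' EH EH (fun x : H => h * x) 1 (cocycle X h⁻¹) = (X.1 h : EH) := by
  obtain ⟨c, hc, hX⟩ := X.2
  have hs : ContMDiff 𝓘(ℝ, ℝ) 𝓘(ℝ, EH) ∞ (fun t => h⁻¹ * c t h⁻¹⁻¹) :=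
    contMDiff_const.mul (hc.contMDiff_apply _)
  rw [cocycle_eq hc hX, deriv'_vel contMDiff_mul_left hs (by simp [hc.zero])]
  simp only [inv_inv, mul_inv_cancel_left]
  exact (congrFun hX h).symm

/-- Uniqueness principle for `A`: both its linearity and the equation `A₁₂ = A₁₃` are verified on
cocycles, which take values in one vector space. -/
theorem cocycle_injective {X Y : LieAut EH H} (h : ∀ k, cocycle X k = cocycle Y k) : X = Y := by
  refine Subtype.ext (funext fun k => ?_)
  have h1 := deriv'_mul_left_cocycle X k
  rw [h, deriv'_mul_left_cocycle Y k] at h1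
  exact h1.symm

/-- Since `c_t` is a homomorphism, `h k c_t((h k)⁻¹)` is the product of `h (k c_t(k⁻¹)) h⁻¹` and `h
c_t(h⁻¹)`, two curves through `1`, whose velocities add. -/
theorem cocycle_mul (X : LieAut EH H) (h k : H) :
    cocycle X (h * k) = cocycle X h + adMap EH h (cocycle X k) := by
  obtain ⟨c, hc, hX⟩ := X.2
  have hs : ∀ h : H, ContMDiff 𝓘(ℝ, ℝ) 𝓘(ℝ, EH) ∞ (fun t => h * c t h⁻¹) := fun h =>
    contMDiff_const.mul (hc.contMDiff_apply _)
  rw [cocycle_eq hc hX, cocycle_eq hc hX, cocycle_eq hc hX, adMap_vel h (hs k) (by simp [hc.zero]),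
    add_comm, ← vel_mul_of_one ((hs k).conj h) (hs h) (by simp [hc.zero])
      (by simp [hc.zero])]
  congr 1
  funext t
  simp only [mul_inv_rev, map_mul]
  group

end LieGroupCalculus

/-! ### Algebra and smoothness of division and of `φ` in a bibundle. -/

namespace Bibundle

variable {EH H EB B EP P : Type*}
  [NormedAddCommGroup EH] [NormedSpace ℝ EH] [TopologicalSpace H] [ChartedSpace EH H] [Group H]
  [NormedAddCommGroup EB] [NormedSpace ℝ EB] [TopologicalSpace B] [ChartedSpace EB B]
  [IsManifold 𝓘(ℝ, EB) ∞ B]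
  [NormedAddCommGroup EP] [NormedSpace ℝ EP] [TopologicalSpace P] [ChartedSpace EP P]
  [IsManifold 𝓘(ℝ, EP) ∞ P]
  (E : Bibundle EH H EB B EP P)

open scoped Classical in
/-- The left division of two points, which is `1` if they lie in different fibres. -/
def ld (x y : P) : H := if h : E.proj.toFun x = E.proj.toFun y then E.ldiv ⟨x, y, h⟩ else 1

open scoped Classical in
/-- The right division of two points, which is `1` if they lie in different fibres. -/
def rd (x y : P) : H := if h : E.proj.toFun x = E.proj.toFun y then E.rdiv ⟨x, y, h⟩ else 1

variable {E}

theorem ld_lact {x y : P} (h : E.proj.toFun x = E.proj.toFun y) : E.lact (E.ld x y) y = x := by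
  rw [ld, dif_pos h]
  exact E.lact_ldiv ⟨x, y, h⟩

theorem ract_rd {x y : P} (h : E.proj.toFun x = E.proj.toFun y) : E.ract y (E.rd x y) = x := by
  rw [rd, dif_pos h]
  exact E.ract_rdiv ⟨x, y, h⟩

theorem ld_eq {x y : P} {h : H} (hh : E.lact h y = x) : E.ld x y = h := by
  subst hh
  rw [ld, dif_pos (E.proj_lact h y)]
  exact E.ldiv_lact h y

theorem rd_eq {x y : P} {h : H} (hh : E.ract y h = x) : E.rd x y = h := by
  subst hh
  rw [rd, dif_pos (E.proj_ract y h)]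
  exact E.rdiv_ract y h

theorem lact_injective {h k : H} {e : P} (hh : E.lact h e = E.lact k e) : h = k :=
  (ld_eq hh).symm.trans (ld_eq rfl)

theorem ract_injective {h k : H} {e : P} (hh : E.ract e h = E.ract e k) : h = k :=
  (rd_eq hh).symm.trans (rd_eq rfl)

theorem phi_lact_eq (e : P) (h : H) : E.lact (E.phi e h) e = E.ract e h :=
  E.lact_ldiv ⟨E.ract e h, e, E.proj_ract e h⟩

theorem phi_eq {e : P} {h k : H} (hh : E.lact k e = E.ract e h) : E.phi e h = k :=
  lact_injective ((phi_lact_eq e h).trans hh.symm)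

/-- The two actions commute: `φ_e(h) φ_e(k) e = φ_e(h) (e ◁ k) = (φ_e(h) e) ◁ k = e ◁ (h k)`, and
the left action is free. -/
theorem phi_mul (e : P) (h k : H) : E.phi e (h * k) = E.phi e h * E.phi e k := by
  refine phi_eq ?_
  rw [E.mul_lact, phi_lact_eq, E.ract_mul, ← E.lact_ract, phi_lact_eq]

theorem phi_one (e : P) : E.phi e 1 = 1 := phi_eq (by rw [E.one_lact, E.ract_one])

theorem phi_lact (g : H) (e : P) (h : H) : E.phi (E.lact g e) h = g * E.phi e h * g⁻¹ := by
  refine phi_eq ?_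
  rw [← E.mul_lact, E.lact_ract, ← phi_lact_eq, ← E.mul_lact, inv_mul_cancel_right]

variable (E) in
/-- The inverse of `φ_e`. -/
def psi (e : P) (h : H) : H := E.rd (E.lact h e) e

theorem ract_psi (e : P) (h : H) : E.ract e (E.psi e h) = E.lact h e := ract_rd (E.proj_lact h e)

theorem phi_psi (e : P) (h : H) : E.phi e (E.psi e h) = h := phi_eq (ract_psi e h).symm

theorem psi_phi (e : P) (h : H) : E.psi e (E.phi e h) = h :=
  ract_injective ((ract_psi e _).trans (phi_lact_eq e h))

variable (E) in
/-- The automorphism `φ_e` of `H`. -/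
def phiEquiv (e : P) : H ≃* H where
  toFun := E.phi e
  invFun := E.psi e
  left_inv := psi_phi e
  right_inv := phi_psi e
  map_mul' := phi_mul e

section Smooth

variable {EN HN N : Type*} [NormedAddCommGroup EN] [NormedSpace ℝ EN] [TopologicalSpace HN]
  {J : ModelWithCorners ℝ EN HN} [TopologicalSpace N] [ChartedSpace HN N] {s : Set N}

theorem contMDiff_proj : ContMDiff 𝓘(ℝ, EP) 𝓘(ℝ, EB) ∞ E.proj.toFun := E.proj.toMap.contMDiff

theorem _root_.ContMDiffOn.lact {h : N → H} {x : N → P} (hh : ContMDiffOn J 𝓘(ℝ, EH) ∞ h s)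
    (hx : ContMDiffOn J 𝓘(ℝ, EP) ∞ x s) :
    ContMDiffOn J 𝓘(ℝ, EP) ∞ (fun n => E.lact (h n) (x n)) s :=
  E.contMDiff_lact.comp_contMDiffOn (hh.prodMk hx)

theorem _root_.ContMDiffOn.ract {h : N → H} {x : N → P} (hx : ContMDiffOn J 𝓘(ℝ, EP) ∞ x s)
    (hh : ContMDiffOn J 𝓘(ℝ, EH) ∞ h s) :
    ContMDiffOn J 𝓘(ℝ, EP) ∞ (fun n => E.ract (x n) (h n)) s :=
  E.contMDiff_ract.comp_contMDiffOn (hx.prodMk hh)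

theorem _root_.ContMDiffOn.ld (hs : IsOpen s) {x y : N → P} (hx : ContMDiffOn J 𝓘(ℝ, EP) ∞ x s)
    (hy : ContMDiffOn J 𝓘(ℝ, EP) ∞ y s)
    (h : ∀ n ∈ s, E.proj.toFun (x n) = E.proj.toFun (y n)) :
    ContMDiffOn J 𝓘(ℝ, EH) ∞ (fun n => E.ld (x n) (y n)) s := by
  rcases s.eq_empty_or_nonempty with rfl | hne
  · exact fun n hn => hn.elim
  obtain ⟨q, hq, hq'⟩ := FibProd.exists_lift (f := E.proj.toMap) (g := E.proj) hs hne hx hy h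
  refine (E.contMDiff_ldiv.comp_contMDiffOn hq).congr fun n hn => ?_
  refine ld_eq ?_
  rw [← (hq' n hn).1, ← (hq' n hn).2]
  exact E.lact_ldiv (q n)

theorem _root_.ContMDiffOn.rd (hs : IsOpen s) {x y : N → P} (hx : ContMDiffOn J 𝓘(ℝ, EP) ∞ x s)
    (hy : ContMDiffOn J 𝓘(ℝ, EP) ∞ y s)
    (h : ∀ n ∈ s, E.proj.toFun (x n) = E.proj.toFun (y n)) :
    ContMDiffOn J 𝓘(ℝ, EH) ∞ (fun n => E.rd (x n) (y n)) s := by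
  rcases s.eq_empty_or_nonempty with rfl | hne
  · exact fun n hn => hn.elim
  obtain ⟨q, hq, hq'⟩ := FibProd.exists_lift (f := E.proj.toMap) (g := E.proj) hs hne hx hy h
  refine (E.contMDiff_rdiv.comp_contMDiffOn hq).congr fun n hn => ?_
  refine rd_eq ?_
  rw [← (hq' n hn).1, ← (hq' n hn).2]
  exact E.ract_rdiv (q n)

theorem _root_.ContMDiff.lact {h : N → H} {x : N → P} (hh : ContMDiff J 𝓘(ℝ, EH) ∞ h)
    (hx : ContMDiff J 𝓘(ℝ, EP) ∞ x) : ContMDiff J 𝓘(ℝ, EP) ∞ (fun n => E.lact (h n) (x n)) :=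
  E.contMDiff_lact.comp (hh.prodMk hx)

theorem _root_.ContMDiff.ract {h : N → H} {x : N → P} (hx : ContMDiff J 𝓘(ℝ, EP) ∞ x)
    (hh : ContMDiff J 𝓘(ℝ, EH) ∞ h) : ContMDiff J 𝓘(ℝ, EP) ∞ (fun n => E.ract (x n) (h n)) :=
  E.contMDiff_ract.comp (hx.prodMk hh)

theorem _root_.ContMDiff.ld {x y : N → P} (hx : ContMDiff J 𝓘(ℝ, EP) ∞ x)
    (hy : ContMDiff J 𝓘(ℝ, EP) ∞ y) (h : ∀ n, E.proj.toFun (x n) = E.proj.toFun (y n)) :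
    ContMDiff J 𝓘(ℝ, EH) ∞ (fun n => E.ld (x n) (y n)) :=
  contMDiffOn_univ.1 (hx.contMDiffOn.ld isOpen_univ hy.contMDiffOn fun n _ => h n)

theorem _root_.ContMDiff.rd {x y : N → P} (hx : ContMDiff J 𝓘(ℝ, EP) ∞ x)
    (hy : ContMDiff J 𝓘(ℝ, EP) ∞ y) (h : ∀ n, E.proj.toFun (x n) = E.proj.toFun (y n)) :
    ContMDiff J 𝓘(ℝ, EH) ∞ (fun n => E.rd (x n) (y n)) :=
  contMDiffOn_univ.1 (hx.contMDiffOn.rd isOpen_univ hy.contMDiffOn fun n _ => h n)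

theorem _root_.ContMDiff.phi {x : N → P} {h : N → H} (hx : ContMDiff J 𝓘(ℝ, EP) ∞ x)
    (hh : ContMDiff J 𝓘(ℝ, EH) ∞ h) : ContMDiff J 𝓘(ℝ, EH) ∞ (fun n => E.phi (x n) (h n)) := by
  have h1 := (hx.ract (E := E) hh).ld hx fun _ => E.proj_ract _ _
  have h2 : ∀ n, E.ld (E.ract (x n) (h n)) (x n) = E.phi (x n) (h n) :=
    fun n => ld_eq (phi_lact_eq _ _)
  simpa only [h2] using h1

theorem _root_.ContMDiff.psi {x : N → P} {h : N → H} (hx : ContMDiff J 𝓘(ℝ, EP) ∞ x)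
    (hh : ContMDiff J 𝓘(ℝ, EH) ∞ h) : ContMDiff J 𝓘(ℝ, EH) ∞ (fun n => E.psi (x n) (h n)) :=
  (hh.lact (E := E) hx).rd hx fun _ => E.proj_lact _ _

end Smooth

theorem contMDiff_phi (e : P) : ContMDiff 𝓘(ℝ, EH) 𝓘(ℝ, EH) ∞ (E.phi e) :=
  contMDiff_const.phi contMDiff_id

theorem contMDiff_psi (e : P) : ContMDiff 𝓘(ℝ, EH) 𝓘(ℝ, EH) ∞ (E.psi e) :=
  contMDiff_const.psi contMDiff_id

variable (E) in
/-- The differential of `φ_e` at `1`, as a linear map of the model space. -/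
def dphi (e : P) : EH →L[ℝ] EH := deriv' EH EH (E.phi e) 1

theorem dphi_vel (e : P) {g : ℝ → H} (hg : ContMDiff 𝓘(ℝ, ℝ) 𝓘(ℝ, EH) ∞ g) (h0 : g 0 = 1) :
    E.dphi e (vel EH g) = vel EH (fun t => E.phi e (g t)) :=
  deriv'_vel (contMDiff_phi e) hg h0

theorem dphi_lact [LieGroup 𝓘(ℝ, EH) ∞ H] (h : H) (e : P) (ξ : EH) :
    E.dphi (E.lact h e) ξ = adMap EH h (E.dphi e ξ) := by
  obtain ⟨g, hg, h0, rfl⟩ := exists_curve_one (H := H) ξ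
  rw [dphi_vel _ hg h0, dphi_vel _ hg h0,
    adMap_vel h (contMDiff_const.phi hg) (by simp [h0, phi_one])]
  simp only [phi_lact]

end Bibundle

/-! ### Evaluation of one-forms on curves. -/

namespace LieForm

variable {EH H EP P : Type*}
  [NormedAddCommGroup EH] [NormedSpace ℝ EH] [TopologicalSpace H] [ChartedSpace EH H] [Group H]
  [NormedAddCommGroup EP] [NormedSpace ℝ EP] [TopologicalSpace P] [ChartedSpace EP P]

/-- The value of a one-form on the velocity of a curve at time `0`. -/
def ev (a : LieForm EH H EP P) (γ : ℝ → P) : EH := a.val (γ 0) (vel EP γ)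

theorem ev_comb (x y : ℝ) (a b : LieForm EH H EP P) (γ : ℝ → P) :
    (x • a + y • b).ev γ = x • a.ev γ + y • b.ev γ := rfl

theorem ev_congr {a b : LieForm EH H EP P} {γ : ℝ → P} (h : a (γ 0) = b (γ 0)) :
    a.ev γ = b.ev γ :=
  congrArg (fun L => L (vel EP γ)) h

theorem ev_comp_time (a : LieForm EH H EP P) {γ : ℝ → P}
    (hγ : ContMDiff 𝓘(ℝ, ℝ) 𝓘(ℝ, EP) ∞ γ) {τ : ℝ → ℝ} (h0 : τ 0 = 0) (hτ : HasDerivAt τ 1 0) :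
    a.ev (fun t => γ (τ t)) = a.ev γ := by
  change a.val (γ (τ 0)) _ = _
  rw [vel_comp_time hγ h0 hτ, one_smul, h0]
  rfl

theorem ev_const (a : LieForm EH H EP P) (e : P) : a.ev (fun _ => e) = 0 := by
  unfold ev
  rw [vel_const]
  exact (a e).map_zero

theorem ev_diag (a : LieForm EH H EP P) {G : ℝ → ℝ → P}
    (hG : ContMDiff 𝓘(ℝ, ℝ × ℝ) 𝓘(ℝ, EP) ∞ fun p : ℝ × ℝ => G p.1 p.2) :
    a.ev (fun t => G t t) = a.ev (fun t => G t 0) + a.ev (fun t => G 0 t) := by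
  unfold ev
  rw [vel_diag hG]
  exact (a (G 0 0)).map_add _ _

end LieForm

/-! ### Right-invariant vertical forms with left cocycles on a bibundle. -/

namespace Bibundle

variable {EH H EB B EP P : Type*}
  [NormedAddCommGroup EH] [NormedSpace ℝ EH] [TopologicalSpace H] [ChartedSpace EH H] [Group H]
  [NormedAddCommGroup EB] [NormedSpace ℝ EB] [TopologicalSpace B] [ChartedSpace EB B]
  [IsManifold 𝓘(ℝ, EB) ∞ B]
  [NormedAddCommGroup EP] [NormedSpace ℝ EP] [TopologicalSpace P] [ChartedSpace EP P]
  [IsManifold 𝓘(ℝ, EP) ∞ P]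
  (E : Bibundle EH H EB B EP P)

/-- At `e`, the form takes the value `-[g(t)]` on the vertical vector `[g(t) e]`. -/
def IsVerticalAt (a : LieForm EH H EP P) (e : P) : Prop :=
  ∀ g : ℝ → H, ContMDiff 𝓘(ℝ, ℝ) 𝓘(ℝ, EH) ∞ g → g 0 = 1 →
    a.ev (fun t => E.lact (g t) e) = -vel EH g

/-- At `e`, the form is invariant under right translations. -/
def IsRightInvariantAt (a : LieForm EH H EP P) (e : P) : Prop :=
  ∀ γ : ℝ → P, ContMDiff 𝓘(ℝ, ℝ) 𝓘(ℝ, EP) ∞ γ → γ 0 = e → ∀ h,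
    a.ev (fun t => E.ract (γ t) h) = a.ev γ

/-- At `e`, the form is equivariant under left translations up to the cocycle of an infinitesimal
automorphism of `H`. -/
def HasCocycleAt (a : LieForm EH H EP P) (e : P) : Prop :=
  ∀ γ : ℝ → P, ContMDiff 𝓘(ℝ, ℝ) 𝓘(ℝ, EP) ∞ γ → γ 0 = e → ∃ X : LieAut EH H, ∀ h,
    a.ev (fun t => E.lact h (γ t)) = adMap EH h (a.ev γ) + cocycle X h

variable {E}

theorem convex_isVerticalAt (e : P) : Convex ℝ {a | E.IsVerticalAt a e} := by
  intro a ha b hb x y _ _ hxy g hg h0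
  rw [LieForm.ev_comb, ha g hg h0, hb g hg h0, ← add_smul, hxy, one_smul]

theorem convex_isRightInvariantAt (e : P) : Convex ℝ {a | E.IsRightInvariantAt a e} := by
  intro a ha b hb x y _ _ _ γ hγ h0 h
  rw [LieForm.ev_comb, ha γ hγ h0, hb γ hγ h0, ← LieForm.ev_comb]

/-- The cocycle `T_X` is linear in `X`, so the same combination of the infinitesimal automorphisms
serves the combined form. -/
theorem convex_hasCocycleAt (e : P) : Convex ℝ {a | E.HasCocycleAt a e} := by
  intro a ha b hb x y _ _ _ γ hγ h0
  obtain ⟨X, hX⟩ := ha γ hγ h0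
  obtain ⟨Y, hY⟩ := hb γ hγ h0
  refine ⟨x • X + y • Y, fun h => ?_⟩
  rw [LieForm.ev_comb, LieForm.ev_comb, hX, hY, cocycle_add, cocycle_smul, cocycle_smul, map_add,
    map_smul, map_smul, smul_add, smul_add]
  abel

/-- Both actions preserve fibres, so this condition and the next two depend only on the form along
the fibre through `e`. The gluing lemma asks for exactly this locality. -/
theorem IsVerticalAt.congr {a b : LieForm EH H EP P} {e : P} (h : E.IsVerticalAt a e)
    (hab : ∀ e', E.proj.toFun e' = E.proj.toFun e → a e' = b e') : E.IsVerticalAt b e := by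
  intro g hg h0
  rw [← h g hg h0]
  exact (LieForm.ev_congr (hab _ (E.proj_lact _ _))).symm

theorem IsRightInvariantAt.congr {a b : LieForm EH H EP P} {e : P}
    (h : E.IsRightInvariantAt a e)
    (hab : ∀ e', E.proj.toFun e' = E.proj.toFun e → a e' = b e') : E.IsRightInvariantAt b e := by
  rintro γ hγ rfl k
  rw [← LieForm.ev_congr (hab (γ 0) rfl), ← h γ hγ rfl k]
  exact (LieForm.ev_congr (hab _ (E.proj_ract _ _))).symm

theorem HasCocycleAt.congr {a b : LieForm EH H EP P} {e : P} (h : E.HasCocycleAt a e)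
    (hab : ∀ e', E.proj.toFun e' = E.proj.toFun e → a e' = b e') : E.HasCocycleAt b e := by
  rintro γ hγ rfl
  obtain ⟨X, hX⟩ := h γ hγ rfl
  refine ⟨X, fun k => ?_⟩
  rw [← LieForm.ev_congr (hab (γ 0) rfl), ← hX k]
  exact (LieForm.ev_congr (hab _ (E.proj_lact _ _))).symm

variable (E) in
/-- The right-invariant form whose kernel is spanned by the right translates of a section. -/
def flatForm (σ : B → P) : LieForm EH H EP P := fun e =>
  deriv' EP EH (fun x => E.ld (E.ract (σ (E.proj.toFun x)) (E.rd e (σ (E.proj.toFun e)))) x) e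

/-! ### The flat form of a local section. -/

section FlatForm

variable {σ : B → P} {W : Set B} (hW : IsOpen W) (hσ : ContMDiffOn 𝓘(ℝ, EB) 𝓘(ℝ, EP) ∞ σ W)
  (hs : ∀ b ∈ W, E.proj.toFun (σ b) = b)
include hW hσ hs

/-- Working formula: `k` is fixed by the starting point, and the value is the velocity of the curve
`l` in `H` with `l(t) γ(t) = σ(p γ(t)) ◁ k`. -/
theorem flatForm_ev {γ : ℝ → P} (hγ : ContMDiff 𝓘(ℝ, ℝ) 𝓘(ℝ, EP) ∞ γ)
    (h : ∀ t, E.proj.toFun (γ t) ∈ W) {k : H} (hk : E.ract (σ (E.proj.toFun (γ 0))) k = γ 0) :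
    (E.flatForm σ).ev γ = vel EH (fun t => E.ld (E.ract (σ (E.proj.toFun (γ t))) k) (γ t)) := by
  have hO : IsOpen (E.proj.toFun ⁻¹' W) := hW.preimage E.contMDiff_proj.continuous
  have h1 : ContMDiffOn 𝓘(ℝ, EP) 𝓘(ℝ, EH) ∞
      (fun x => E.ld (E.ract (σ (E.proj.toFun x)) k) x) (E.proj.toFun ⁻¹' W) := by
    refine ContMDiffOn.ld hO (ContMDiffOn.ract (hσ.comp E.contMDiff_proj.contMDiffOn fun x hx => hx)
      contMDiffOn_const) contMDiffOn_id fun x hx => ?_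
    exact (E.proj_ract _ _).trans (hs _ hx)
  rw [← deriv'_vel_of_mdifferentiableAt (h1.mdifferentiableAt' hO (h 0)) (hγ.mdifferentiableAt' 0),
    ← rd_eq hk]
  rfl

theorem flatForm_smoothOn [LieGroup 𝓘(ℝ, EH) ∞ H] :
    (E.flatForm σ).SmoothOn (E.proj.toFun ⁻¹' W) := by
  have hO : IsOpen (E.proj.toFun ⁻¹' W) := hW.preimage E.contMDiff_proj.continuous
  have hσ' : ContMDiffOn 𝓘(ℝ, EP) 𝓘(ℝ, EP) ∞ (fun x => σ (E.proj.toFun x))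
      (E.proj.toFun ⁻¹' W) := hσ.comp E.contMDiff_proj.contMDiffOn fun x hx => hx
  have hΩ : IsOpen ((E.proj.toFun ⁻¹' W) ×ˢ (E.proj.toFun ⁻¹' W)) := hO.prod hO
  -- The base point plays two roles: it is differentiated, and it fixes the group element.
  -- Separating them gives a smooth function of two variables, whose partial derivative is then
  -- restricted to the diagonal.
  have h1 : ContMDiffOn (𝓘(ℝ, EP).prod 𝓘(ℝ, EP)) 𝓘(ℝ, EH) ∞
      (fun p : P × P => E.ld (E.ract (σ (E.proj.toFun p.1)) (E.rd p.2 (σ (E.proj.toFun p.2)))) p.1)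
      ((E.proj.toFun ⁻¹' W) ×ˢ (E.proj.toFun ⁻¹' W)) := by
    refine ContMDiffOn.ld hΩ (ContMDiffOn.ract (hσ'.comp contMDiffOn_fst fun x hx => hx.1)
      (ContMDiffOn.rd hΩ contMDiffOn_snd (hσ'.comp contMDiffOn_snd fun x hx => hx.2) fun x hx =>
        (hs _ hx.2).symm)) contMDiffOn_fst fun x hx => ?_
    exact (E.proj_ract _ _).trans (hs _ hx.1)
  have h2 := contMDiffOn_partial_deriv (F := fun x e =>
    E.ld (E.ract (σ (E.proj.toFun x)) (E.rd e (σ (E.proj.toFun e)))) x) hΩ h1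
  have h3 : ContMDiff 𝓘(ℝ, EP).tangent (𝓘(ℝ, EP).tangent.prod 𝓘(ℝ, EP)) ∞
      (fun v : TangentBundle 𝓘(ℝ, EP) P => (v, v.1)) :=
    contMDiff_id.prodMk (Bundle.contMDiff_proj (TangentSpace 𝓘(ℝ, EP)))
  have h4 := h2.comp (h3.contMDiffOn
    (s := {v : TangentBundle 𝓘(ℝ, EP) P | v.1 ∈ E.proj.toFun ⁻¹' W})) fun v hv => ⟨hv, hv⟩
  refine (contMDiffOn_tangentSpace_iff (x := (1 : H))).1 (h4.congr fun v hv => ?_)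
  -- On the diagonal the function equals `1`, so its derivative lies in the single tangent space
  -- `Lie(H)`.
  have h5 : E.ld (E.ract (σ (E.proj.toFun v.1)) (E.rd v.1 (σ (E.proj.toFun v.1)))) v.1 = 1 := by
    rw [ract_rd (hs _ hv).symm]
    exact ld_eq (E.one_lact _)
  refine congrArg (fun k => tmk k _) h5.symm

theorem flatForm_isVerticalAt [LieGroup 𝓘(ℝ, EH) ∞ H] {e : P} (he : E.proj.toFun e ∈ W) :
    E.IsVerticalAt (E.flatForm σ) e := by
  intro g hg h0
  have hk : E.ract (σ (E.proj.toFun e)) (E.rd e (σ (E.proj.toFun e))) = e := ract_rd (hs _ he).symm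
  rw [flatForm_ev hW hσ hs (k := E.rd e (σ (E.proj.toFun e))) (hg.lact contMDiff_const)
    (by simpa only [E.proj_lact] using fun _ => he) (by simp only [h0, E.one_lact, hk]),
    ← vel_inv hg h0]
  congr 1
  funext t
  refine ld_eq ?_
  rw [← E.mul_lact, inv_mul_cancel, E.one_lact, E.proj_lact, hk]

/-- Translating the curve by `h` replaces `k` by `k h` and leaves the curve `l` of `flatForm_ev`
unchanged. -/
theorem flatForm_isRightInvariantAt {e : P} (he : E.proj.toFun e ∈ W) :
    E.IsRightInvariantAt (E.flatForm σ) e := by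
  rintro γ hγ rfl h
  obtain ⟨τ, h1, h2, h3, h4⟩ := exists_time_mapsTo hγ
    (hW.preimage E.contMDiff_proj.continuous) he
  have hc : ContMDiff 𝓘(ℝ, ℝ) 𝓘(ℝ, EP) ∞ (fun t => γ (τ t)) := hγ.comp h1.contMDiff
  have hk : E.ract (σ (E.proj.toFun (γ 0))) (E.rd (γ 0) (σ (E.proj.toFun (γ 0)))) = γ 0 :=
    ract_rd (hs _ he).symm
  rw [← LieForm.ev_comp_time _ hγ h2 h3, ← LieForm.ev_comp_time _
    (ContMDiff.ract (E := E) hγ contMDiff_const) h2 h3,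
    flatForm_ev hW hσ hs hc h4 (by simpa only [h2] using hk),
    flatForm_ev hW hσ hs (k := E.rd (γ 0) (σ (E.proj.toFun (γ 0))) * h)
      (hc.ract contMDiff_const) (fun t => (E.proj_ract _ _).symm ▸ h4 t)
      (by simp only [E.proj_ract, h2, E.ract_mul, hk])]
  congr 1
  funext t
  refine ld_eq ?_
  rw [← E.lact_ract, ld_lact, E.proj_ract, ← E.ract_mul]
  exact (E.proj_ract _ _).trans (hs _ (h4 t))

/-- Let `β = σ(p γ) ◁ k` and `l γ = β`. For the curve `h γ` the reference curve is `β ◁ φ_e⁻¹(h) =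
d_t(h) β` with `d_t = φ_{β(t)} φ_e⁻¹`, so `l` is replaced by `d_t(h) l h⁻¹`. Its velocity is `Ad_h
[l]` plus the velocity of `d_t(h) h⁻¹`, and `d_t` is a curve of automorphisms through the identity.
-/
theorem flatForm_cocycle [LieGroup 𝓘(ℝ, EH) ∞ H] {γ : ℝ → P}
    (hγ : ContMDiff 𝓘(ℝ, ℝ) 𝓘(ℝ, EP) ∞ γ) (hγW : ∀ t, E.proj.toFun (γ t) ∈ W) :
    ∃ X : LieAut EH H, ∀ h, (E.flatForm σ).ev (fun t => E.lact h (γ t)) =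
      adMap EH h ((E.flatForm σ).ev γ) + cocycle X h := by
  set e := γ 0
  set k := E.rd e (σ (E.proj.toFun e))
  have hk : E.ract (σ (E.proj.toFun e)) k = e := ract_rd (hs _ (hγW 0)).symm
  set β : ℝ → P := fun t => E.ract (σ (E.proj.toFun (γ t))) k
  have hβ : ContMDiff 𝓘(ℝ, ℝ) 𝓘(ℝ, EP) ∞ β := by
    refine ContMDiff.ract ?_ contMDiff_const
    exact contMDiffOn_univ.1 (hσ.comp (E.contMDiff_proj.comp hγ).contMDiffOn fun t _ => hγW t)
  have hβe : β 0 = e := hk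
  have hpβ : ∀ t, E.proj.toFun (β t) = E.proj.toFun (γ t) := fun t =>
    (E.proj_ract _ _).trans (hs _ (hγW t))
  let d : ℝ → H ≃* H := fun t => (E.phiEquiv e).symm.trans (E.phiEquiv (β t))
  have hd : IsAutCurve EH d := by
    refine ⟨fun h => ?_, fun t => ?_, ?_⟩
    · change E.phi (β 0) (E.psi e h) = h
      rw [hβe, phi_psi]
    · exact (contMDiff_phi e).comp (contMDiff_psi (β t))
    · exact ContMDiff.phi (hβ.comp contMDiff_fst) ((contMDiff_psi e).comp contMDiff_snd)
  let X : LieAut EH H := ⟨autVelocity EH d, d, hd, rfl⟩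
  -- The sign appears because `d_t(h) h⁻¹` is the inverse of the curve `h d_t(h⁻¹)` that defines the
  -- cocycle of `X`.
  refine ⟨(-1 : ℝ) • X, fun h => ?_⟩
  have hX : cocycle ((-1 : ℝ) • X) h = vel EH (fun t => d t h * h⁻¹) := by
    have h1 : ContMDiff 𝓘(ℝ, ℝ) 𝓘(ℝ, EH) ∞ (fun t => h * d t h⁻¹) :=
      contMDiff_const.mul (hd.contMDiff_apply _)
    rw [cocycle_smul, cocycle_eq hd rfl, neg_one_smul, ← vel_inv h1 (by simp [hd.zero])]
    simp only [mul_inv_rev, map_inv, inv_inv]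
  have hl : ContMDiff 𝓘(ℝ, ℝ) 𝓘(ℝ, EH) ∞ (fun t => E.ld (β t) (γ t)) := hβ.ld hγ hpβ
  have hl0 : E.ld (β 0) (γ 0) = 1 := ld_eq (by rw [E.one_lact, hβe])
  have hl' : ContMDiff 𝓘(ℝ, ℝ) 𝓘(ℝ, EH) ∞ (fun t => E.ld (β t) (γ t) * h⁻¹) :=
    hl.mul contMDiff_const
  have h5 : ∀ t, E.ld (E.ract (σ (E.proj.toFun (E.lact h (γ t)))) (k * E.psi e h))
      (E.lact h (γ t)) = d t h * (E.ld (β t) (γ t) * h⁻¹) := by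
    intro t
    refine ld_eq ?_
    rw [← E.mul_lact, E.proj_lact, E.ract_mul, mul_assoc, inv_mul_cancel_right, E.mul_lact,
      ld_lact (hpβ t)]
    exact phi_lact_eq (β t) (E.psi e h)
  have h6 : E.ract (σ (E.proj.toFun (E.lact h e))) (k * E.psi e h) = E.lact h e := by
    rw [E.proj_lact, E.ract_mul, hk, ract_psi]
  rw [flatForm_ev hW hσ hs hγ hγW hk, flatForm_ev hW hσ hs (k := k * E.psi e h)
      (contMDiff_const.lact hγ) (fun t => by simpa only [E.proj_lact] using hγW t) h6,
    adMap_vel h hl hl0, hX, add_comm]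
  simp only [h5]
  rw [vel_mul (hd.contMDiff_apply h) hl']
  simp only [hl0, hd.zero, one_mul, mul_assoc]

theorem flatForm_hasCocycleAt [LieGroup 𝓘(ℝ, EH) ∞ H] {e : P} (he : E.proj.toFun e ∈ W) :
    E.HasCocycleAt (E.flatForm σ) e := by
  rintro γ hγ rfl
  obtain ⟨τ, h1, h2, h3, h4⟩ := exists_time_mapsTo hγ
    (hW.preimage E.contMDiff_proj.continuous) he
  obtain ⟨X, hX⟩ := flatForm_cocycle hW hσ hs (hγ.comp h1.contMDiff) h4
  refine ⟨X, fun h => ?_⟩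
  rw [← LieForm.ev_comp_time _ hγ h2 h3, ← LieForm.ev_comp_time _
    (ContMDiff.lact (E := E) (contMDiff_const (c := h)) hγ) h2 h3]
  exact hX h

end FlatForm

/-- A principal bibundle over a second countable Hausdorff base has a smooth right-invariant
vertical one-form which is a cocycle on the left. -/
theorem exists_rightInvariant_form [LieGroup 𝓘(ℝ, EH) ∞ H] [FiniteDimensional ℝ EB] [T2Space B]
    [SecondCountableTopology B] (E : Bibundle EH H EB B EP P) :
    ∃ a : LieForm EH H EP P, a.Smooth ∧ ∀ e, E.IsVerticalAt a e ∧ E.IsRightInvariantAt a e ∧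
      E.HasCocycleAt a e := by
  let Φ : B → Set (LieForm EH H EP P) := fun b => ⋂ (e : P) (_ : E.proj.toFun e = b),
    ({a | E.IsVerticalAt a e} ∩ {a | E.IsRightInvariantAt a e} ∩ {a | E.HasCocycleAt a e})
  have h : ∃ a : LieForm EH H EP P, a.Smooth ∧ ∀ b, a ∈ Φ b := by
    refine LieForm.exists_smooth_of_local E.contMDiff_proj (fun b => ?_) (fun b a a' h ha => ?_)
      (fun b => ?_)
    · exact convex_iInter₂ fun e _ => ((convex_isVerticalAt e).inter
        (convex_isRightInvariantAt e)).inter (convex_hasCocycleAt e)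
    · refine mem_iInter₂.2 fun e he => ?_
      subst he
      have := mem_iInter₂.1 ha e rfl
      exact ⟨⟨this.1.1.congr h, this.1.2.congr h⟩, this.2.congr h⟩
    · obtain ⟨e, rfl⟩ := E.surjective_proj b
      obtain ⟨W, σ, hW, hb, hσ, -, hs⟩ := E.proj.exists_local_section e
      refine ⟨W, hW, hb, E.flatForm σ, flatForm_smoothOn hW hσ hs, fun b hb => ?_⟩
      refine mem_iInter₂.2 fun e he => ?_
      subst he
      exact ⟨⟨flatForm_isVerticalAt hW hσ hs hb, flatForm_isRightInvariantAt hW hσ hs hb⟩,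
        flatForm_hasCocycleAt hW hσ hs hb⟩
  obtain ⟨a, ha, hΦ⟩ := h
  refine ⟨a, ha, fun e => ?_⟩
  have := mem_iInter₂.1 (hΦ (E.proj.toFun e)) e rfl
  exact ⟨this.1.1, this.1.2, this.2⟩

end Bibundle

/-! ### The groupoid multiplication of a bundle gerbe. -/

namespace BundleGerbe

variable {EM EY F EH EP M Y H P : Type*}
  [NormedAddCommGroup EM] [NormedSpace ℝ EM] [NormedAddCommGroup EY] [NormedSpace ℝ EY]
  [NormedAddCommGroup F] [NormedSpace ℝ F]
  [NormedAddCommGroup EH] [NormedSpace ℝ EH] [NormedAddCommGroup EP] [NormedSpace ℝ EP]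
  [TopologicalSpace M] [ChartedSpace EM M] [IsManifold 𝓘(ℝ, EM) ∞ M]
  [TopologicalSpace Y] [ChartedSpace EY Y] [IsManifold 𝓘(ℝ, EY) ∞ Y]
  [TopologicalSpace H] [ChartedSpace EH H] [Group H]
  [TopologicalSpace P] [ChartedSpace EP P] [IsManifold 𝓘(ℝ, EP) ∞ P]
  {π : Submersion F EY EM Y M} (G : BundleGerbe EH H EP P π)

/-- The point `y₁` below `e`, for `e` over `(y₁, y₂)`. -/
def src (e : P) : Y := (G.E.proj.toFun e).fst

/-- The point `y₂` below `e`, for `e` over `(y₁, y₂)`. -/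
def tgt (e : P) : Y := (G.E.proj.toFun e).snd

/-- The point of `M` below `e`. -/
def base (e : P) : M := π.toFun (G.src e)

theorem base_eq_tgt (e : P) : G.base e = π.toFun (G.tgt e) := (G.E.proj.toFun e).comm

open scoped Classical in
/-- The groupoid multiplication `ℰ₁₂ × ℰ₂₃ → ℰ₁₃`, extended arbitrarily to all pairs. -/
def mul (e e' : P) : P := if h : G.tgt e = G.src e' then gerbeMul G.f e e' h else e

variable {G}

theorem mul_eq {e e' : P} (h : G.tgt e = G.src e') : G.mul e e' = gerbeMul G.f e e' h := dif_pos h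

@[simp] theorem src_lact (h : H) (e : P) : G.src (G.E.lact h e) = G.src e :=
  congrArg FibProd.fst (G.E.proj_lact h e)

@[simp] theorem tgt_lact (h : H) (e : P) : G.tgt (G.E.lact h e) = G.tgt e :=
  congrArg FibProd.snd (G.E.proj_lact h e)

@[simp] theorem src_ract (e : P) (h : H) : G.src (G.E.ract e h) = G.src e :=
  congrArg FibProd.fst (G.E.proj_ract e h)

@[simp] theorem tgt_ract (e : P) (h : H) : G.tgt (G.E.ract e h) = G.tgt e :=
  congrArg FibProd.snd (G.E.proj_ract e h)

@[simp] theorem base_lact (h : H) (e : P) : G.base (G.E.lact h e) = G.base e := by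
  simp only [base, src_lact]

theorem src_mul {e e' : P} (h : G.tgt e = G.src e') : G.src (G.mul e e') = G.src e := by
  rw [mul_eq h]
  exact (proj_gerbeMul G.f e e' h).1

theorem tgt_mul {e e' : P} (h : G.tgt e = G.src e') : G.tgt (G.mul e e') = G.tgt e' := by
  rw [mul_eq h]
  exact (proj_gerbeMul G.f e e' h).2

theorem base_mul {e e' : P} (h : G.tgt e = G.src e') : G.base (G.mul e e') = G.base e := by
  simp only [base, src_mul h]

theorem base_eq_base {e e' : P} (h : G.tgt e = G.src e') : G.base e = G.base e' := by
  rw [base_eq_tgt, h, base]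

theorem mul_mul_mul {e₁ e₂ e₃ : P} (h₁₂ : G.tgt e₁ = G.src e₂) (h₂₃ : G.tgt e₂ = G.src e₃) :
    G.mul (G.mul e₁ e₂) e₃ = G.mul e₁ (G.mul e₂ e₃) := by
  refine (mul_eq ((tgt_mul h₁₂).trans h₂₃)).trans
    (Eq.trans ?_ (mul_eq (h₁₂.trans (src_mul h₂₃).symm)).symm)
  simp only [mul_eq h₁₂, mul_eq h₂₃]
  exact G.cocycle e₁ e₂ e₃ h₁₂ h₂₃

/-- A point of `ℰ₁₂ ⊕ ℰ₂₃` is determined by its two components in `ℰ`, the point of `Y^{[3]}` being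
read off from them. This translates between `f` and the multiplication on `P`. -/
theorem mul_eq_of_pair {e e' : P} (h : G.tgt e = G.src e')
    {q : Bibundle.Sum (G.E.pullback (p12 π)) (G.E.pullback (p23 π))} (h1 : q.fst.snd = e)
    (h2 : q.snd.snd = e') : G.mul e e' = (G.f.toFun (Bibundle.Prod.mk q)).snd := by
  have hq : gerbePair G.E e e' h = q := by
    have h3 : (gerbePair G.E e e' h).fst.fst = q.fst.fst := by
      refine FibProd.ext ?_ ?_
      · have := q.fst.comm
        rw [h1] at this
        exact this.symm
      · have h4 := q.snd.comm
        have h5 : q.fst.fst = q.snd.fst := q.comm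
        rw [h2, ← h5] at h4
        exact (congrArg FibProd.snd h4).symm
    refine FibProd.ext (FibProd.ext h3 h1.symm) (FibProd.ext ?_ h2.symm)
    exact h3.trans q.comm
  rw [mul_eq h, ← hq]
  rfl

theorem lact_mul {e e' : P} (k : H) (h : G.tgt e = G.src e') :
    G.mul (G.E.lact k e) e' = G.E.lact k (G.mul e e') := by
  let q := gerbePair G.E e e' h
  have h1 := congrArg FibProd.snd (G.f.map_lact k (Bibundle.Prod.mk q))
  rw [mul_eq h]
  refine Eq.trans ?_ h1
  exact mul_eq_of_pair (by rw [tgt_lact, h]) rfl rfl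

theorem mul_ract {e e' : P} (k : H) (h : G.tgt e = G.src e') :
    G.mul e (G.E.ract e' k) = G.E.ract (G.mul e e') k := by
  let q := gerbePair G.E e e' h
  have h1 := congrArg FibProd.snd (G.f.map_ract (Bibundle.Prod.mk q) k)
  rw [mul_eq h]
  refine Eq.trans ?_ h1
  exact mul_eq_of_pair (by rw [src_ract, h]) rfl rfl

/-- This is the relation that defines the quotient `ℰ₁₂ℰ₂₃`. -/
theorem ract_mul {e e' : P} (k : H) (h : G.tgt e = G.src e') :
    G.mul (G.E.ract e k) e' = G.mul e (G.E.lact k e') := by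
  have h1 : G.tgt e = G.src (G.E.lact k e') := by rw [src_lact, h]
  have h2 : G.tgt (G.E.ract e k) = G.src e' := by rw [tgt_ract, h]
  have h3 : Bibundle.Prod.mk (gerbePair G.E e (G.E.lact k e') h1) =
      Bibundle.Prod.mk (gerbePair G.E (G.E.ract e k) e' h2) := by
    have h4 : (gerbePair G.E (G.E.ract e k) e' h2).fst.fst =
        (gerbePair G.E e (G.E.lact k e') h1).fst.fst :=
      FibProd.ext (G.E.proj_ract e k) (tgt_lact k e').symm
    exact Quot.sound ⟨k, FibProd.ext h4 rfl, FibProd.ext h4.symm rfl⟩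
  rw [mul_eq h1, mul_eq h2]
  exact (congrArg (fun z => (G.f.toFun z).snd) h3).symm

/-- `φ_e(φ_{e'}(k)) (e e') = (e ◁ φ_{e'}(k)) e' = e (φ_{e'}(k) e') = e (e' ◁ k) = (e e') ◁ k`. -/
theorem phi_mul {e e' : P} (h : G.tgt e = G.src e') (k : H) :
    G.E.phi (G.mul e e') k = G.E.phi e (G.E.phi e' k) := by
  refine Bibundle.phi_eq ?_
  rw [← lact_mul _ h, Bibundle.phi_lact_eq, ract_mul _ h, Bibundle.phi_lact_eq, mul_ract _ h]

theorem contMDiff_src : ContMDiff 𝓘(ℝ, EP) 𝓘(ℝ, EY) ∞ G.src :=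
  FibProd.contMDiff_fst.comp G.E.contMDiff_proj

theorem contMDiff_tgt : ContMDiff 𝓘(ℝ, EP) 𝓘(ℝ, EY) ∞ G.tgt :=
  FibProd.contMDiff_snd.comp G.E.contMDiff_proj

theorem contMDiff_base : ContMDiff 𝓘(ℝ, EP) 𝓘(ℝ, EM) ∞ G.base :=
  π.toMap.contMDiff.comp contMDiff_src

section Smooth

variable {EN HN N : Type*} [NormedAddCommGroup EN] [NormedSpace ℝ EN] [TopologicalSpace HN]
  {J : ModelWithCorners ℝ EN HN} [TopologicalSpace N] [ChartedSpace HN N] {s : Set N}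

theorem _root_.ContMDiffOn.gerbe_mul (hs : IsOpen s) {x x' : N → P}
    (hx : ContMDiffOn J 𝓘(ℝ, EP) ∞ x s) (hx' : ContMDiffOn J 𝓘(ℝ, EP) ∞ x' s)
    (h : ∀ n ∈ s, G.tgt (x n) = G.src (x' n)) :
    ContMDiffOn J 𝓘(ℝ, EP) ∞ (fun n => G.mul (x n) (x' n)) s := by
  rcases s.eq_empty_or_nonempty with rfl | hne
  · exact fun n hn => hn.elim
  obtain ⟨y, hy, hy'⟩ := FibProd.exists_lift (f := π.toMap.comp (⟨FibProd.snd,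
      FibProd.contMDiff_snd⟩ : C^∞⟮𝓘(ℝ, EY × F), FibSq π; 𝓘(ℝ, EY), Y⟯)) (g := π) hs hne
    (G.E.contMDiff_proj.comp_contMDiffOn hx) (contMDiff_tgt.comp_contMDiffOn hx')
    (fun n hn => (congrArg π.toFun (h n hn)).trans (G.E.proj.toFun (x' n)).comm)
  obtain ⟨q₁, hq₁, hq₁'⟩ := FibProd.exists_lift (f := p12 π) (g := G.E.proj) hs hne hy hx
    (fun n hn => (hy' n hn).1)
  obtain ⟨q₂, hq₂, hq₂'⟩ := FibProd.exists_lift (f := p23 π) (g := G.E.proj) hs hne hy hx'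
    (fun n hn => FibProd.ext ((congrArg FibProd.snd (hy' n hn).1).trans (h n hn)) (hy' n hn).2)
  obtain ⟨q, hq, hq'⟩ := FibProd.exists_lift (f := (G.E.pullback (p12 π)).proj.toMap)
    (g := (G.E.pullback (p23 π)).proj) hs hne hq₁ hq₂
    (fun n hn => (hq₁' n hn).1.trans (hq₂' n hn).1.symm)
  refine (FibProd.contMDiff_snd.comp_contMDiffOn (G.f.contMDiff.comp_contMDiffOn hq)).congr
    fun n hn => ?_
  exact mul_eq_of_pair (h n hn) (by rw [(hq' n hn).1, (hq₁' n hn).2])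
    (by rw [(hq' n hn).2, (hq₂' n hn).2])

theorem _root_.ContMDiff.gerbe_mul {x x' : N → P} (hx : ContMDiff J 𝓘(ℝ, EP) ∞ x)
    (hx' : ContMDiff J 𝓘(ℝ, EP) ∞ x') (h : ∀ n, G.tgt (x n) = G.src (x' n)) :
    ContMDiff J 𝓘(ℝ, EP) ∞ (fun n => G.mul (x n) (x' n)) :=
  contMDiffOn_univ.1 (hx.contMDiffOn.gerbe_mul isOpen_univ hx'.contMDiffOn fun n _ => h n)

end Smooth

theorem dphi_mul [LieGroup 𝓘(ℝ, EH) ∞ H] {e e' : P} (h : G.tgt e = G.src e') (ξ : EH) :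
    G.E.dphi (G.mul e e') ξ = G.E.dphi e (G.E.dphi e' ξ) := by
  obtain ⟨g, hg, h0, rfl⟩ := exists_curve_one (H := H) ξ
  rw [Bibundle.dphi_vel _ hg h0, Bibundle.dphi_vel _ hg h0,
    Bibundle.dphi_vel e (contMDiff_const.phi hg) (by simp [h0, Bibundle.phi_one])]
  simp only [phi_mul h]

variable (G) in
/-- Over the point `m` of `M`, the form is multiplicative: `a(e e') = a(e) + φ_e a(e')`. -/
def IsMultiplicativeAt (a : LieForm EH H EP P) (m : M) : Prop :=
  ∀ γ γ' : ℝ → P, ContMDiff 𝓘(ℝ, ℝ) 𝓘(ℝ, EP) ∞ γ → ContMDiff 𝓘(ℝ, ℝ) 𝓘(ℝ, EP) ∞ γ' →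
    (∀ t, G.tgt (γ t) = G.src (γ' t)) → G.base (γ 0) = m →
    a.ev (fun t => G.mul (γ t) (γ' t)) = a.ev γ + G.E.dphi (γ 0) (a.ev γ')

theorem convex_isMultiplicativeAt (m : M) : Convex ℝ {a | G.IsMultiplicativeAt a m} := by
  intro a ha b hb x y _ _ _ γ γ' hγ hγ' hc hm
  simp only [LieForm.ev_comb, ha γ γ' hγ hγ' hc hm, hb γ γ' hγ hγ' hc hm, map_add, map_smul,
    smul_add]
  abel

/-- Two composable elements and their product all lie over the same point of `M`; this is why the
gluing is done over `M` and not over `Y^{[2]}`. -/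
theorem IsMultiplicativeAt.congr {a b : LieForm EH H EP P} {m : M}
    (h : G.IsMultiplicativeAt a m) (hab : ∀ e, G.base e = m → a e = b e) :
    G.IsMultiplicativeAt b m := by
  intro γ γ' hγ hγ' hc hm
  have h1 : G.base (γ' 0) = m := (base_eq_base (hc 0)).symm.trans hm
  have h2 : G.base (G.mul (γ 0) (γ' 0)) = m := (base_mul (hc 0)).trans hm
  rw [← LieForm.ev_congr (hab _ hm), ← LieForm.ev_congr (hab _ h1), ← LieForm.ev_congr (hab _ h2)]
  exact h γ γ' hγ hγ' hc hm

end BundleGerbe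

/-! ### Smooth dependence of pulled-back forms and of the differential of `φ`. -/

section

variable {EH H EP P : Type*}
  [NormedAddCommGroup EH] [NormedSpace ℝ EH] [TopologicalSpace H] [ChartedSpace EH H] [Group H]
  [NormedAddCommGroup EP] [NormedSpace ℝ EP] [TopologicalSpace P] [ChartedSpace EP P]

/-- The value of a one-form at a point, as a linear map between model spaces. -/
def LieForm.clm (a : LieForm EH H EP P) (e : P) : EP →L[ℝ] EH := a e

/-- The pull-back of a smooth one-form by a map is smooth on an open set where the map is. -/
theorem LieForm.Smooth.comp_deriv' [IsManifold 𝓘(ℝ, EP) ∞ P] {a : LieForm EH H EP P}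
    (ha : a.Smooth) {EN N : Type*} [NormedAddCommGroup EN] [NormedSpace ℝ EN]
    [TopologicalSpace N] [ChartedSpace EN N] [IsManifold 𝓘(ℝ, EN) ∞ N] {f : N → P} {O : Set N}
    (hO : IsOpen O) (hf : ContMDiffOn 𝓘(ℝ, EN) 𝓘(ℝ, EP) ∞ f O) :
    ContMDiffOn 𝓘(ℝ, EN).tangent 𝓘(ℝ, EH) ∞
      (fun v : TangentBundle 𝓘(ℝ, EN) N => a.val (f v.1) (deriv' EN EP f v.1 (tvec v)))
      {v | v.1 ∈ O} := by
  have h1 := ha.comp_contMDiffOn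
    (hf.contMDiffOn_tangentMapWithin (m := ∞) le_rfl hO.uniqueMDiffOn)
  refine h1.congr fun v hv => ?_
  have h2 : mfderivWithin 𝓘(ℝ, EN) 𝓘(ℝ, EP) f O v.1 = mfderiv 𝓘(ℝ, EN) 𝓘(ℝ, EP) f v.1 :=
    mfderivWithin_of_isOpen hO hv
  exact congrArg (fun L => a.val (f v.1) (L v.2)) h2.symm

end

theorem Bibundle.contMDiffOn_dphi {EH H EB B EP P : Type*}
    [NormedAddCommGroup EH] [NormedSpace ℝ EH] [TopologicalSpace H] [ChartedSpace EH H] [Group H]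
    [NormedAddCommGroup EB] [NormedSpace ℝ EB] [TopologicalSpace B] [ChartedSpace EB B]
    [IsManifold 𝓘(ℝ, EB) ∞ B]
    [NormedAddCommGroup EP] [NormedSpace ℝ EP] [TopologicalSpace P] [ChartedSpace EP P]
    [IsManifold 𝓘(ℝ, EP) ∞ P] [LieGroup 𝓘(ℝ, EH) ∞ H] {E : Bibundle EH H EB B EP P}
    {EN HN N : Type*} [NormedAddCommGroup EN] [NormedSpace ℝ EN] [TopologicalSpace HN]
    {J : ModelWithCorners ℝ EN HN} [TopologicalSpace N] [ChartedSpace HN N] {s : Set N}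
    {x : N → P} {ξ : N → EH} (hx : ContMDiffOn J 𝓘(ℝ, EP) ∞ x s)
    (hξ : ContMDiffOn J 𝓘(ℝ, EH) ∞ ξ s) :
    ContMDiffOn J 𝓘(ℝ, EH) ∞ (fun n => E.dphi (x n) (ξ n)) s := by
  have h1 : ContMDiffOn (𝓘(ℝ, EH).prod 𝓘(ℝ, EP)) 𝓘(ℝ, EH) ∞
      (fun p : H × P => E.phi p.2 p.1) univ :=
    (ContMDiff.phi contMDiff_snd contMDiff_fst).contMDiffOn
  have h2 := contMDiffOn_partial_deriv (F := fun h e => E.phi e h) isOpen_univ h1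
  have h3 := h2.comp (((contMDiffOn_tangentSpace_iff (x := (1 : H))).2 hξ).prodMk hx)
    (fun n hn => mem_univ _)
  refine (contMDiffOn_tangentSpace_iff (x := (1 : H))).1 (h3.congr fun n hn => ?_)
  exact congrArg (fun k => tmk k _) (Bibundle.phi_one (x n)).symm

/-! ### Construction of a multiplicative form. -/

namespace BundleGerbe

variable {EM EY F EH EP M Y H P : Type*}
  [NormedAddCommGroup EM] [NormedSpace ℝ EM] [NormedAddCommGroup EY] [NormedSpace ℝ EY]
  [NormedAddCommGroup F] [NormedSpace ℝ F]
  [NormedAddCommGroup EH] [NormedSpace ℝ EH] [NormedAddCommGroup EP] [NormedSpace ℝ EP]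
  [TopologicalSpace M] [ChartedSpace EM M] [IsManifold 𝓘(ℝ, EM) ∞ M]
  [TopologicalSpace Y] [ChartedSpace EY Y] [IsManifold 𝓘(ℝ, EY) ∞ Y]
  [TopologicalSpace H] [ChartedSpace EH H] [Group H]
  [TopologicalSpace P] [ChartedSpace EP P] [IsManifold 𝓘(ℝ, EP) ∞ P]
  {π : Submersion F EY EM Y M} (G : BundleGerbe EH H EP P π)

/-- The map `q` is a smooth choice on `O` of points over `(y₂, s(m))`, for points over
`(y₁, y₂)`. -/
structure IsTransport (s : M → Y) (O : Set P) (q : P → P) : Prop where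
  isOpen : IsOpen O
  smooth : ContMDiffOn 𝓘(ℝ, EP) 𝓘(ℝ, EP) ∞ q O
  src_eq : ∀ x ∈ O, G.src (q x) = G.tgt x
  tgt_eq : ∀ x ∈ O, G.tgt (q x) = s (G.base x)

/-- The multiplicative form `a(e q) - φ_e a(q)`, for `q` over `(y₂, s(m))`. -/
def multForm (a : LieForm EH H EP P) (q : P → P → P) : LieForm EH H EP P := fun e =>
  ((a.clm (G.mul e (q e e))).comp (deriv' EP EP (fun x => G.mul x (q e x)) e) -
    (G.E.dphi e).comp ((a.clm (q e e)).comp (deriv' EP EP (q e) e)) : EP →L[ℝ] EH)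

variable {G}

/-- The map `x ↦ (y₂, s(m))` into `Y^{[2]}` is smooth over `U`; composing it with a local section of
`ℰ` gives the choice. Such choices exist only locally, so `multForm` uses a separate one at every
`e`. -/
theorem exists_isTransport {s : M → Y} {U : Set M} (hU : IsOpen U)
    (hs : ContMDiffOn 𝓘(ℝ, EM) 𝓘(ℝ, EY) ∞ s U) (hπ : ∀ m ∈ U, π.toFun (s m) = m) {e : P}
    (he : G.base e ∈ U) : ∃ (O : Set P) (q : P → P), e ∈ O ∧ G.IsTransport s O q := by
  have hO : IsOpen (G.base ⁻¹' U) := hU.preimage contMDiff_base.continuous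
  obtain ⟨j, hj, hj'⟩ := FibProd.exists_lift (f := π.toMap) (g := π) hO ⟨e, he⟩
    (contMDiff_tgt (G := G)).contMDiffOn (hs.comp contMDiff_base.contMDiffOn fun x hx => hx)
    (fun x hx => (base_eq_tgt G x).symm.trans (hπ _ hx).symm)
  obtain ⟨e', he'⟩ := G.E.surjective_proj (j e)
  obtain ⟨W, σ, hW, heW, hσ, -, hσ'⟩ := G.E.proj.exists_local_section e'
  rw [he'] at heW
  refine ⟨G.base ⁻¹' U ∩ j ⁻¹' W, fun x => σ (j x), ⟨he, heW⟩,
    hj.continuousOn.isOpen_inter_preimage hO hW, hσ.comp (hj.mono inter_subset_left) fun x hx => hx.2,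
    fun x hx => ?_, fun x hx => ?_⟩
  · exact (congrArg FibProd.fst (hσ' _ hx.2)).trans (hj' x hx.1).1
  · exact (congrArg FibProd.snd (hσ' _ hx.2)).trans (hj' x hx.1).2

theorem exists_transport_curve {s : M → Y} {U : Set M} {O : P → Set P} {q : P → P → P}
    (hq : ∀ e, G.base e ∈ U → e ∈ O e ∧ G.IsTransport s (O e) (q e)) {γ : ℝ → P} (hγ : ContMDiff 𝓘(ℝ, ℝ) 𝓘(ℝ, EP) ∞ γ)
    (hγU : G.base (γ 0) ∈ U) : ∃ (τ : ℝ → ℝ) (p : ℝ → P), ContDiff ℝ ∞ τ ∧ τ 0 = 0 ∧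
      HasDerivAt τ 1 0 ∧ ContMDiff 𝓘(ℝ, ℝ) 𝓘(ℝ, EP) ∞ p ∧
      (∀ t, G.tgt (γ (τ t)) = G.src (p t)) ∧ ∀ t, G.tgt (p t) = s (G.base (γ (τ t))) := by
  obtain ⟨h3, h4⟩ := hq _ hγU
  obtain ⟨τ, t1, t2, t3, t4⟩ := exists_time_mapsTo hγ h4.isOpen h3
  exact ⟨τ, fun t => q (γ 0) (γ (τ t)), t1, t2, t3, contMDiffOn_univ.1 (h4.smooth.comp
    (hγ.comp t1.contMDiff).contMDiffOn fun t _ => t4 t), fun t => (h4.src_eq _ (t4 t)).symm,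
    fun t => h4.tgt_eq _ (t4 t)⟩

section

variable [LieGroup 𝓘(ℝ, EH) ∞ H] {a : LieForm EH H EP P} (hV : ∀ e, G.E.IsVerticalAt a e)
  (hR : ∀ e, G.E.IsRightInvariantAt a e)
include hV hR

/-- Product rule: moving `γ` with `k(0)` fixed contributes `a(γ)` by right invariance. Moving `k`
alone gives a vertical curve, since `γ(0) ◁ k(t) = φ_{γ(0)}(k(t) k(0)⁻¹) (γ(0) ◁ k(0))`. -/
theorem ev_ract {γ : ℝ → P} (hγ : ContMDiff 𝓘(ℝ, ℝ) 𝓘(ℝ, EP) ∞ γ) {k : ℝ → H}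
    (hk : ContMDiff 𝓘(ℝ, ℝ) 𝓘(ℝ, EH) ∞ k) :
    a.ev (fun t => G.E.ract (γ t) (k t)) =
      a.ev γ - G.E.dphi (γ 0) (vel EH fun t => k t * (k 0)⁻¹) := by
  have hk' : ContMDiff 𝓘(ℝ, ℝ) 𝓘(ℝ, EH) ∞ (fun t => k t * (k 0)⁻¹) := hk.mul contMDiff_const
  rw [a.ev_diag (G := fun t u => G.E.ract (γ t) (k u)) (hγ.left.ract hk.right),
    hR _ γ hγ rfl, Bibundle.dphi_vel _ hk' (by simp), sub_eq_add_neg,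
    ← hV (G.E.ract (γ 0) (k 0)) _ (contMDiff_const.phi hk') (by simp [Bibundle.phi_one])]
  congr 2
  funext t
  rw [← G.E.lact_ract, Bibundle.phi_lact_eq, ← G.E.ract_mul, inv_mul_cancel_right]

/-- Write `q' = q ◁ k`, so that also `γ q' = (γ q) ◁ k`. By `ev_ract` the two terms change by `φ_{γ
q}[k k(0)⁻¹]` and `φ_γ φ_q [k k(0)⁻¹]`, which coincide and cancel in the difference. -/
theorem multForm_indep {γ q q' : ℝ → P} (hγ : ContMDiff 𝓘(ℝ, ℝ) 𝓘(ℝ, EP) ∞ γ)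
    (hq : ContMDiff 𝓘(ℝ, ℝ) 𝓘(ℝ, EP) ∞ q) (hq' : ContMDiff 𝓘(ℝ, ℝ) 𝓘(ℝ, EP) ∞ q')
    (hc : ∀ t, G.tgt (γ t) = G.src (q t))
    (hqq' : ∀ t, G.E.proj.toFun (q' t) = G.E.proj.toFun (q t)) :
    a.ev (fun t => G.mul (γ t) (q' t)) - G.E.dphi (γ 0) (a.ev q') =
      a.ev (fun t => G.mul (γ t) (q t)) - G.E.dphi (γ 0) (a.ev q) := by
  have hk : ContMDiff 𝓘(ℝ, ℝ) 𝓘(ℝ, EH) ∞ (fun t => G.E.rd (q' t) (q t)) := hq'.rd hq hqq'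
  have h1 : ∀ t, G.E.ract (q t) (G.E.rd (q' t) (q t)) = q' t := fun t => Bibundle.ract_rd (hqq' t)
  have h2 : a.ev q' = _ := (congrArg a.ev (funext h1)).symm.trans (ev_ract hV hR hq hk)
  have h3 : ∀ t, G.E.ract (G.mul (γ t) (q t)) (G.E.rd (q' t) (q t)) = G.mul (γ t) (q' t) :=
    fun t => by rw [← mul_ract _ (hc t), h1]
  have h4 : a.ev (fun t => G.mul (γ t) (q' t)) = _ :=
    (congrArg a.ev (funext h3)).symm.trans (ev_ract hV hR (hγ.gerbe_mul hq hc) hk)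
  rw [h2, h4, dphi_mul (hc 0), map_sub]
  abel

variable {s : M → Y} {U : Set M} {O : P → Set P} {q : P → P → P}
  (hq : ∀ e, G.base e ∈ U → e ∈ O e ∧ G.IsTransport s (O e) (q e))
include hq

/-- The form may be computed with any smooth curve `p` over `(y₂, s(m))`, not only with the
transport chosen at `γ 0`. All properties below come from a convenient `p`. -/
theorem multForm_ev {γ p : ℝ → P} (hγ : ContMDiff 𝓘(ℝ, ℝ) 𝓘(ℝ, EP) ∞ γ)
    (hp : ContMDiff 𝓘(ℝ, ℝ) 𝓘(ℝ, EP) ∞ p) (hγU : G.base (γ 0) ∈ U)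
    (h1 : ∀ t, G.tgt (γ t) = G.src (p t)) (h2 : ∀ t, G.tgt (p t) = s (G.base (γ t))) :
    (G.multForm a q).ev γ =
      a.ev (fun t => G.mul (γ t) (p t)) - G.E.dphi (γ 0) (a.ev p) := by
  obtain ⟨h3, h4⟩ := hq _ hγU
  obtain ⟨τ, t1, t2, t3, t4⟩ := exists_time_mapsTo hγ h4.isOpen h3
  have hγ' : ContMDiff 𝓘(ℝ, ℝ) 𝓘(ℝ, EP) ∞ (fun t => γ (τ t)) := hγ.comp t1.contMDiff
  have hp' : ContMDiff 𝓘(ℝ, ℝ) 𝓘(ℝ, EP) ∞ (fun t => p (τ t)) := hp.comp t1.contMDiff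
  set e := γ 0
  have hγe : γ (τ 0) = e := congrArg γ t2
  have hqγ : ContMDiff 𝓘(ℝ, ℝ) 𝓘(ℝ, EP) ∞ (fun t => q e (γ (τ t))) :=
    contMDiffOn_univ.1 (h4.smooth.comp hγ'.contMDiffOn fun t _ => t4 t)
  have h5 := multForm_indep hV hR hγ' hp' hqγ (fun t => h1 (τ t)) fun t =>
    FibProd.ext ((h4.src_eq _ (t4 t)).trans (h1 (τ t)))
      ((h4.tgt_eq _ (t4 t)).trans (h2 (τ t)).symm)
  have hm : ContMDiffOn 𝓘(ℝ, EP) 𝓘(ℝ, EP) ∞ (fun x => G.mul x (q e x)) (O e) :=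
    contMDiffOn_id.gerbe_mul h4.isOpen h4.smooth fun x hx => (h4.src_eq x hx).symm
  rw [← a.ev_comp_time (hγ.gerbe_mul hp h1) t2 t3, ← a.ev_comp_time hp t2 t3, ← hγe, ← h5]
  have h6 : vel EP (fun t => γ (τ t)) = vel EP γ := by rw [vel_comp_time hγ t2 t3, one_smul]
  have h7 := deriv'_vel_of_mdifferentiableAt (γ := fun t => γ (τ t))
    (hm.mdifferentiableAt' h4.isOpen (t4 0)) (hγ'.mdifferentiableAt' 0)
  have h8 := deriv'_vel_of_mdifferentiableAt (γ := fun t => γ (τ t))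
    (h4.smooth.mdifferentiableAt' h4.isOpen (t4 0)) (hγ'.mdifferentiableAt' 0)
  unfold LieForm.ev
  rw [← h7, ← h8, h6]
  simp only [t2]
  rfl

theorem multForm_smoothOn (hU : IsOpen U) (ha : a.Smooth) :
    (G.multForm a q).SmoothOn (G.base ⁻¹' U) := by
  intro v hv
  obtain ⟨h3, h4⟩ := hq v.1 hv
  set e := v.1
  have hUo : IsOpen (G.base ⁻¹' U) := hU.preimage contMDiff_base.continuous
  set O' := O e ∩ G.base ⁻¹' U
  have hO' : IsOpen O' := h4.isOpen.inter hUo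
  have hs : ContMDiffOn 𝓘(ℝ, EP) 𝓘(ℝ, EP) ∞ (q e) O' := h4.smooth.mono inter_subset_left
  have hm : ContMDiffOn 𝓘(ℝ, EP) 𝓘(ℝ, EP) ∞ (fun x => G.mul x (q e x)) O' :=
    contMDiffOn_id.gerbe_mul hO' hs fun x hx => (h4.src_eq x hx.1).symm
  have hb : ContMDiff 𝓘(ℝ, EP).tangent 𝓘(ℝ, EP) ∞ (fun v : TangentBundle 𝓘(ℝ, EP) P => v.1) :=
    Bundle.contMDiff_proj (TangentSpace 𝓘(ℝ, EP))
  -- The defining expression with the transport `q e` frozen is smooth on a neighbourhood of `e`.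
  -- The form itself uses another transport at each nearby point, with no regularity in that point,
  -- but the values agree by independence of the choice.
  have h5 := (ha.comp_deriv' hO' hm).sub
    (Bibundle.contMDiffOn_dphi (E := G.E) hb.contMDiffOn (ha.comp_deriv' hO' hs))
  refine ContMDiffAt.contMDiffWithinAt ?_
  refine (h5.congr fun w hw => ?_).contMDiffAt ((hO'.preimage hb.continuous).mem_nhds ⟨h3, hv⟩)
  obtain ⟨γ, g1, g2, g3, g4⟩ := exists_curve hO' hw (tvec w)
  have hqγ : ContMDiff 𝓘(ℝ, ℝ) 𝓘(ℝ, EP) ∞ (fun t => q e (γ t)) :=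
    contMDiffOn_univ.1 (hs.comp g1.contMDiffOn fun t _ => g4 t)
  have h6 := multForm_ev hV hR hq g1 hqγ (g4 0).2 (fun t => (h4.src_eq _ (g4 t).1).symm)
    (fun t => h4.tgt_eq _ (g4 t).1)
  unfold LieForm.ev at h6
  rw [← deriv'_vel_of_mdifferentiableAt (hm.mdifferentiableAt' hO' (g4 0))
    (g1.mdifferentiableAt' 0), ← deriv'_vel_of_mdifferentiableAt
    (hs.mdifferentiableAt' hO' (g4 0)) (g1.mdifferentiableAt' 0), g3] at h6
  simp only [g2] at h6
  exact h6

/-- Along `g(t) e` the auxiliary point may be kept constant; the correction term then vanishes, and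
`(g e) q = g (e q)` reduces to verticality of `a`. -/
theorem multForm_isVerticalAt {e : P} (he : G.base e ∈ U) :
    G.E.IsVerticalAt (G.multForm a q) e := by
  intro g hg h0
  obtain ⟨h3, h4⟩ := hq e he
  have hc : G.tgt e = G.src (q e e) := (h4.src_eq e h3).symm
  rw [multForm_ev hV hR hq (p := fun _ => q e e) (hg.lact contMDiff_const) contMDiff_const
    (by rwa [base_lact]) (fun t => by rw [tgt_lact, hc])
    (fun t => by rw [base_lact, h4.tgt_eq e h3]), a.ev_const, map_zero, sub_zero,
    ← hV (G.mul e (q e e)) g hg h0]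
  simp only [lact_mul _ hc]

theorem multForm_hasCocycleAt {e : P} (he : G.base e ∈ U) (hL : ∀ e, G.E.HasCocycleAt a e) :
    G.E.HasCocycleAt (G.multForm a q) e := by
  rintro γ₀ hγ₀ rfl
  obtain ⟨τ, p, t1, t2, t3, hp, h1, h2⟩ := exists_transport_curve hq hγ₀ he
  have hγ : ContMDiff 𝓘(ℝ, ℝ) 𝓘(ℝ, EP) ∞ (fun t => γ₀ (τ t)) := hγ₀.comp t1.contMDiff
  obtain ⟨X, hX⟩ := hL _ _ (hγ.gerbe_mul hp h1) rfl
  refine ⟨X, fun h => ?_⟩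
  have hb : G.base (γ₀ (τ 0)) ∈ U := by rwa [t2]
  rw [← LieForm.ev_comp_time _ hγ₀ t2 t3, ← LieForm.ev_comp_time _
    (ContMDiff.lact (E := G.E) (contMDiff_const (c := h)) hγ₀) t2 t3,
    multForm_ev hV hR hq hγ hp hb h1 h2,
    multForm_ev hV hR hq (contMDiff_const.lact hγ) hp (by rwa [base_lact])
      (fun t => by rw [tgt_lact, h1]) (fun t => by rw [base_lact, h2])]
  simp only [lact_mul _ (h1 _)]
  rw [hX, Bibundle.dphi_lact, map_sub]
  abel

/-- If `p` serves for `γ'`, it serves for `γ γ'`, and `γ' p` serves for `γ`. With these choices the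
terms in `a(γ' p)` cancel, and associativity identifies the rest. -/
theorem multForm_isMultiplicativeAt {m : M} (hm : m ∈ U) :
    G.IsMultiplicativeAt (G.multForm a q) m := by
  rintro γ₀ γ₀' hγ₀ hγ₀' hc rfl
  have he' : G.base (γ₀' 0) ∈ U := by rwa [← base_eq_base (hc 0)]
  obtain ⟨τ, p, t1, t2, t3, hp, h1, h2⟩ := exists_transport_curve hq hγ₀' he'
  rw [← LieForm.ev_comp_time _ hγ₀ t2 t3, ← LieForm.ev_comp_time _ hγ₀' t2 t3,
    ← LieForm.ev_comp_time _ (hγ₀.gerbe_mul hγ₀' hc) t2 t3]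
  have hγ : ContMDiff 𝓘(ℝ, ℝ) 𝓘(ℝ, EP) ∞ (fun t => γ₀ (τ t)) := hγ₀.comp t1.contMDiff
  have hγ' : ContMDiff 𝓘(ℝ, ℝ) 𝓘(ℝ, EP) ∞ (fun t => γ₀' (τ t)) := hγ₀'.comp t1.contMDiff
  have hc' : ∀ t, G.tgt (γ₀ (τ t)) = G.src (γ₀' (τ t)) := fun t => hc (τ t)
  have hb : ∀ t, G.base (γ₀' (τ t)) = G.base (γ₀ (τ t)) := fun t => (base_eq_base (hc' t)).symm
  have hb0 : G.base (γ₀ (τ 0)) ∈ U := by rwa [t2]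
  rw [multForm_ev hV hR hq hγ' hp (by rwa [hb]) h1 h2,
    multForm_ev hV hR hq hγ (hγ'.gerbe_mul hp h1) hb0
      (fun t => by rw [src_mul (h1 t), hc']) (fun t => by rw [tgt_mul (h1 t), h2, hb]),
    multForm_ev hV hR hq (hγ.gerbe_mul hγ' hc') hp (by rwa [base_mul (hc' 0)])
      (fun t => by rw [tgt_mul (hc' t), h1]) (fun t => by rw [base_mul (hc' t), h2, hb]),
    dphi_mul (hc' 0), map_sub, t2]
  simp only [mul_mul_mul (hc' _) (h1 _)]
  abel

end

/-- A bundle gerbe has a smooth vertical multiplicative one-form which is a cocycle on the left. -/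
theorem exists_multiplicative_form [LieGroup 𝓘(ℝ, EH) ∞ H] [FiniteDimensional ℝ EM]
    [FiniteDimensional ℝ EY] [FiniteDimensional ℝ F] [T2Space M] [SecondCountableTopology M]
    [T2Space Y] [SecondCountableTopology Y] (hπ : Surjective π.toFun)
    (G : BundleGerbe EH H EP P π) :
    ∃ a : LieForm EH H EP P, a.Smooth ∧ (∀ e, G.E.IsVerticalAt a e) ∧
      (∀ e, G.E.HasCocycleAt a e) ∧ ∀ m, G.IsMultiplicativeAt a m := by
  -- A partition of unity on `Y^{[2]}` is needed for the right-invariant form; the Hausdorff and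
  -- countability conditions are inherited from `Y × Y`.
  have hind : Topology.IsInducing (FibProd.toProd : FibSq π → Y × Y) := ⟨rfl⟩
  have hinj : Injective (FibProd.toProd : FibSq π → Y × Y) := fun x y h =>
    FibProd.ext (congrArg _root_.Prod.fst h) (congrArg _root_.Prod.snd h)
  have : T2Space (FibSq π) := T2Space.of_injective_continuous hinj hind.continuous
  have : SecondCountableTopology (FibSq π) := hind.secondCountableTopology
  obtain ⟨a, ha, hP⟩ := G.E.exists_rightInvariant_form
  let Φ : M → Set (LieForm EH H EP P) := fun m => (⋂ (e : P) (_ : G.base e = m),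
    ({a | G.E.IsVerticalAt a e} ∩ {a | G.E.HasCocycleAt a e})) ∩ {a | G.IsMultiplicativeAt a m}
  have h : ∃ a : LieForm EH H EP P, a.Smooth ∧ ∀ m, a ∈ Φ m := by
    refine LieForm.exists_smooth_of_local (contMDiff_base (G := G)) (fun m => ?_)
      (fun m b b' h hb => ?_) (fun m => ?_)
    · exact (convex_iInter₂ fun e _ => (Bibundle.convex_isVerticalAt e).inter
        (Bibundle.convex_hasCocycleAt e)).inter (convex_isMultiplicativeAt m)
    · refine ⟨mem_iInter₂.2 fun e he => ?_, hb.2.congr h⟩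
      have hb1 := mem_iInter₂.1 hb.1 e he
      have h' : ∀ e', G.E.proj.toFun e' = G.E.proj.toFun e → b e' = b' e' := fun e' he' =>
        h e' ((congrArg (fun z : FibSq π => π.toFun z.fst) he').trans he)
      exact ⟨hb1.1.congr h', hb1.2.congr h'⟩
    · obtain ⟨y, rfl⟩ := hπ m
      obtain ⟨U, s, hU, hy, hs, -, hs'⟩ := π.exists_local_section y
      have key : ∀ e, ∃ (O : Set P) (q : P → P), G.base e ∈ U → e ∈ O ∧ G.IsTransport s O q :=
        fun e => by
          by_cases he : G.base e ∈ U
          · obtain ⟨O, q, h⟩ := exists_isTransport hU hs hs' he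
            exact ⟨O, q, fun _ => h⟩
          · exact ⟨∅, id, fun h => absurd h he⟩
      choose O q hq using key
      have hV := fun e => (hP e).1
      have hR := fun e => (hP e).2.1
      refine ⟨U, hU, hy, G.multForm a q, multForm_smoothOn hV hR hq hU ha, fun m hm => ?_⟩
      refine ⟨mem_iInter₂.2 fun e he => ?_, multForm_isMultiplicativeAt hV hR hq hm⟩
      subst he
      exact ⟨multForm_isVerticalAt hV hR hq hm,
        multForm_hasCocycleAt hV hR hq hm fun e => (hP e).2.2⟩
  obtain ⟨b, hb, hΦ⟩ := h
  exact ⟨b, hb, fun e => (mem_iInter₂.1 (hΦ (G.base e)).1 e rfl).1,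
    fun e => (mem_iInter₂.1 (hΦ (G.base e)).1 e rfl).2, fun m => (hΦ m).2⟩

end BundleGerbe

/-! ### The form `A` determined by `a`. -/

namespace Bibundle

variable {EH H EB B EP P : Type*}
  [NormedAddCommGroup EH] [NormedSpace ℝ EH] [TopologicalSpace H] [ChartedSpace EH H] [Group H]
  [NormedAddCommGroup EB] [NormedSpace ℝ EB] [TopologicalSpace B] [ChartedSpace EB B]
  [IsManifold 𝓘(ℝ, EB) ∞ B]
  [NormedAddCommGroup EP] [NormedSpace ℝ EP] [TopologicalSpace P] [ChartedSpace EP P]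
  [IsManifold 𝓘(ℝ, EP) ∞ P]
  {E : Bibundle EH H EB B EP P} {a : LieForm EH H EP P}

theorem contMDiff_lact_const (h : H) : ContMDiff 𝓘(ℝ, EP) 𝓘(ℝ, EP) ∞ (E.lact h) :=
  contMDiff_const.lact contMDiff_id

variable (E) in
/-- The form `A` on the base gives the cocycle by which the form `a` on the total space fails to be
equivariant under left translations. -/
def HasCocycle (a : LieForm EH H EP P) (A : AutForm EH H EB B) : Prop :=
  ∀ (γ : ℝ → P) (c : ℝ → B), ContMDiff 𝓘(ℝ, ℝ) 𝓘(ℝ, EP) ∞ γ → (∀ t, E.proj.toFun (γ t) = c t) →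
    ∀ h, a.ev (fun t => E.lact h (γ t)) = adMap EH h (a.ev γ) + cocycle (A (c 0) (vel EB c)) h

theorem exists_cocycle_of_tangent (hL : ∀ e, E.HasCocycleAt a e) (e : P) (v : EP) :
    ∃ X : LieAut EH H, ∀ h, a.val (E.lact h e) (deriv' EP EP (E.lact h) e v) =
      adMap EH h (a.val e v) + cocycle X h := by
  obtain ⟨γ, h1, rfl, rfl, -⟩ := exists_curve isOpen_univ (mem_univ e) v
  obtain ⟨X, hX⟩ := hL _ γ h1 rfl
  refine ⟨X, fun h => ?_⟩
  rw [deriv'_vel (contMDiff_lact_const h) h1 rfl]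
  exact hX h

variable [LieGroup 𝓘(ℝ, EH) ∞ H]

theorem ev_lact (hV : ∀ e, E.IsVerticalAt a e) {g : ℝ → H}
    (hg : ContMDiff 𝓘(ℝ, ℝ) 𝓘(ℝ, EH) ∞ g) {β : ℝ → P} (hβ : ContMDiff 𝓘(ℝ, ℝ) 𝓘(ℝ, EP) ∞ β) :
    a.ev (fun t => E.lact (g t) (β t)) =
      a.ev (fun t => E.lact (g 0) (β t)) - vel EH (fun t => g t * (g 0)⁻¹) := by
  have hg' : ContMDiff 𝓘(ℝ, ℝ) 𝓘(ℝ, EH) ∞ (fun t => g t * (g 0)⁻¹) := hg.mul contMDiff_const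
  rw [a.ev_diag (G := fun t u => E.lact (g t) (β u)) (hg.left.lact hβ.right), sub_eq_add_neg,
    ← hV (E.lact (g 0) (β 0)) _ hg' (by simp), add_comm]
  simp only [← E.mul_lact, inv_mul_cancel_right]

/-- The infinitesimal automorphism belonging to a curve depends only on the projection of that
curve. Replacing `β` by `g β` adds vertical terms that match under `Ad_h`, and the rest is `T_X(h
g(0)) = T_X(h) + Ad_h T_X(g(0))`. This makes `A` a form on the base. -/
theorem cocycle_of_lact (hV : ∀ e, E.IsVerticalAt a e) {g : ℝ → H}
    (hg : ContMDiff 𝓘(ℝ, ℝ) 𝓘(ℝ, EH) ∞ g) {β : ℝ → P} (hβ : ContMDiff 𝓘(ℝ, ℝ) 𝓘(ℝ, EP) ∞ β)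
    {X : LieAut EH H}
    (hX : ∀ h, a.ev (fun t => E.lact h (β t)) = adMap EH h (a.ev β) + cocycle X h) (h : H) :
    a.ev (fun t => E.lact h (E.lact (g t) (β t))) =
      adMap EH h (a.ev fun t => E.lact (g t) (β t)) + cocycle X h := by
  have hg' : ContMDiff 𝓘(ℝ, ℝ) 𝓘(ℝ, EH) ∞ (fun t => g t * (g 0)⁻¹) := hg.mul contMDiff_const
  have hhg : ContMDiff 𝓘(ℝ, ℝ) 𝓘(ℝ, EH) ∞ (fun t => h * g t) := contMDiff_const.mul hg
  have h1 : ∀ t, h * g t * (h * g 0)⁻¹ = h * (g t * (g 0)⁻¹) * h⁻¹ := fun t => by group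
  simp only [← E.mul_lact]
  rw [ev_lact hV hhg hβ, ev_lact hV hg hβ, hX, hX, cocycle_mul, map_sub, map_add, adMap_mul,
    adMap_vel h hg' (by simp)]
  simp only [h1]
  abel

variable (hV : ∀ e, E.IsVerticalAt a e) (hL : ∀ e, E.HasCocycleAt a e)

/-- The `Lie(Aut(H))`-valued form on the base determined by a vertical form on the total space that
is a cocycle on the left, in terms of a lift of tangent vectors. -/
def autForm (hL : ∀ e, E.HasCocycleAt a e) (σ : B → B → P) : AutForm EH H EB B := fun b =>
  { toFun := fun u =>
      (exists_cocycle_of_tangent hL (σ b b) (deriv' EB EP (σ b) b u)).choose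
    map_add' := fun u w => by
      -- The automorphisms are chosen vector by vector; linearity holds because each is determined
      -- by its cocycle, which is linear in the tangent vector.
      refine cocycle_injective fun k => ?_
      have h1 := (exists_cocycle_of_tangent hL (σ b b) (deriv' EB EP (σ b) b u)).choose_spec k
      have h2 := (exists_cocycle_of_tangent hL (σ b b) (deriv' EB EP (σ b) b w)).choose_spec k
      have h3 := (exists_cocycle_of_tangent hL (σ b b)
        (deriv' EB EP (σ b) b (u + w))).choose_spec k
      have h4 : deriv' EB EP (σ b) b (u + w) =
        deriv' EB EP (σ b) b u + deriv' EB EP (σ b) b w := map_add _ _ _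
      have h5 : ∀ (e : P) (x y : EP), a.val e (x + y) = a.val e x + a.val e y :=
        fun e x y => (a.clm e).map_add x y
      rw [cocycle_add, ← add_right_inj (adMap EH k (a.val (σ b b) (deriv' EB EP (σ b) b (u + w)))),
        ← h3, h4, map_add, h5, h5, map_add, h1, h2]
      abel
    map_smul' := fun r u => by
      refine cocycle_injective fun k => ?_
      have h1 := (exists_cocycle_of_tangent hL (σ b b) (deriv' EB EP (σ b) b u)).choose_spec k
      have h3 := (exists_cocycle_of_tangent hL (σ b b)
        (deriv' EB EP (σ b) b (r • u))).choose_spec k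
      have h4 : deriv' EB EP (σ b) b (r • u) = r • deriv' EB EP (σ b) b u := map_smul _ _ _
      have h5 : ∀ (e : P) (x : EP), a.val e (r • x) = r • a.val e x :=
        fun e x => (a.clm e).map_smul r x
      rw [RingHom.id_apply, cocycle_smul,
        ← add_right_inj (adMap EH k (a.val (σ b b) (deriv' EB EP (σ b) b (r • u)))),
        ← h3, h4, map_smul, h5, h5, map_smul, h1, smul_add] }

include hV in
theorem autForm_spec {σ : B → B → P} {W : B → Set B}
    (hσ : ∀ b, b ∈ W b ∧ IsOpen (W b) ∧ ContMDiffOn 𝓘(ℝ, EB) 𝓘(ℝ, EP) ∞ (σ b) (W b) ∧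
      ∀ c ∈ W b, E.proj.toFun (σ b c) = c) : E.HasCocycle a (autForm hL σ) := by
  intro γ c hγ hγc h
  obtain rfl : (fun t => E.proj.toFun (γ t)) = c := funext hγc
  obtain ⟨h1, h2, h3, h4⟩ := hσ (E.proj.toFun (γ 0))
  obtain ⟨τ, t1, t2, t3, t4⟩ := exists_time_mapsTo hγ (h2.preimage E.contMDiff_proj.continuous) h1
  set b := E.proj.toFun (γ 0)
  have hγ' : ContMDiff 𝓘(ℝ, ℝ) 𝓘(ℝ, EP) ∞ (fun t => γ (τ t)) := hγ.comp t1.contMDiff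
  have hc : ContMDiff 𝓘(ℝ, ℝ) 𝓘(ℝ, EB) ∞ (fun t => E.proj.toFun (γ t)) := E.contMDiff_proj.comp hγ
  have hc' : ContMDiff 𝓘(ℝ, ℝ) 𝓘(ℝ, EB) ∞ (fun t => E.proj.toFun (γ (τ t))) :=
    E.contMDiff_proj.comp hγ'
  set β : ℝ → P := fun t => σ b (E.proj.toFun (γ (τ t)))
  have hβ : ContMDiff 𝓘(ℝ, ℝ) 𝓘(ℝ, EP) ∞ β :=
    contMDiffOn_univ.1 (h3.comp hc'.contMDiffOn fun t _ => t4 t)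
  have hb0 : E.proj.toFun (γ (τ 0)) = b := by rw [t2]
  have hβ0 : β 0 = σ b b := congrArg (σ b) hb0
  have hvel : vel EP β = deriv' EB EP (σ b) b (vel EB fun t => E.proj.toFun (γ t)) := by
    rw [← one_smul ℝ (vel EB fun t => E.proj.toFun (γ t)), ← vel_comp_time hc t2 t3]
    have := deriv'_vel_of_mdifferentiableAt (γ := fun t => E.proj.toFun (γ (τ t)))
      (h3.mdifferentiableAt' h2 (t4 0)) (hc'.mdifferentiableAt' 0)
    rw [hb0] at this
    exact this.symm
  set X := autForm hL σ b (vel EB fun t => E.proj.toFun (γ t))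
  have hX : ∀ h, a.ev (fun t => E.lact h (β t)) = adMap EH h (a.ev β) + cocycle X h := fun h => by
    change a.val (E.lact h (β 0)) (vel EP fun t => E.lact h (β t)) =
      adMap EH h (a.val (β 0) (vel EP β)) + _
    rw [← deriv'_vel (contMDiff_lact_const h) hβ rfl, hvel, hβ0]
    exact (exists_cocycle_of_tangent hL (σ b b) (deriv' EB EP (σ b) b
      (vel EB fun t => E.proj.toFun (γ t)))).choose_spec h
  have hpβ : ∀ t, E.proj.toFun (γ (τ t)) = E.proj.toFun (β t) := fun t => (h4 _ (t4 t)).symm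
  -- Near time `0` the given curve is a left translate, by a curve in `H`, of the curve `β` on the
  -- local section, for which the cocycle is known by construction.
  have h5 := cocycle_of_lact hV (hγ'.ld hβ hpβ) hβ hX h
  have h6 : ∀ t, E.lact (E.ld (γ (τ t)) (β t)) (β t) = γ (τ t) := fun t => ld_lact (hpβ t)
  simp only [h6] at h5
  rw [← LieForm.ev_comp_time _ hγ t2 t3, ← LieForm.ev_comp_time _
    (ContMDiff.lact (E := E) (contMDiff_const (c := h)) hγ) t2 t3]
  exact h5

theorem contMDiffOn_adMap {EN HN N : Type*} [NormedAddCommGroup EN] [NormedSpace ℝ EN]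
    [TopologicalSpace HN] {J : ModelWithCorners ℝ EN HN} [TopologicalSpace N] [ChartedSpace HN N]
    {s : Set N} {x : N → H} {ξ : N → EH} (hx : ContMDiffOn J 𝓘(ℝ, EH) ∞ x s)
    (hξ : ContMDiffOn J 𝓘(ℝ, EH) ∞ ξ s) :
    ContMDiffOn J 𝓘(ℝ, EH) ∞ (fun n => adMap EH (x n) (ξ n)) s := by
  have h1 : ContMDiffOn (𝓘(ℝ, EH).prod 𝓘(ℝ, EH)) 𝓘(ℝ, EH) ∞
      (fun p : H × H => p.2 * p.1 * p.2⁻¹) univ :=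
    ((contMDiff_snd.mul contMDiff_fst).mul contMDiff_snd.inv).contMDiffOn
  have h2 := contMDiffOn_partial_deriv (F := fun g h : H => h * g * h⁻¹) isOpen_univ h1
  have h3 := h2.comp (((contMDiffOn_tangentSpace_iff (x := (1 : H))).2 hξ).prodMk hx)
    (fun n hn => mem_univ _)
  refine (contMDiffOn_tangentSpace_iff (x := (1 : H))).1 (h3.congr fun n hn => ?_)
  exact congrArg (fun k => tmk k _) (by simp [tmk])

theorem contMDiffOn_leftTranslate {EN HN N : Type*} [NormedAddCommGroup EN] [NormedSpace ℝ EN]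
    [TopologicalSpace HN] {J : ModelWithCorners ℝ EN HN} [TopologicalSpace N] [ChartedSpace HN N]
    {s : Set N} {x : N → H} {ξ : N → EH} (hx : ContMDiffOn J 𝓘(ℝ, EH) ∞ x s)
    (hξ : ContMDiffOn J 𝓘(ℝ, EH) ∞ ξ s) :
    ContMDiffOn J 𝓘(ℝ, EH).tangent ∞
      (fun n => tmk (x n) (deriv' EH EH (fun g : H => x n * g) 1 (ξ n))) s := by
  have h1 : ContMDiffOn (𝓘(ℝ, EH).prod 𝓘(ℝ, EH)) 𝓘(ℝ, EH) ∞
      (fun p : H × H => p.2 * p.1) univ :=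
    (contMDiff_snd.mul contMDiff_fst).contMDiffOn
  have h2 := contMDiffOn_partial_deriv (F := fun g h : H => h * g) isOpen_univ h1
  have h3 := h2.comp (((contMDiffOn_tangentSpace_iff (x := (1 : H))).2 hξ).prodMk hx)
    (fun n hn => mem_univ _)
  refine h3.congr fun n hn => ?_
  exact congrArg (fun k => tmk k _) (by simp [tmk])

/-- A form on the base that gives the left cocycle of a smooth form is smooth. -/
theorem autForm_smooth (ha : a.Smooth) {A : AutForm EH H EB B}
    (hA : E.HasCocycle a A) : A.Smooth := by
  rintro ⟨w, k⟩
  obtain ⟨e, he⟩ := E.surjective_proj w.1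
  obtain ⟨W, σ, hW, hb, hσ, -, hσ'⟩ := E.proj.exists_local_section e
  rw [he] at hb
  have hΩ : IsOpen (W ×ˢ (univ : Set H)) := hW.prod isOpen_univ
  have hproj : ContMDiff 𝓘(ℝ, EB).tangent 𝓘(ℝ, EB) ∞ (fun v : TangentBundle 𝓘(ℝ, EB) B => v.1) :=
    Bundle.contMDiff_proj (TangentSpace 𝓘(ℝ, EB))
  set s : Set (TangentBundle 𝓘(ℝ, EB) B × H) := {p | (p.1.1, p.2) ∈ W ×ˢ (univ : Set H)}
  have hs : IsOpen s := hΩ.preimage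
    ((hproj.continuous.comp continuous_fst).prodMk continuous_snd)
  have h1 : ContMDiffOn (𝓘(ℝ, EB).prod 𝓘(ℝ, EH)) 𝓘(ℝ, EP) ∞
      (fun p : B × H => E.lact p.2⁻¹ (σ p.1)) (W ×ˢ (univ : Set H)) :=
    ContMDiffOn.lact contMDiff_snd.inv.contMDiffOn (hσ.comp contMDiffOn_fst fun p hp => hp.1)
  have h2 := ha.comp_contMDiffOn
    (contMDiffOn_partial_deriv (F := fun b h => E.lact h⁻¹ (σ b)) hΩ h1)
  have h3 := (ha.comp_deriv' hW hσ).comp (contMDiffOn_fst (I := 𝓘(ℝ, EB).tangent)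
    (J := 𝓘(ℝ, EH)) (s := s)) (fun p hp => hp.1)
  have hk : ContMDiffOn (𝓘(ℝ, EB).tangent.prod 𝓘(ℝ, EH)) 𝓘(ℝ, EH) ∞
      (fun p : TangentBundle 𝓘(ℝ, EB) B × H => p.2) s := contMDiffOn_snd
  -- Explicit formula: the vector field `A(u)` at `k` is the left translate by `k` of `a(k⁻¹ σ_* u)
  -- - Ad_{k⁻¹} a(σ_* u)`, for a local section `σ`.
  have h4 := contMDiffOn_leftTranslate hk (h2.sub (contMDiffOn_adMap hk.inv h3))
  refine (h4.congr ?_).contMDiffAt (hs.mem_nhds ⟨hb, mem_univ _⟩)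
  rintro ⟨⟨b, u⟩, k⟩ ⟨hw, -⟩
  refine congrArg (tmk k) ?_
  obtain ⟨c, c1, rfl, c3, c4⟩ := exists_curve (E := EB) hW hw u
  have hγ : ContMDiff 𝓘(ℝ, ℝ) 𝓘(ℝ, EP) ∞ (fun t => σ (c t)) :=
    contMDiffOn_univ.1 (hσ.comp c1.contMDiffOn fun t _ => c4 t)
  have h5 := hA _ c hγ (fun t => hσ' _ (c4 t)) k⁻¹
  have h7 : ContMDiffOn 𝓘(ℝ, EB) 𝓘(ℝ, EP) ∞ (fun b => E.lact k⁻¹ (σ b)) W :=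
    ContMDiffOn.lact contMDiffOn_const hσ
  unfold LieForm.ev at h5
  rw [← deriv'_vel_of_mdifferentiableAt (hσ.mdifferentiableAt' hW (c4 0))
    (c1.mdifferentiableAt' 0), ← deriv'_vel_of_mdifferentiableAt
    (h7.mdifferentiableAt' hW (c4 0)) (c1.mdifferentiableAt' 0), c3] at h5
  refine (deriv'_mul_left_cocycle (A (c 0) u) k).symm.trans ?_
  refine congrArg (deriv' EH EH (fun g : H => k * g) 1) ?_
  exact (sub_eq_of_eq_add' h5).symm

include hV hL in
/-- A smooth vertical form that is a cocycle on the left is the first component of a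
2-connection. -/
theorem exists_isTwoConnection (ha : a.Smooth) :
    ∃ A : AutForm EH H EB B, E.IsTwoConnection a A ∧ E.HasCocycle a A := by
  have key : ∀ b, ∃ (W : Set B) (σ : B → P), b ∈ W ∧ IsOpen W ∧
      ContMDiffOn 𝓘(ℝ, EB) 𝓘(ℝ, EP) ∞ σ W ∧ ∀ c ∈ W, E.proj.toFun (σ c) = c := fun b => by
    obtain ⟨e, rfl⟩ := E.surjective_proj b
    obtain ⟨W, σ, hW, hb, hσ, -, hσ'⟩ := E.proj.exists_local_section e
    exact ⟨W, σ, hb, hW, hσ, hσ'⟩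
  choose W σ hσ using key
  have hA := autForm_spec hV hL hσ
  refine ⟨autForm hL σ, ⟨ha, autForm_smooth ha hA, fun e ξ => ?_, fun h e v => ?_⟩, hA⟩
  · obtain ⟨g, hg, h0, rfl⟩ := exists_curve_one (EH := EH) (H := H) ξ
    have h1 := hV e g hg h0
    unfold LieForm.ev at h1
    have h2 : ContMDiff 𝓘(ℝ, EH) 𝓘(ℝ, EP) ∞ (fun g : H => E.lact g e) :=
      contMDiff_id.lact contMDiff_const
    rw [← deriv'_vel h2 hg h0] at h1
    simp only [h0, E.one_lact] at h1
    exact h1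
  · obtain ⟨γ, hγ, rfl, rfl, -⟩ := exists_curve (E := EP) isOpen_univ (mem_univ e) v
    have h1 := hA γ _ hγ (fun _ => rfl) h
    unfold LieForm.ev at h1
    rw [← deriv'_vel (contMDiff_lact_const h) hγ rfl, ← deriv'_vel E.contMDiff_proj hγ rfl] at h1
    exact h1

end Bibundle

/-! ### Inner derivations after left translation. -/

section LieGroupCalculus

variable {EH H : Type*}
  [NormedAddCommGroup EH] [NormedSpace ℝ EH] [TopologicalSpace H] [ChartedSpace EH H] [Group H]
  [LieGroup 𝓘(ℝ, EH) ∞ H]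

theorem deriv'_mul_left_vel (k : H) {g : ℝ → H} (hg : ContMDiff 𝓘(ℝ, ℝ) 𝓘(ℝ, EH) ∞ g)
    (h0 : g 0 = k) :
    deriv' EH EH (fun x : H => k * x) 1 (vel EH fun t => k⁻¹ * g t) = vel EH g := by
  have h1 : ContMDiff 𝓘(ℝ, ℝ) 𝓘(ℝ, EH) ∞ (fun t => k⁻¹ * g t) := contMDiff_const.mul hg
  rw [deriv'_vel contMDiff_mul_left h1 (by simp [h0])]
  simp only [mul_inv_cancel_left]

/-- Left translation by `k⁻¹` turns `g k g⁻¹` into the product of `k⁻¹ g k` and `g⁻¹`, two curves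
through `1`. -/
theorem adField_eq (ξ : EH) (k : H) :
    (adField EH (H := H) ξ k : EH) =
      deriv' EH EH (fun x : H => k * x) 1 (adMap EH k⁻¹ ξ - ξ) := by
  obtain ⟨g, hg, h0, rfl⟩ := exists_curve_one (EH := EH) (H := H) ξ
  have h1 : ContMDiff 𝓘(ℝ, EH) 𝓘(ℝ, EH) ∞ (fun x : H => x * k * x⁻¹) :=
    (contMDiff_id.mul contMDiff_const).mul contMDiff_id.inv
  have h2 : ContMDiff 𝓘(ℝ, ℝ) 𝓘(ℝ, EH) ∞ (fun t => g t * k * (g t)⁻¹) := h1.comp hg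
  refine (deriv'_vel h1 hg h0).trans ?_
  rw [← deriv'_mul_left_vel k h2 (by simp [h0])]
  have h3 : ∀ t, k⁻¹ * (g t * k * (g t)⁻¹) = k⁻¹ * g t * k⁻¹⁻¹ * (g t)⁻¹ := fun t => by group
  simp only [h3]
  rw [vel_mul_of_one (hg.conj k⁻¹) hg.inv (by simp [h0]) (by simp [h0])]
  rw [adMap_vel _ hg h0, sub_eq_add_neg, ← vel_inv hg h0]

end LieGroupCalculus

/-! ### A multiplicative form gives a bundle gerbe connection. -/

namespace BundleGerbe

variable {EM EY F EH EP M Y H P : Type*}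
  [NormedAddCommGroup EM] [NormedSpace ℝ EM] [NormedAddCommGroup EY] [NormedSpace ℝ EY]
  [NormedAddCommGroup F] [NormedSpace ℝ F]
  [NormedAddCommGroup EH] [NormedSpace ℝ EH] [NormedAddCommGroup EP] [NormedSpace ℝ EP]
  [TopologicalSpace M] [ChartedSpace EM M] [IsManifold 𝓘(ℝ, EM) ∞ M]
  [TopologicalSpace Y] [ChartedSpace EY Y] [IsManifold 𝓘(ℝ, EY) ∞ Y]
  [TopologicalSpace H] [ChartedSpace EH H] [Group H] [LieGroup 𝓘(ℝ, EH) ∞ H]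
  [TopologicalSpace P] [ChartedSpace EP P] [IsManifold 𝓘(ℝ, EP) ∞ P]
  {π : Submersion F EY EM Y M} {G : BundleGerbe EH H EP P π} {a : LieForm EH H EP P}
  {A : AutForm EH H (EY × F) (FibSq π)}

section

variable (hM : ∀ m, G.IsMultiplicativeAt a m) (hA : G.E.HasCocycle a A)
include hM hA

/-- Evaluate `a` on `(h γ) γ' = h (γ γ')`. Multiplicativity on both sides leaves `T_{A₁₂}(h) =
T_{A₁₃}(h)` for every `h`, the other terms being equal because `φ_{h e} = Ad_h φ_e`. -/
theorem autForm_src_eq {γ γ' : ℝ → P} (hγ : ContMDiff 𝓘(ℝ, ℝ) 𝓘(ℝ, EP) ∞ γ)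
    (hγ' : ContMDiff 𝓘(ℝ, ℝ) 𝓘(ℝ, EP) ∞ γ') (hc : ∀ t, G.tgt (γ t) = G.src (γ' t))
    {c d : ℝ → FibSq π} (h1 : ∀ t, G.E.proj.toFun (γ t) = c t)
    (h2 : ∀ t, G.E.proj.toFun (G.mul (γ t) (γ' t)) = d t) :
    A (c 0) (vel (EY × F) c) = A (d 0) (vel (EY × F) d) := by
  refine cocycle_injective fun h => ?_
  have h3 := hA _ d (hγ.gerbe_mul hγ' hc) h2 h
  simp only [← lact_mul _ (hc _)] at h3
  rw [hM _ _ _ (contMDiff_const.lact hγ) hγ' (fun t => by rw [tgt_lact, hc]) rfl,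
    hM _ _ _ hγ hγ' hc rfl, hA γ c hγ h1 h, Bibundle.dphi_lact, map_add] at h3
  have h4 := h3
  rw [add_right_comm, add_left_cancel_iff] at h4
  exact h4

/-- Evaluate `a` on `(γ ◁ h) γ' = γ (h γ')`, where `γ ◁ h = φ_γ(h) γ` is a left translate by a
moving group element. The terms in `a(γ')` cancel, and what remains is `A₂₃ = (A₁₂)^r` expressed
through cocycles. -/
theorem dphi_cocycle (hV : ∀ e, G.E.IsVerticalAt a e) {γ γ' : ℝ → P}
    (hγ : ContMDiff 𝓘(ℝ, ℝ) 𝓘(ℝ, EP) ∞ γ) (hγ' : ContMDiff 𝓘(ℝ, ℝ) 𝓘(ℝ, EP) ∞ γ')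
    (hc : ∀ t, G.tgt (γ t) = G.src (γ' t)) {c d : ℝ → FibSq π}
    (h1 : ∀ t, G.E.proj.toFun (γ t) = c t) (h2 : ∀ t, G.E.proj.toFun (γ' t) = d t) (h : H) :
    G.E.dphi (γ 0) (_root_.cocycle (A (d 0) (vel (EY × F) d)) h) =
      _root_.cocycle (A (c 0) (vel (EY × F) c)) (G.E.phi (γ 0) h) +
        (adMap EH (G.E.phi (γ 0) h) (a.ev γ) - a.ev γ) -
        vel EH (fun t => G.E.phi (γ t) h * (G.E.phi (γ 0) h)⁻¹) := by
  have h3 := hM _ γ _ hγ (ContMDiff.lact (E := G.E) (contMDiff_const (c := h)) hγ')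
    (fun t => by rw [src_lact, hc]) rfl
  simp only [← ract_mul _ (hc _)] at h3
  rw [hM _ _ _ (hγ.ract contMDiff_const) hγ' (fun t => by rw [tgt_ract, hc]) rfl,
    hA γ' d hγ' h2 h] at h3
  simp only [← Bibundle.phi_lact_eq] at h3
  -- Infinitesimal form of `φ_e(h) φ_e(g) φ_e(h)⁻¹ = φ_e(h g h⁻¹)`.
  have h4 : G.E.dphi (G.E.lact (G.E.phi (γ 0) h) (γ 0)) (a.ev γ') =
      G.E.dphi (γ 0) (adMap EH h (a.ev γ')) := by
    rw [Bibundle.dphi_lact]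
    obtain ⟨g, hg, h0, hgv⟩ := exists_curve_one (EH := EH) (H := H) (a.ev γ')
    rw [← hgv, Bibundle.dphi_vel _ hg h0, adMap_vel _ hg h0,
      Bibundle.dphi_vel _ (hg.conj h) (by simp [h0]),
      adMap_vel _ (contMDiff_const.phi hg) (by simp [h0, Bibundle.phi_one])]
    have h5 : (G.E.phi (γ 0) h)⁻¹ = G.E.phi (γ 0) h⁻¹ :=
      (map_inv (G.E.phiEquiv (γ 0)) h).symm
    simp only [Bibundle.phi_mul, h5]
  rw [h4, Bibundle.ev_lact hV (hγ.phi contMDiff_const) hγ, hA γ c hγ h1, map_add] at h3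
  have h6 : ∀ x y z w s t u : EH, x + y - z + w = s + (w + t) → t = y + (x - s) - z := by
    intro x y z w s t _ h
    have : s + t = x + y - z := by
      have := congrArg (· - w) h
      simp only [add_sub_cancel_right] at this
      rw [this]; abel
    rw [← sub_eq_of_eq_add' this.symm]; abel
  exact h6 _ _ _ _ _ _ 0 h3

/-- This is `dphi_cocycle` at `h⁻¹`, left-translated by `φ_{γ(0)}(h)`: a vector field at a point is
the left translate of its cocycle at the inverse of that point. -/
theorem rightForm_apply (hV : ∀ e, G.E.IsVerticalAt a e) {γ γ' : ℝ → P}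
    (hγ : ContMDiff 𝓘(ℝ, ℝ) 𝓘(ℝ, EP) ∞ γ) (hγ' : ContMDiff 𝓘(ℝ, ℝ) 𝓘(ℝ, EP) ∞ γ')
    (hc : ∀ t, G.tgt (γ t) = G.src (γ' t)) {c d : ℝ → FibSq π}
    (h1 : ∀ t, G.E.proj.toFun (γ t) = c t) (h2 : ∀ t, G.E.proj.toFun (γ' t) = d t) (h : H) {x y : EH}
    (hx : x = (A (c 0) (vel (EY × F) c)).1 (G.E.phi (γ 0) h))
    (hy : y = adField EH (a.ev γ) (G.E.phi (γ 0) h)) :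
    deriv' EH EH (G.E.phi (γ 0)) h ((A (d 0) (vel (EY × F) d)).1 h : EH) =
      x + y + vel EH (fun t => G.E.phi (γ t) h) := by
  have hinv : ∀ t, G.E.phi (γ t) h⁻¹ = (G.E.phi (γ t) h)⁻¹ := fun t =>
    map_inv (G.E.phiEquiv (γ t)) h
  have hφ : ContMDiff 𝓘(ℝ, ℝ) 𝓘(ℝ, EH) ∞ (fun t => G.E.phi (γ t) h) := hγ.phi contMDiff_const
  have hkφ : ContMDiff 𝓘(ℝ, ℝ) 𝓘(ℝ, EH) ∞ (fun t => (G.E.phi (γ 0) h)⁻¹ * G.E.phi (γ t) h) :=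
    contMDiff_const.mul hφ
  have h3 := dphi_cocycle hM hA hV hγ hγ' hc h1 h2 h⁻¹
  have h4 : ∀ t, (G.E.phi (γ t) h)⁻¹ * (G.E.phi (γ 0) h)⁻¹⁻¹ =
      ((G.E.phi (γ 0) h)⁻¹ * G.E.phi (γ t) h)⁻¹ := fun t => by group
  simp only [hinv, h4] at h3
  rw [vel_inv hkφ (by simp), sub_neg_eq_add] at h3
  rw [hx, hy, ← deriv'_mul_left_cocycle, adField_eq,
    ← deriv'_mul_left_cocycle (A (c 0) (vel (EY × F) c)), ← deriv'_mul_left_vel _ hφ rfl, ← map_add, ← map_add]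
  refine Eq.trans ?_ (congrArg _ h3)
  obtain ⟨g, hg, h0, hgv⟩ := exists_curve_one (EH := EH) (H := H)
    (_root_.cocycle (A (d 0) (vel (EY × F) d)) h⁻¹)
  have hhg : ContMDiff 𝓘(ℝ, ℝ) 𝓘(ℝ, EH) ∞ (fun t => h * g t) := contMDiff_const.mul hg
  rw [← hgv, Bibundle.dphi_vel _ hg h0, deriv'_vel contMDiff_mul_left hg h0,
    deriv'_vel (Bibundle.contMDiff_phi (γ 0)) hhg (by simp [h0]),
    deriv'_vel contMDiff_mul_left (contMDiff_const.phi hg) (by simp [h0, Bibundle.phi_one])]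
  simp only [Bibundle.phi_mul]

end

/-- A smooth vertical multiplicative form, which is a cocycle on the left with respect to a form on
the base, is a bundle gerbe connection. -/
theorem isConnection_of_multiplicative (hM : ∀ m, G.IsMultiplicativeAt a m)
    (hV : ∀ e, G.E.IsVerticalAt a e) (hA : G.E.HasCocycle a A) (h2 : G.E.IsTwoConnection a A) :
    G.IsConnection a A where
  isTwoConnection := h2
  summable := by
    intro e v h
    -- The equation only involves a vector on `ℰ₁₂`. A local section of `ℰ` near the image in the
    -- `(2,3)` slot supplies the composable curve `γ'` that the argument needs.
    obtain ⟨e', he'⟩ := G.E.surjective_proj (p23 π e.fst)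
    obtain ⟨W, σ, hW, hb, hσ, -, hσ'⟩ := G.E.proj.exists_local_section e'
    rw [he'] at hb
    have hf : ContMDiff 𝓘(ℝ, ((EY × F) × F) × EH) 𝓘(ℝ, (EY × F) × F) ∞
        (FibProd.fst : FibProd (p12 π) G.E.proj → FibCube π) := FibProd.contMDiff_fst
    have hs : ContMDiff 𝓘(ℝ, ((EY × F) × F) × EH) 𝓘(ℝ, EP) ∞
        (FibProd.snd : FibProd (p12 π) G.E.proj → P) := FibProd.contMDiff_snd
    have h23 : ContMDiff 𝓘(ℝ, ((EY × F) × F) × EH) 𝓘(ℝ, EY × F) ∞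
        (fun q : FibProd (p12 π) G.E.proj => p23 π q.fst) := (p23 π).contMDiff.comp hf
    obtain ⟨q, q1, rfl, rfl, q4⟩ := exists_curve (E := ((EY × F) × F) × EH)
      (hW.preimage h23.continuous) hb v
    have k1 : ContMDiff 𝓘(ℝ, ℝ) 𝓘(ℝ, EP) ∞ (fun t => (q t).snd) := hs.comp q1
    have k2 : ContMDiff 𝓘(ℝ, ℝ) 𝓘(ℝ, EP) ∞ (fun t => σ (p23 π (q t).fst)) := by
      rw [← contMDiffOn_univ]
      exact hσ.comp (h23.comp q1).contMDiffOn fun t _ => q4 t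
    have k3 : ∀ t, G.E.proj.toFun (q t).snd = p12 π (q t).fst := fun t => (q t).comm.symm
    have k4 : ∀ t, G.E.proj.toFun (σ (p23 π (q t).fst)) = p23 π (q t).fst := fun t => hσ' _ (q4 t)
    have k5 := rightForm_apply hM hA hV k1 k2
      (fun t => (congrArg FibProd.snd (k3 t)).trans (congrArg FibProd.fst (k4 t)).symm) k3 k4 h rfl rfl
    have k6 : deriv' (((EY × F) × F) × EH) ((EY × F) × F)
        (FibProd.fst : FibProd (p12 π) G.E.proj → FibCube π) (q 0) (vel _ q) =
        vel _ (fun t => (q t).fst) := deriv'_vel hf q1 rfl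
    have k7 : deriv' (((EY × F) × F) × EH) EP
        (FibProd.snd : FibProd (p12 π) G.E.proj → P) (q 0) (vel _ q) =
        vel _ (fun t => (q t).snd) := deriv'_vel hs q1 rfl
    have hqf : ContMDiff 𝓘(ℝ, ℝ) 𝓘(ℝ, (EY × F) × F) ∞ (fun t => (q t).fst) := hf.comp q1
    have k8 : deriv' ((EY × F) × F) (EY × F) (p12 π) (q 0).fst (vel _ (fun t => (q t).fst)) =
        vel _ (fun t => p12 π (q t).fst) := deriv'_vel (p12 π).contMDiff hqf rfl
    have k9 : deriv' ((EY × F) × F) (EY × F) (p23 π) (q 0).fst (vel _ (fun t => (q t).fst)) =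
        vel _ (fun t => p23 π (q t).fst) := deriv'_vel (p23 π).contMDiff hqf rfl
    have k10 : deriv' (((EY × F) × F) × EH) EH
        (fun r : FibProd (p12 π) G.E.proj => G.E.phi r.snd h) (q 0) (vel _ q) =
        vel _ (fun t => G.E.phi (q t).snd h) := deriv'_vel (hs.phi contMDiff_const) q1 rfl
    rw [← k8, ← k9, ← k10, ← k6] at k5
    unfold LieForm.ev at k5
    rw [← k7] at k5
    exact k5
  sum_eq := by
    funext z
    refine ContinuousLinearMap.ext fun v => ?_
    -- A curve in `ℰ₁₂ ⊕ ℰ₂₃` is a pair of composable curves in `ℰ`, so the equation is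
    -- multiplicativity along that pair.
    obtain ⟨ζ, ζ1, rfl, rfl, -⟩ := exists_curve (E := (((EY × F) × F) × EH) × EH) isOpen_univ
      (mem_univ z) v
    have f1 : ContMDiff 𝓘(ℝ, (((EY × F) × F) × EH) × EH) 𝓘(ℝ, ((EY × F) × F) × EH) ∞
        (FibProd.fst : Bibundle.Sum (G.E.pullback (p12 π)) (G.E.pullback (p23 π)) → _) :=
      FibProd.contMDiff_fst
    have f2 : ContMDiff 𝓘(ℝ, (((EY × F) × F) × EH) × EH) 𝓘(ℝ, ((EY × F) × F) × EH) ∞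
        (FibProd.snd : Bibundle.Sum (G.E.pullback (p12 π)) (G.E.pullback (p23 π)) → _) :=
      FibProd.contMDiff_snd
    have g1 : ContMDiff 𝓘(ℝ, ((EY × F) × F) × EH) 𝓘(ℝ, EP) ∞
        (FibProd.snd : FibProd (p12 π) G.E.proj → P) := FibProd.contMDiff_snd
    have g2 : ContMDiff 𝓘(ℝ, ((EY × F) × F) × EH) 𝓘(ℝ, EP) ∞
        (FibProd.snd : FibProd (p23 π) G.E.proj → P) := FibProd.contMDiff_snd
    have g3 : ContMDiff 𝓘(ℝ, ((EY × F) × F) × EH) 𝓘(ℝ, EP) ∞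
        (FibProd.snd : FibProd (p13 π) G.E.proj → P) := FibProd.contMDiff_snd
    have f3 := G.f.contMDiff
    have c1 : ContMDiff 𝓘(ℝ, ℝ) 𝓘(ℝ, ((EY × F) × F) × EH) ∞ (fun t => (ζ t).fst) := f1.comp ζ1
    have c2 : ContMDiff 𝓘(ℝ, ℝ) 𝓘(ℝ, ((EY × F) × F) × EH) ∞ (fun t => (ζ t).snd) := f2.comp ζ1
    have c3 : ContMDiff 𝓘(ℝ, ℝ) 𝓘(ℝ, ((EY × F) × F) × EH) ∞
        (fun t => G.f.toFun (Bibundle.Prod.mk (ζ t))) := f3.comp ζ1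
    have hc : ∀ t, G.tgt (ζ t).fst.snd = G.src (ζ t).snd.snd := fun t => by
      have h3 := (ζ t).fst.comm
      have h4 := (ζ t).snd.comm
      have h5 : (ζ t).fst.fst = (ζ t).snd.fst := (ζ t).comm
      rw [← h5] at h4
      exact (congrArg FibProd.snd h3).symm.trans (congrArg FibProd.fst h4)
    have k1 := hM _ (fun t => (ζ t).fst.snd) (fun t => (ζ t).snd.snd) (g1.comp c1) (g2.comp c2)
      hc rfl
    have k2 : ∀ t, G.mul (ζ t).fst.snd (ζ t).snd.snd =
        (G.f.toFun (Bibundle.Prod.mk (ζ t))).snd := fun t => mul_eq_of_pair (hc t) rfl rfl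
    simp only [k2] at k1
    unfold LieForm.ev at k1
    rw [← deriv'_vel g3 c3 rfl, ← deriv'_vel g1 c1 rfl, ← deriv'_vel g2 c2 rfl,
      ← deriv'_vel f1 ζ1 rfl, ← deriv'_vel f2 ζ1 rfl, ← deriv'_vel f3 ζ1 rfl] at k1
    exact k1.symm
  snd_eq := by
    funext y
    refine LinearMap.ext fun u => ?_
    -- Local sections over the `(1,2)` and `(2,3)` slots lift a curve in `Y^{[3]}` to a composable
    -- pair, whose product lies over the `(1,3)` slot.
    obtain ⟨e, he⟩ := G.E.surjective_proj (p12 π y)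
    obtain ⟨e', he'⟩ := G.E.surjective_proj (p23 π y)
    obtain ⟨W, σ, hW, hb, hσ, -, hσ'⟩ := G.E.proj.exists_local_section e
    obtain ⟨W', τ, hW', hb', hτ, -, hτ'⟩ := G.E.proj.exists_local_section e'
    rw [he] at hb
    rw [he'] at hb'
    obtain ⟨ζ, ζ1, rfl, rfl, ζ4⟩ := exists_curve (E := (EY × F) × F)
      ((hW.preimage (p12 π).contMDiff.continuous).inter
        (hW'.preimage (p23 π).contMDiff.continuous)) ⟨hb, hb'⟩ u
    have k1 : ContMDiff 𝓘(ℝ, ℝ) 𝓘(ℝ, EP) ∞ (fun t => σ (p12 π (ζ t))) := by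
      rw [← contMDiffOn_univ]
      exact hσ.comp ((p12 π).contMDiff.comp ζ1).contMDiffOn fun t _ => (ζ4 t).1
    have k2 : ContMDiff 𝓘(ℝ, ℝ) 𝓘(ℝ, EP) ∞ (fun t => τ (p23 π (ζ t))) := by
      rw [← contMDiffOn_univ]
      exact hτ.comp ((p23 π).contMDiff.comp ζ1).contMDiffOn fun t _ => (ζ4 t).2
    have k3 : ∀ t, G.E.proj.toFun (σ (p12 π (ζ t))) = p12 π (ζ t) := fun t => hσ' _ (ζ4 t).1
    have k4 : ∀ t, G.E.proj.toFun (τ (p23 π (ζ t))) = p23 π (ζ t) := fun t => hτ' _ (ζ4 t).2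
    have k5 : ∀ t, G.tgt (σ (p12 π (ζ t))) = G.src (τ (p23 π (ζ t))) := fun t =>
      (congrArg FibProd.snd (k3 t)).trans (congrArg FibProd.fst (k4 t)).symm
    have k6 : ∀ t, G.E.proj.toFun (G.mul (σ (p12 π (ζ t))) (τ (p23 π (ζ t)))) = p13 π (ζ t) :=
      fun t => by
        have l1 : G.src (σ (p12 π (ζ t))) = (p12 π (ζ t)).fst := congrArg FibProd.fst (k3 t)
        have l2 : G.tgt (τ (p23 π (ζ t))) = (p23 π (ζ t)).snd := congrArg FibProd.snd (k4 t)
        exact FibProd.ext ((src_mul (k5 t)).trans l1) ((tgt_mul (k5 t)).trans l2)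
    have k7 := autForm_src_eq hM hA k1 k2 k5 k3 k6
    rw [← deriv'_vel (p12 π).contMDiff ζ1 rfl, ← deriv'_vel (p13 π).contMDiff ζ1 rfl] at k7
    exact k7

end BundleGerbe

end

theorem mainTheorem1
    {EM EY F EH EP M Y H P : Type*}
    [NormedAddCommGroup EM] [NormedSpace ℝ EM] [FiniteDimensional ℝ EM]
    [NormedAddCommGroup EY] [NormedSpace ℝ EY] [FiniteDimensional ℝ EY]
    [NormedAddCommGroup F] [NormedSpace ℝ F] [FiniteDimensional ℝ F]
    [NormedAddCommGroup EH] [NormedSpace ℝ EH] [FiniteDimensional ℝ EH]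
    [NormedAddCommGroup EP] [NormedSpace ℝ EP] [FiniteDimensional ℝ EP]
    [TopologicalSpace M] [T2Space M] [SecondCountableTopology M]
    [ChartedSpace EM M] [IsManifold 𝓘(ℝ, EM) ∞ M]
    [TopologicalSpace Y] [T2Space Y] [SecondCountableTopology Y]
    [ChartedSpace EY Y] [IsManifold 𝓘(ℝ, EY) ∞ Y]
    [TopologicalSpace H] [ChartedSpace EH H] [Group H] [LieGroup 𝓘(ℝ, EH) ∞ H]
    [TopologicalSpace P] [ChartedSpace EP P] [IsManifold 𝓘(ℝ, EP) ∞ P]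
    (π : Submersion F EY EM Y M) (hπ : Function.Surjective π.toFun)
    (G : BundleGerbe EH H EP P π) :
    ∃ (a : LieForm EH H EP P) (A : AutForm EH H (EY × F) (FibSq π)), G.IsConnection a A := by
  obtain ⟨a, ha, hV, hL, hM⟩ := BundleGerbe.exists_multiplicative_form hπ G
  obtain ⟨A, h2, hA⟩ := Bibundle.exists_isTwoConnection hV hL ha
  exact ⟨a, A, BundleGerbe.isConnection_of_multiplicative hM hV hA h2⟩
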